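/- Let $\mathbb{S}^5\subset\mathbb{C}^3$ be the unit sphere with its standard metric, contact form $\alpha_p(V)=\langle ip,V\rangle$, Reeb field $\mathbf{R}_p=ip$ and the tensor $J(V)=i\,(V-\alpha(V)\mathbf{R})$. Let $\Sigma$ be a smooth surface (a second countable Hausdorff smooth 2-manifold without boundary) and $f:\Sigma\to\mathbb{S}^5$ a smooth Legendrian immersion, i.e. an immersion with $\alpha(df(v))=0$ for all $v\in T\Sigma$. Let $B$ be its second fundamental form in $\mathbb{S}^5$, $H=\operatorname{trace}B$ its mean curvature vector (so that $JH$ is tangent to $\Sigma$), $\nabla$ the Levi-Civita connection of the induced metric and $d\mu_f$ its area element. A Legendrian deformation of $f$ is a smooth family $(f_t)_{|t|<\varepsilon}$ of Legendrian immersions $f_t:\Sigma\to\mathbb{S}^5$ with $f_0=f$ and with $f_t=f$ outside a compact set $K\subset\Sigma$ independent of $t$. The immersion $f$ is called csL if it is a critical point of the area under Legendrian deformations, that is, $\frac{d}{dt}\big|_{t=0}\int_K d\mu_{f_t}=0$ for all such deformations (the Euler-Lagrange equation is $\operatorname{Div}(JH)=0$), and it is called csL Willmore if it is a critical point of the Willmore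 functional $W(f)=\int\left(\frac14|H|^2+1\right)d\mu_f$ under Legendrian deformations, that is, $\frac{d}{dt}\big|_{t=0}\int_K\left(\frac14|H_{f_t}|^2+1\right)d\mu_{f_t}=0$ for all such deformations. Suppose that $f$ is csL and that $\operatorname{trace}\langle B(\cdot,\nabla_\cdot(JH)),H\rangle=0$ everywhere on $\Sigma$, the trace being taken with respect to the induced metric. Then $f$ is csL Willmore. -/

import Mathlib

open scoped Manifold ContDiff
open MeasureTheory Set

noncomputable section

namespace LegendrianSurface

/-- The parameter plane `ℝ²`. -/
abbrev Plane : Type := EuclideanSpace ℝ (Fin 2)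

/-- The complex space `ℂ³`; `inner ℝ V W` is its Euclidean inner product `Re ⟨V, W⟩`, and `S⁵` is its
unit sphere. -/
abbrev C3 : Type := EuclideanSpace ℂ (Fin 3)

/-! ### The standard contact structure of the unit sphere -/

/-- The Reeb field `R_p = i p`. -/
def reeb (p : C3) : C3 := Complex.I • p

/-- The contact form `α_p(V) = ⟪i p, V⟫ = ∑ (x_j dy_j - y_j dx_j)(V)`. -/
def contactForm (p V : C3) : ℝ := inner ℝ (reeb p) V

/-- The tensor `J` of the contact structure: projection to the contact plane along the Reeb field,
followed by multiplication by `i`. -/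
def contactJ (p V : C3) : C3 := Complex.I • (V - contactForm p V • reeb p)

/-! ### Geometry of a parametrized immersion `F` of (an open part of) `ℝ²` in `S⁵` -/

/-- The coordinate vector `e_i` of `ℝ²`. -/
def coordVec (i : Fin 2) : Plane := EuclideanSpace.single i 1

/-- The matrix `g_ij = ⟪∂_i F, ∂_j F⟫` of the induced metric. -/
def gram (F : Plane → C3) (p : Plane) : Matrix (Fin 2) (Fin 2) ℝ :=
  Matrix.of fun i j => inner ℝ (fderiv ℝ F p (coordVec i)) (fderiv ℝ F p (coordVec j))

/-- The area density `√(det g)`. -/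
def areaDensity (F : Plane → C3) (p : Plane) : ℝ := Real.sqrt (gram F p).det

/-- The tangential part of an ambient vector `W`, as a vector in the parameter plane: the vector
`v` with `⟪W, dF w⟫ = ⟪dF v, dF w⟫` for all `w`, that is `v = ∑ g^{ij} ⟪W, ∂_i F⟫ e_j`. -/
def tangentPart (F : Plane → C3) (p : Plane) (W : C3) : Plane :=
  ∑ i, ∑ j, ((gram F p)⁻¹ i j * inner ℝ W (fderiv ℝ F p (coordVec i))) • coordVec j

/-- The component of an ambient vector that is normal to the surface and tangent to `S⁵`. -/
def normalPart (F : Plane → C3) (p : Plane) (W : C3) : C3 :=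
  W - fderiv ℝ F p (tangentPart F p W) - (inner ℝ W (F p) : ℝ) • F p

/-- The second fundamental form `B(v, w)` in `S⁵`: the normal part of the second derivative. -/
def secondFF (F : Plane → C3) (p : Plane) (v w : Plane) : C3 :=
  normalPart F p (fderiv ℝ (fderiv ℝ F) p v w)

/-- The mean curvature vector `H = trace B = ∑ g^{ij} B(e_i, e_j)`. -/
def meanCurv (F : Plane → C3) (p : Plane) : C3 :=
  ∑ i, ∑ j, (gram F p)⁻¹ i j • secondFF F p (coordVec i) (coordVec j)

/-- `JH` as a vector field in the parameter plane (`JH` is tangent to a Legendrian surface). -/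
def fieldJH (F : Plane → C3) (p : Plane) : Plane :=
  tangentPart F p (contactJ (F p) (meanCurv F p))

/-- The Levi-Civita derivative `∇_v X` of the induced metric: the tangential part of the derivative
of `dF(X)` in direction `v`. -/
def covDeriv (F : Plane → C3) (X : Plane → Plane) (p v : Plane) : Plane :=
  tangentPart F p (fderiv ℝ (fun q => fderiv ℝ F q (X q)) p v)

/-- `trace ⟨B(·, ∇_· (JH)), H⟩`, the trace being taken with the induced metric. -/
def traceTerm (F : Plane → C3) (p : Plane) : ℝ :=
  ∑ i, ∑ j, (gram F p)⁻¹ i j *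
    inner ℝ (secondFF F p (coordVec i) (covDeriv F (fieldJH F) p (coordVec j))) (meanCurv F p)

/-! ### Immersions of an abstract surface `M` -/

section Surface

variable {M : Type*} [TopologicalSpace M] [ChartedSpace Plane M]

/-- The map `f` read in the chart of `M` at `c`. -/
def inChart (f : M → C3) (c : M) : Plane → C3 := f ∘ (extChartAt (𝓡 2) c).symm

/-- The mean curvature vector of `f` at `x`. -/
def meanCurvAt (f : M → C3) (x : M) : C3 :=
  meanCurv (inChart f x) (extChartAt (𝓡 2) x x)

/-- `trace ⟨B(·, ∇_· (JH)), H⟩` at the point `x`. -/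
def traceTermAt (f : M → C3) (x : M) : ℝ :=
  traceTerm (inChart f x) (extChartAt (𝓡 2) x x)

/-- `f` is a smooth Legendrian immersion of the surface `M` in `S⁵`. -/
structure IsLegendrianImmersion (f : M → C3) : Prop where
  smooth : ContMDiff (𝓡 2) 𝓘(ℝ, C3) ∞ f
  mem_sphere : ∀ x, f x ∈ Metric.sphere (0 : C3) 1
  immersion : ∀ x, Function.Injective (mfderiv (𝓡 2) 𝓘(ℝ, C3) f x)
  isotropic : ∀ (x : M) (v : TangentSpace (𝓡 2) x),
    contactForm (f x) (mfderiv (𝓡 2) 𝓘(ℝ, C3) f x v) = 0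

/-- `F` is a smooth deformation `(F t)`, `|t| < ε`, of `f` through Legendrian immersions which is
constant outside `K`. -/
structure IsLegendrianVariation (f : M → C3) (ε : ℝ) (K : Set M) (F : ℝ → M → C3) : Prop where
  smooth : ContMDiffOn (𝓘(ℝ, ℝ).prod (𝓡 2)) 𝓘(ℝ, C3) ∞ (fun z : ℝ × M => F z.1 z.2)
    (Ioo (-ε) ε ×ˢ univ)
  initial : F 0 = f
  legendrian : ∀ t ∈ Ioo (-ε) ε, IsLegendrianImmersion (F t)
  support : ∀ t ∈ Ioo (-ε) ε, ∀ x ∉ K, F t x = f x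

/-- `f` is a critical point, under compactly supported Legendrian deformations, of a functional
`Φ`, where `Φ f K` is the contribution of the part `K` of the surface. -/
def IsLegendrianCritical (Φ : (M → C3) → Set M → ℝ) (f : M → C3) : Prop :=
  ∀ (ε : ℝ) (K : Set M) (F : ℝ → M → C3), 0 < ε → IsCompact K → IsLegendrianVariation f ε K F →
    HasDerivAt (fun t => Φ (F t) K) 0 0

variable [IsManifold (𝓡 2) ∞ M] [T2Space M] [SecondCountableTopology M]
  [MeasurableSpace M] [BorelSpace M]

theorem exists_chartPartition (M : Type*) [TopologicalSpace M] [ChartedSpace Plane M]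
    [IsManifold (𝓡 2) ∞ M] [T2Space M] [SecondCountableTopology M] :
    ∃ ρ : SmoothPartitionOfUnity M (𝓡 2) M univ,
      ρ.IsSubordinate fun x => (chartAt Plane x).source := by
  have : LocallyCompactSpace M := ChartedSpace.locallyCompactSpace Plane M
  exact SmoothPartitionOfUnity.exists_isSubordinate_chartAt_source (𝓡 2) M

/-- A smooth partition of unity of `M` whose member with index `c` is supported in the domain of
the chart at `c`. -/
def chartPartition (M : Type*) [TopologicalSpace M] [ChartedSpace Plane M]
    [IsManifold (𝓡 2) ∞ M] [T2Space M] [SecondCountableTopology M] :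
    SmoothPartitionOfUnity M (𝓡 2) M univ :=
  Classical.choose (exists_chartPartition M)

/-- The area measure `√(det g) dp` of `f` on the domain of the chart at `c`. -/
def chartArea (f : M → C3) (c : M) : Measure M :=
  ((volume.restrict (extChartAt (𝓡 2) c).target).withDensity
    fun p => ENNReal.ofReal (areaDensity (inChart f c) p)).map (extChartAt (𝓡 2) c).symm

/-- The area measure `μ_f` on `M` of the metric induced by `f`, patched together from the charts
with a partition of unity (by the change of variables formula it does not depend on the choice
of the partition). -/
def areaMeasure (f : M → C3) : Measure M :=
  Measure.sum fun c : M =>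
    (chartArea f c).withDensity fun x => ENNReal.ofReal (chartPartition M c x)

/-- The area of the part `K` of the surface. -/
def area (f : M → C3) (K : Set M) : ℝ := ∫ _x in K, (1 : ℝ) ∂(areaMeasure f)

/-- The Willmore energy `∫ (|H|² / 4 + κ) dμ_f` of the part `K` of the surface. Here `κ` is the
sectional curvature of the tangent plane in the ambient space `S⁵`, which is `1`. -/
def willmore (f : M → C3) (K : Set M) : ℝ :=
  ∫ x in K, (1 / 4 * ‖meanCurvAt f x‖ ^ 2 + 1) ∂(areaMeasure f)

/-- Contact stationary Legendrian (csL) surfaces: Legendrian immersions which are critical points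
of the area among Legendrian immersions. -/
def IsCsL (f : M → C3) : Prop :=
  IsLegendrianImmersion f ∧ IsLegendrianCritical area f

/-- csL Willmore surfaces: Legendrian immersions which are critical points of the Willmore
functional under Legendrian deformations. -/
def IsCsLWillmore (f : M → C3) : Prop :=
  IsLegendrianImmersion f ∧ IsLegendrianCritical willmore f

end Surface

end LegendrianSurface

end

set_option linter.unusedSimpArgs false

/-! Everything is expressed through the Legendrian angle θ, the phase of the complex determinant of
`(Φ, ∂₀Φ, ∂₁Φ)`. Only its differential `angleForm` is used; it is closed in the space variables and
the deformation parameter together (`dd_angleForm`). With `Z = ∇θ` (`angleGrad`) one has `H = iZ`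
and `JH = -Z` (`meanCurv_eq`, `contactJ_meanCurv`). Hence `Div(JH) = 0` says that `Z` is divergence
free, and the Willmore integrand is `E = |Z|²/4 + 1`.

Let `V` be the variation field, `Vᵀ` its tangential part and `u = ⟪V, iΦ⟫` its contact Hamiltonian.
The normal part of `V` is governed by `u`, since `⟪V, i∂ₖΦ⟫ = ∂ₖu/2` (`dd_contact`). The area
element varies at the rate `Div Vᵀ - ⟪Z, ∇u⟫/2`, and `|Z|²/2` at the rate `∂_Z(∂ₜθ - ⟪Z, V⟫) + ⟪∂_Z
Z, V⟫`. As `Z` is divergence free, these terms are divergences up to two remainders: `u ⟪∇E, Z⟫/2 =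
u Hess θ(Z, Z)/4`, and the normal part of `⟪∂_Z Z, V⟫/2`. The cubic form `⟪B(·,·), i·⟫` is symmetric
with trace dθ and satisfies the Codazzi equation, so `C = -iB(Z, Z)` has divergence `Hess θ(Z, Z)`
minus twice the trace term of the hypothesis (`sum_dd_density_mul_cubicCoord`, `traceTerm_eq`). If
that term vanishes, the first remainder is `u Div C/4`, and `⟪∇u, C⟫/4` from integrating it by parts
cancels the second one. The variation of the integrand is thus an exact divergence
(`dd_willmoreDensity`).

The vector field inside this divergence does not depend on the chart (`map_flux`). With a partition
of unity χ, each chart contributes minus the integral of `dχ` along the flux, and the sum of the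
`dχ` vanishes near the support of the deformation (`hasDerivAt_willmore`).

Contact stationarity is assumed variationally, so its Euler-Lagrange equation has to be derived
(`IsCsL.isDivergenceFree`). In a chart, the variation of area is half the integral of `u Div Z`, so
deformations with `u ≥ 0` concentrated at a given point are needed. If `Q` is homogeneous of degree
two and depends only on the coordinates `X_j = ⟪w, b_j⟫` for a Lagrangian frame `b`, then `w + t
i∇Q(w)` is an explicit Hamiltonian motion commuting with positive scalings; it preserves cones over
Legendrian surfaces, and radial projection returns to the sphere, with `u = ⟪∇Q(f), f⟫ = 2Q(f)`.
Taking for `b` the vectors `Φ, ∂₀Φ, ∂₁Φ` at the point and `Q = X₀² h((X₁² + X₂²)/X₀²)` with a cutoff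
`h` gives the required bump. -/

namespace LegendrianSurface

/-! ### Multiplication by `i` as a real linear map -/

/-- Multiplication by `i` on `ℂ³`. -/
noncomputable def mulI : C3 →L[ℝ] C3 :=
  LinearMap.toContinuousLinearMap
    { toFun := fun W => Complex.I • W
      map_add' := fun V W => smul_add _ V W
      map_smul' := fun r V => smul_comm _ r V }

theorem mulI_apply (W : C3) : mulI W = Complex.I • W := rfl

theorem mulI_mulI (W : C3) : mulI (mulI W) = -W := by
  simp [mulI_apply, smul_smul]

theorem inner_mulI_left (V W : C3) : inner ℝ (mulI V) W = -inner ℝ V (mulI W) := by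
  simp only [mulI_apply, PiLp.inner_apply, Complex.inner, ← Finset.sum_neg_distrib]
  refine Finset.sum_congr rfl fun i _ => ?_
  simp
  ring

theorem inner_mulI_mulI (V W : C3) : inner ℝ (mulI V) (mulI W) = inner ℝ V W := by
  rw [inner_mulI_left, mulI_mulI, inner_neg_right, neg_neg]

theorem inner_mulI_self (V : C3) : inner ℝ V (mulI V) = 0 := by
  have h := inner_mulI_left V V
  rw [real_inner_comm] at h
  linarith

theorem inner_mulI_right (V W : C3) : inner ℝ V (mulI W) = -inner ℝ (mulI V) W := by
  rw [inner_mulI_left, neg_neg]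

/-! ### Biorthogonal systems -/

/-- Pairing a linear relation with the dual vectors kills its coefficients, so the family is
independent, and by cardinality it is a basis whose coordinates are the pairings. -/
theorem eq_sum_of_biorthogonal {E ι : Type*} [NormedAddCommGroup E] [InnerProductSpace ℝ E]
    [FiniteDimensional ℝ E] [Fintype ι] [DecidableEq ι] (b b' : ι → E)
    (hcard : Fintype.card ι = Module.finrank ℝ E)
    (h : ∀ i j, inner ℝ (b' i) (b j) = if i = j then (1 : ℝ) else 0) (W : E) :
    W = ∑ i, (inner ℝ (b' i) W : ℝ) • b i := by
  have hli : LinearIndependent ℝ b := by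
    rw [Fintype.linearIndependent_iff]
    intro g hg i
    have := congrArg (fun x => inner ℝ (b' i) x) hg
    simpa [inner_sum, inner_smul_right, h] using this
  let B := basisOfLinearIndependentOfCardEqFinrank' b hli hcard
  have hB : ∀ i, B i = b i := fun i => by simp [B]
  have hW := B.sum_repr W
  have hc : ∀ i, inner ℝ (b' i) W = B.repr W i := by
    intro i
    conv_lhs => rw [← hW]
    simp [inner_sum, inner_smul_right, hB, h]
  conv_lhs => rw [← hW]
  simp [hc, hB]

/-- A frame `F, F₀, F₁` of the type of a Legendrian immersion, with the dual frame `F⁰, F¹`. -/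
structure LegendrianFrame (F : C3) (f f' : Fin 2 → C3) : Prop where
  norm : inner ℝ F F = (1 : ℝ)
  base : ∀ i, inner ℝ F (f i) = (0 : ℝ)
  baseI : ∀ i, inner ℝ F (mulI (f i)) = (0 : ℝ)
  lag : ∀ i j, inner ℝ (f i) (mulI (f j)) = (0 : ℝ)
  dual : ∀ i j, inner ℝ (f' i) (f j) = if i = j then (1 : ℝ) else 0
  base' : ∀ i, inner ℝ F (f' i) = (0 : ℝ)
  baseI' : ∀ i, inner ℝ F (mulI (f' i)) = (0 : ℝ)
  lag' : ∀ i j, inner ℝ (f' i) (mulI (f j)) = (0 : ℝ)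

/-- The vectors `F, iF, fᵢ, ifᵢ` are six in number, the real dimension of `ℂ³`, and the Lagrangian
conditions make `F, iF, f'ᵢ, if'ᵢ` biorthogonal to them. -/
theorem LegendrianFrame.expand {F : C3} {f f' : Fin 2 → C3} (h : LegendrianFrame F f f')
    (W : C3) :
    W = (inner ℝ F W : ℝ) • F + (inner ℝ (mulI F) W : ℝ) • mulI F
      + ∑ i, ((inner ℝ (f' i) W : ℝ) • f i + (inner ℝ (mulI (f' i)) W : ℝ) • mulI (f i)) := by
  -- In the index type, `none` stands for the base point, `some i` for a frame vector, and the
  -- Boolean tells whether multiplication by `i` is applied.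
  have key := eq_sum_of_biorthogonal (E := C3) (ι := Option (Fin 2) × Bool)
    (fun x => (if x.2 then mulI else ContinuousLinearMap.id ℝ C3) (x.1.elim F f))
    (fun x => (if x.2 then mulI else ContinuousLinearMap.id ℝ C3) (x.1.elim F f'))
    (by rw [finrank_real_of_complex]; simp) (by
      have h1 := fun i => real_inner_comm F (f' i)
      have h2 : ∀ i j, inner ℝ (mulI (f' i)) (f j) = (0 : ℝ) := fun i j => by
        rw [inner_mulI_left, h.lag', neg_zero]
      have h3 : ∀ i, inner ℝ (mulI F) (f i) = (0 : ℝ) := fun i => by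
        rw [inner_mulI_left, h.baseI, neg_zero]
      have h4 : ∀ i, inner ℝ (mulI (f' i)) F = (0 : ℝ) := fun i => by
        rw [real_inner_comm, h.baseI']
      have h5 : ∀ i, inner ℝ (f' i) (mulI F) = (0 : ℝ) := fun i => by
        rw [real_inner_comm, inner_mulI_left, h.baseI', neg_zero]
      have h6 : inner ℝ (mulI F) F = (0 : ℝ) := by rw [real_inner_comm, inner_mulI_self]
      rintro ⟨_ | i, _ | _⟩ ⟨_ | j, _ | _⟩ <;>
        simp [-inner_self_eq_norm_sq_to_K, h.norm, h.base, h.dual, h.base', h.baseI,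
          h.lag', h1, h2, h3, h4, h5, h6, inner_mulI_mulI, inner_mulI_self]) W
  rw [Fintype.sum_prod_type, Fintype.sum_option] at key
  simpa [Finset.sum_add_distrib, add_comm] using key

/-- Parseval's identity for a pair of dual systems. It reduces products of second derivatives to
scalar components in the frame, where `ring` and `linear_combination` apply. -/
theorem LegendrianFrame.inner_expand {F : C3} {f f' : Fin 2 → C3} (h : LegendrianFrame F f f')
    (W W' : C3) :
    inner ℝ W W' = inner ℝ W F * inner ℝ F W' + inner ℝ W (mulI F) * inner ℝ (mulI F) W'
      + ∑ i, (inner ℝ W (f' i) * inner ℝ (f i) W'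
        + inner ℝ W (mulI (f' i)) * inner ℝ (mulI (f i)) W' : ℝ) := by
  conv_lhs => rw [h.expand W]
  simp only [inner_add_left, sum_inner, inner_smul_left, real_inner_comm]
  simp

/-! ### Directional derivatives -/

section Calculus

variable {E F : Type*} [NormedAddCommGroup E] [NormedSpace ℝ E] [NormedAddCommGroup F]
  [NormedSpace ℝ F]

/-- The derivative of `h` in the direction `v`, as a function of the point. -/
noncomputable def dd (v : E) (h : E → F) (z : E) : F := fderiv ℝ h z v

theorem dd_congr {v : E} {h k : E → F} {z : E} (hk : h =ᶠ[nhds z] k) : dd v h z = dd v k z := by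
  rw [dd, dd, hk.fderiv_eq]

theorem dd_const (v : E) (c : F) (z : E) : dd v (fun _ => c) z = 0 := by
  simp [dd]

theorem dd_add {v : E} {h k : E → F} {z : E} (hh : DifferentiableAt ℝ h z)
    (hk : DifferentiableAt ℝ k z) : dd v (fun x => h x + k x) z = dd v h z + dd v k z := by
  simp [dd, fderiv_fun_add hh hk]

theorem dd_sub {v : E} {h k : E → F} {z : E} (hh : DifferentiableAt ℝ h z)
    (hk : DifferentiableAt ℝ k z) : dd v (fun x => h x - k x) z = dd v h z - dd v k z := by
  simp [dd, fderiv_fun_sub hh hk]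

theorem dd_sum {ι : Type*} {s : Finset ι} {v : E} {h : ι → E → F} {z : E}
    (hh : ∀ i ∈ s, DifferentiableAt ℝ (h i) z) :
    dd v (fun x => ∑ i ∈ s, h i x) z = ∑ i ∈ s, dd v (h i) z := by
  simp [dd, fderiv_fun_sum hh]

theorem dd_mul {v : E} {h k : E → ℝ} {z : E} (hh : DifferentiableAt ℝ h z)
    (hk : DifferentiableAt ℝ k z) :
    dd v (fun x => h x * k x) z = h z * dd v k z + dd v h z * k z := by
  simp [dd, fderiv_fun_mul hh hk, mul_comm]

theorem dd_const_mul {v : E} {h : E → ℝ} {z : E} (c : ℝ) (hh : DifferentiableAt ℝ h z) :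
    dd v (fun x => c * h x) z = c * dd v h z := by
  simp [dd, fderiv_const_mul hh]

theorem dd_smul {v : E} {h : E → ℝ} {k : E → F} {z : E} (hh : DifferentiableAt ℝ h z)
    (hk : DifferentiableAt ℝ k z) :
    dd v (fun x => h x • k x) z = h z • dd v k z + dd v h z • k z := by
  simp [dd, fderiv_fun_smul hh hk]

theorem dd_clm {G : Type*} [NormedAddCommGroup G] [NormedSpace ℝ G] {v : E} {h : E → F} {z : E}
    (L : F →L[ℝ] G) (hh : DifferentiableAt ℝ h z) :
    dd v (fun x => L (h x)) z = L (dd v h z) := by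
  have := (L.hasFDerivAt.comp z hh.hasFDerivAt).fderiv
  simp only [dd]
  rw [show (fun x => L (h x)) = L ∘ h from rfl, this]
  rfl

theorem dd_inner {v : E} {h k : E → C3} {z : E} (hh : DifferentiableAt ℝ h z)
    (hk : DifferentiableAt ℝ k z) :
    dd v (fun x => (inner ℝ (h x) (k x) : ℝ)) z
      = inner ℝ (h z) (dd v k z) + inner ℝ (dd v h z) (k z) := by
  simp [dd, fderiv_inner_apply ℝ hh hk]

theorem _root_.ContDiffOn.dd {s : Set E} (hs : IsOpen s) {h : E → F} (hh : ContDiffOn ℝ ∞ h s)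
    (v : E) :
    ContDiffOn ℝ ∞ (LegendrianSurface.dd v h) s :=
  (hh.fderiv_of_isOpen hs (by simp)).clm_apply contDiffOn_const

theorem dd_comm {s : Set E} (hs : IsOpen s) {h : E → F} (hh : ContDiffOn ℝ ∞ h s) (v w : E)
    {z : E} (hz : z ∈ s) : dd v (dd w h) z = dd w (dd v h) z := by
  have hc : ContDiffAt ℝ ∞ h z := hh.contDiffAt (hs.mem_nhds hz)
  have hsym := hc.isSymmSndFDerivAt (by simpa using ENat.LEInfty.out)
  have hd : DifferentiableAt ℝ (fderiv ℝ h) z :=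
    (hc.fderiv_right (m := ∞) (by simp)).differentiableAt (by simp)
  have key : ∀ v w : E, LegendrianSurface.dd v (LegendrianSurface.dd w h) z
      = fderiv ℝ (fderiv ℝ h) z v w := by
    intro v w
    have := (hd.hasFDerivAt.clm_apply (hasFDerivAt_const w z)).fderiv
    rw [LegendrianSurface.dd]
    rw [show LegendrianSurface.dd w h = fun y => (fderiv ℝ h y) w from rfl, this]
    simp
  rw [key, key]
  exact hsym v w

end Calculus

/-! ### Frames of a Legendrian immersion depending on parameters -/

section Frames

variable {E : Type*} [NormedAddCommGroup E] [NormedSpace ℝ E]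

theorem _root_.ContDiffOn.differentiableAt_of_isOpen {F : Type*} [NormedAddCommGroup F]
    [NormedSpace ℝ F] {s : Set E} {h : E → F} (hh : ContDiffOn ℝ ∞ h s) (hs : IsOpen s) {z : E}
    (hz : z ∈ s) : DifferentiableAt ℝ h z :=
  (hh.contDiffAt (hs.mem_nhds hz)).differentiableAt (by simp)

theorem dd_congr_of_isOpen {F : Type*} [NormedAddCommGroup F] [NormedSpace ℝ F] {s : Set E}
    (hs : IsOpen s) {h k : E → F} (hk : ∀ z ∈ s, h z = k z) (v : E) {z : E} (hz : z ∈ s) :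
    dd v h z = dd v k z :=
  dd_congr (Filter.eventuallyEq_of_mem (hs.mem_nhds hz) hk)

/-- The derivative of `Φ` in the spatial direction `e i`. -/
noncomputable def frame (Φ : E → C3) (e : Fin 2 → E) (i : Fin 2) (z : E) : C3 := dd (e i) Φ z

/-- The Gram matrix of the frame. -/
noncomputable def frameGram (Φ : E → C3) (e : Fin 2 → E) (z : E) : Matrix (Fin 2) (Fin 2) ℝ :=
  Matrix.of fun i j => inner ℝ (frame Φ e i z) (frame Φ e j z)

/-- The dual frame. -/
noncomputable def coframe (Φ : E → C3) (e : Fin 2 → E) (i : Fin 2) (z : E) : C3 :=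
  ∑ j, (frameGram Φ e z)⁻¹ i j • frame Φ e j z

/-- The area density. -/
noncomputable def density (Φ : E → C3) (e : Fin 2 → E) (z : E) : ℝ :=
  Real.sqrt (frameGram Φ e z).det

/-- The derivative of the Legendrian angle in the direction `v`. -/
noncomputable def angleForm (Φ : E → C3) (e : Fin 2 → E) (v : E) (z : E) : ℝ :=
  inner ℝ (dd v Φ z) (mulI (Φ z)) + ∑ i, inner ℝ (dd v (frame Φ e i) z) (mulI (coframe Φ e i z))

/-- The gradient of the Legendrian angle, as an ambient vector. -/
noncomputable def angleGrad (Φ : E → C3) (e : Fin 2 → E) (z : E) : C3 :=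
  ∑ k, angleForm Φ e (e k) z • coframe Φ e k z

/-- `Φ` is a smooth map into `S⁵` on the open set `Ω` which is a Legendrian immersion in the
directions `e 0` and `e 1`. -/
structure IsLegendrianOn (Φ : E → C3) (e : Fin 2 → E) (Ω : Set E) : Prop where
  isOpen : IsOpen Ω
  smooth : ContDiffOn ℝ ∞ Φ Ω
  norm : ∀ z ∈ Ω, inner ℝ (Φ z) (Φ z) = (1 : ℝ)
  contact : ∀ z ∈ Ω, ∀ i, inner ℝ (Φ z) (mulI (frame Φ e i z)) = (0 : ℝ)
  det_pos : ∀ z ∈ Ω, 0 < (frameGram Φ e z).det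

variable {Φ : E → C3} {e : Fin 2 → E} {Ω : Set E}

theorem frameGram_comm (z : E) (i j : Fin 2) : frameGram Φ e z i j = frameGram Φ e z j i := by
  simp only [frameGram, Matrix.of_apply]
  exact real_inner_comm _ _

theorem frameGram_inv_apply (z : E) (i j : Fin 2) :
    (frameGram Φ e z)⁻¹ i j = (frameGram Φ e z).det⁻¹ * (frameGram Φ e z).adjugate i j := by
  rw [Matrix.inv_def, Ring.inverse_eq_inv', Matrix.smul_apply, smul_eq_mul]

/-- Cramer's rule in dimension two; the explicit form gives the smoothness of the dual frame and
Jacobi's formula for the density without differentiating a matrix inverse. -/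
theorem coframe_zero (z : E) : coframe Φ e 0 z = (frameGram Φ e z).det⁻¹ •
    (frameGram Φ e z 1 1 • frame Φ e 0 z - frameGram Φ e z 0 1 • frame Φ e 1 z) := by
  simp [coframe, frameGram_inv_apply, Fin.sum_univ_two, Matrix.adjugate_fin_two, smul_smul,
    sub_eq_add_neg]

theorem coframe_one (z : E) : coframe Φ e 1 z = (frameGram Φ e z).det⁻¹ •
    (frameGram Φ e z 0 0 • frame Φ e 1 z - frameGram Φ e z 0 1 • frame Φ e 0 z) := by
  simp [coframe, frameGram_inv_apply, Fin.sum_univ_two, Matrix.adjugate_fin_two, smul_smul,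
    sub_eq_add_neg, frameGram_comm z 1 0, add_comm]

namespace IsLegendrianOn

variable (h : IsLegendrianOn Φ e Ω)
include h

theorem frame_smooth (i : Fin 2) : ContDiffOn ℝ ∞ (frame Φ e i) Ω := h.smooth.dd h.isOpen (e i)

theorem gram_smooth (i j : Fin 2) : ContDiffOn ℝ ∞ (fun z => frameGram Φ e z i j) Ω :=
  (h.frame_smooth i).inner ℝ (h.frame_smooth j)

theorem det_smooth : ContDiffOn ℝ ∞ (fun z => (frameGram Φ e z).det) Ω := by
  simp only [Matrix.det_fin_two]
  exact ((h.gram_smooth 0 0).mul (h.gram_smooth 1 1)).sub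
    ((h.gram_smooth 0 1).mul (h.gram_smooth 1 0))

theorem coframe_smooth (i : Fin 2) : ContDiffOn ℝ ∞ (coframe Φ e i) Ω := by
  have hd := h.det_smooth.inv fun z hz => (h.det_pos z hz).ne'
  fin_cases i
  · exact (hd.smul (((h.gram_smooth 1 1).smul (h.frame_smooth 0)).sub
      ((h.gram_smooth 0 1).smul (h.frame_smooth 1)))).congr fun z _ => coframe_zero z
  · exact (hd.smul (((h.gram_smooth 0 0).smul (h.frame_smooth 1)).sub
      ((h.gram_smooth 0 1).smul (h.frame_smooth 0)))).congr fun z _ => coframe_one z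

theorem density_smooth : ContDiffOn ℝ ∞ (density Φ e) Ω :=
  h.det_smooth.sqrt fun z hz => (h.det_pos z hz).ne'

theorem angleForm_smooth (v : E) : ContDiffOn ℝ ∞ (angleForm Φ e v) Ω :=
  ((h.smooth.dd h.isOpen v).inner ℝ (mulI.contDiff.comp_contDiffOn h.smooth)).add
    (ContDiffOn.sum fun i _ => ((h.frame_smooth i).dd h.isOpen v).inner ℝ
      (mulI.contDiff.comp_contDiffOn (h.coframe_smooth i)))

theorem angleGrad_smooth : ContDiffOn ℝ ∞ (angleGrad Φ e) Ω :=
  ContDiffOn.sum fun k _ => (h.angleForm_smooth (e k)).smul (h.coframe_smooth k)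

theorem differentiableAt {F : Type*} [NormedAddCommGroup F] [NormedSpace ℝ F] {k : E → F} {z : E}
    (hz : z ∈ Ω) (hk : ContDiffOn ℝ ∞ k Ω) : DifferentiableAt ℝ k z :=
  hk.differentiableAt_of_isOpen h.isOpen hz

/-- Differentiating a scalar product which is constant on `Ω`. -/
theorem dd_inner_const {a b : E → C3} {c : ℝ} (ha : ContDiffOn ℝ ∞ a Ω)
    (hb : ContDiffOn ℝ ∞ b Ω) (hab : ∀ z ∈ Ω, inner ℝ (a z) (b z) = c) (v : E) {z : E}
    (hz : z ∈ Ω) : inner ℝ (a z) (dd v b z) = -(inner ℝ (dd v a z) (b z) : ℝ) := by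
  have h1 := dd_inner (v := v) (h.differentiableAt hz ha) (h.differentiableAt hz hb)
  rw [dd_congr_of_isOpen h.isOpen hab v hz, dd_const] at h1
  linarith

theorem dd_inner_mulI_const {a b : E → C3} {c : ℝ} (ha : ContDiffOn ℝ ∞ a Ω)
    (hb : ContDiffOn ℝ ∞ b Ω) (hab : ∀ z ∈ Ω, inner ℝ (a z) (mulI (b z)) = c) (v : E) {z : E}
    (hz : z ∈ Ω) :
    inner ℝ (a z) (mulI (dd v b z)) = -(inner ℝ (dd v a z) (mulI (b z)) : ℝ) := by
  rw [← h.dd_inner_const (b := fun x => mulI (b x)) ha (mulI.contDiff.comp_contDiffOn hb) hab v hz]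
  exact congrArg _ (dd_clm mulI (h.differentiableAt hz hb)).symm

theorem dd_frame (i : Fin 2) (v : E) {z : E} (hz : z ∈ Ω) :
    dd v (frame Φ e i) z = dd (e i) (dd v Φ) z :=
  dd_comm h.isOpen h.smooth v (e i) hz

theorem dd_frame_comm (i j : Fin 2) {z : E} (hz : z ∈ Ω) :
    dd (e j) (frame Φ e i) z = dd (e i) (frame Φ e j) z :=
  h.dd_frame i (e j) hz

theorem inner_dd (v : E) {z : E} (hz : z ∈ Ω) : inner ℝ (Φ z) (dd v Φ z) = (0 : ℝ) := by
  have := h.dd_inner_const h.smooth h.smooth h.norm v hz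
  rw [real_inner_comm] at this
  have h2 := real_inner_comm (Φ z) (dd v Φ z)
  linarith

/-- `∂_v (∂_i Φ)` and the contact form. -/
theorem inner_mulI_dd_frame (i : Fin 2) (v : E) {z : E} (hz : z ∈ Ω) :
    inner ℝ (Φ z) (mulI (dd v (frame Φ e i) z))
      = -(inner ℝ (dd v Φ z) (mulI (frame Φ e i z)) : ℝ) :=
  h.dd_inner_mulI_const h.smooth (h.frame_smooth i) (fun z hz => h.contact z hz i) v hz

/-- Tangent planes of Legendrian surfaces are Lagrangian: differentiating the contact condition
gives `⟪Φ, i∂ⱼFᵢ⟫ = -⟪Fⱼ, iFᵢ⟫`, whose left side is symmetric and whose right side is antisymmetric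
in the two indices. -/
theorem frame_lag (i j : Fin 2) {z : E} (hz : z ∈ Ω) :
    inner ℝ (frame Φ e i z) (mulI (frame Φ e j z)) = (0 : ℝ) := by
  have h1 := h.inner_mulI_dd_frame i (e j) hz
  have h2 := h.inner_mulI_dd_frame j (e i) hz
  rw [h.dd_frame_comm i j hz, h2] at h1
  have h3 := inner_mulI_left (frame Φ e j z) (frame Φ e i z)
  rw [real_inner_comm] at h3
  change -(inner ℝ (frame Φ e i z) _ : ℝ) = -inner ℝ (frame Φ e j z) _ at h1
  linarith

theorem legendrianFrame {z : E} (hz : z ∈ Ω) :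
    LegendrianFrame (Φ z) (fun i => frame Φ e i z) (fun i => coframe Φ e i z) where
  norm := h.norm z hz
  base i := h.inner_dd (e i) hz
  baseI i := h.contact z hz i
  lag i j := h.frame_lag i j hz
  dual i j := by
    have hinv := Matrix.nonsing_inv_mul (frameGram Φ e z) (h.det_pos z hz).ne'.isUnit
    have := congrFun (congrFun hinv i) j
    rw [Matrix.mul_apply, Matrix.one_apply] at this
    rw [← this, coframe, sum_inner]
    exact Finset.sum_congr rfl fun k _ => by rw [inner_smul_left]; rfl
  base' i := by
    rw [coframe, inner_sum]
    exact Finset.sum_eq_zero fun k _ => by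
      rw [inner_smul_right, frame, h.inner_dd (e k) hz, mul_zero]
  baseI' i := by
    rw [coframe, map_sum, inner_sum]
    exact Finset.sum_eq_zero fun k _ => by
      rw [map_smul, inner_smul_right, h.contact z hz k, mul_zero]
  lag' i j := by
    rw [coframe, sum_inner]
    exact Finset.sum_eq_zero fun k _ => by
      rw [inner_smul_left, h.frame_lag k j hz, mul_zero]

theorem coframe_lag (i j : Fin 2) {z : E} (hz : z ∈ Ω) :
    inner ℝ (coframe Φ e i z) (mulI (coframe Φ e j z)) = (0 : ℝ) := by
  conv_lhs => rw [coframe.eq_1 Φ e j z]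
  rw [map_sum, inner_sum]
  exact Finset.sum_eq_zero fun k _ => by
    rw [map_smul, inner_smul_right, (h.legendrianFrame hz).lag' i k, mul_zero]

theorem frame_eq_sum (k : Fin 2) {z : E} (hz : z ∈ Ω) :
    frame Φ e k z = ∑ i, frameGram Φ e z i k • coframe Φ e i z := by
  have hinv := Matrix.mul_nonsing_inv (frameGram Φ e z) (h.det_pos z hz).ne'.isUnit
  simp_rw [coframe, Finset.smul_sum, smul_smul]
  rw [Finset.sum_comm]
  have : ∀ j, ∑ i, (frameGram Φ e z i k * (frameGram Φ e z)⁻¹ i j) • frame Φ e j z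
      = (if k = j then (1 : ℝ) else 0) • frame Φ e j z := by
    intro j
    rw [← Finset.sum_smul]
    congr 1
    have := congrFun (congrFun hinv k) j
    rw [Matrix.mul_apply, Matrix.one_apply] at this
    rw [← this]
    exact Finset.sum_congr rfl fun i _ => by rw [frameGram_comm]
  simp [this]

/-! ### Derivatives of the dual frame -/

theorem inner_frame_dd_coframe (i j : Fin 2) (v : E) {z : E} (hz : z ∈ Ω) :
    inner ℝ (frame Φ e j z) (dd v (coframe Φ e i) z)
      = -(inner ℝ (dd v (frame Φ e j) z) (coframe Φ e i z) : ℝ) :=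
  h.dd_inner_const (h.frame_smooth j) (h.coframe_smooth i)
    (fun z hz => by rw [real_inner_comm]; exact (h.legendrianFrame hz).dual i j) v hz

theorem inner_mulI_frame_dd_coframe (i j : Fin 2) (v : E) {z : E} (hz : z ∈ Ω) :
    inner ℝ (mulI (frame Φ e j z)) (dd v (coframe Φ e i) z)
      = inner ℝ (dd v (frame Φ e j) z) (mulI (coframe Φ e i z)) := by
  have := h.dd_inner_mulI_const (h.frame_smooth j) (h.coframe_smooth i)
    (c := 0) (fun _ hz => by
      rw [inner_mulI_right, real_inner_comm, (h.legendrianFrame hz).lag' i j, neg_zero]) v hz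
  rw [inner_mulI_left, this, neg_neg]

theorem inner_dd_coframe (i : Fin 2) (v : E) {z : E} (hz : z ∈ Ω) :
    inner ℝ (Φ z) (dd v (coframe Φ e i) z)
      = -(inner ℝ (dd v Φ z) (coframe Φ e i z) : ℝ) :=
  h.dd_inner_const h.smooth (h.coframe_smooth i)
    (fun _ hz => (h.legendrianFrame hz).base' i) v hz

theorem inner_mulI_dd_coframe (i : Fin 2) (v : E) {z : E} (hz : z ∈ Ω) :
    inner ℝ (mulI (Φ z)) (dd v (coframe Φ e i) z)
      = inner ℝ (dd v Φ z) (mulI (coframe Φ e i z)) := by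
  have := h.dd_inner_mulI_const h.smooth (h.coframe_smooth i)
    (fun z hz => (h.legendrianFrame hz).baseI' i) v hz
  rw [inner_mulI_left, this, neg_neg]

/-- The derivative of the dual frame, expanded in the frame. -/
theorem inner_mulI_dd_coframe_expand (A : C3) (i : Fin 2) (v : E) {z : E} (hz : z ∈ Ω) :
    inner ℝ A (mulI (dd v (coframe Φ e i) z))
      = -(inner ℝ A (Φ z) * inner ℝ (dd v Φ z) (mulI (coframe Φ e i z)))
        - inner ℝ A (mulI (Φ z)) * inner ℝ (dd v Φ z) (coframe Φ e i z)
        - ∑ j, (inner ℝ A (coframe Φ e j z)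
              * inner ℝ (dd v (frame Φ e j) z) (mulI (coframe Φ e i z))
            + inner ℝ A (mulI (coframe Φ e j z))
              * inner ℝ (dd v (frame Φ e j) z) (coframe Φ e i z) : ℝ) := by
  rw [(h.legendrianFrame hz).inner_expand A]
  simp only [inner_mulI_mulI]
  simp only [inner_mulI_right _ (dd v (coframe Φ e i) z),
    h.inner_frame_dd_coframe i _ v hz, h.inner_mulI_frame_dd_coframe i _ v hz,
    h.inner_dd_coframe i v hz, h.inner_mulI_dd_coframe i v hz, Fin.sum_univ_two]
  ring

/-- The Hessian of the Legendrian angle is symmetric. -/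
theorem dd_angleForm (v : E) (k : Fin 2) {z : E} (hz : z ∈ Ω) :
    dd v (angleForm Φ e (e k)) z = dd (e k) (angleForm Φ e v) z := by
  -- The terms with three derivatives are symmetric in `v` and `w`, so only the products of
  -- derivatives of the frame and of the dual frame have to be compared.
  have hform : ∀ v w, dd w (angleForm Φ e v) z
      = inner ℝ (dd v Φ z) (mulI (dd w Φ z)) + inner ℝ (dd w (dd v Φ) z) (mulI (Φ z))
        + ∑ i, (inner ℝ (dd v (frame Φ e i) z) (mulI (dd w (coframe Φ e i) z))
          + inner ℝ (dd w (dd v (frame Φ e i)) z) (mulI (coframe Φ e i z))) := by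
    intro v w
    have d1 := h.differentiableAt hz (h.smooth.dd h.isOpen v)
    have d2 := h.differentiableAt hz h.smooth
    have d3 := fun i => h.differentiableAt hz ((h.frame_smooth i).dd h.isOpen v)
    have d4 := fun i => h.differentiableAt hz (h.coframe_smooth i)
    have d5 : DifferentiableAt ℝ (fun x => mulI (Φ x)) z := mulI.differentiableAt.comp z d2
    have d6 : ∀ i, DifferentiableAt ℝ (fun x => mulI (coframe Φ e i x)) z :=
      fun i => mulI.differentiableAt.comp z (d4 i)
    unfold angleForm
    rw [dd_add (d1.inner ℝ d5) (DifferentiableAt.fun_sum fun i _ => (d3 i).inner ℝ (d6 i)),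
      dd_sum fun i _ => (d3 i).inner ℝ (d6 i), dd_inner d1 d5, dd_clm mulI d2]
    congr 1
    refine Finset.sum_congr rfl fun i _ => ?_
    rw [dd_inner (d3 i) (d6 i), dd_clm mulI (d4 i)]
  rw [hform, hform]
  have hF := h.legendrianFrame hz
  have hg : ∀ i, inner ℝ (dd (e k) (frame Φ e i) z) (Φ z) = -frameGram Φ e z i k := by
    intro i
    rw [real_inner_comm, h.dd_inner_const h.smooth (h.frame_smooth i)
      (fun z hz => h.inner_dd (e i) hz) (e k) hz, frameGram_comm]
    rfl
  have hg' : ∀ i, inner ℝ (dd (e k) (frame Φ e i) z) (mulI (Φ z)) = (0 : ℝ) := by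
    intro i
    rw [inner_mulI_right, real_inner_comm, h.inner_mulI_dd_frame i (e k) hz, neg_neg]
    exact h.frame_lag k i hz
  have hVk : inner ℝ (dd v Φ z) (mulI (frame Φ e k z))
      = ∑ i, frameGram Φ e z i k * inner ℝ (dd v Φ z) (mulI (coframe Φ e i z)) := by
    conv_lhs => rw [h.frame_eq_sum k hz, map_sum, inner_sum]
    exact Finset.sum_congr rfl fun i _ => by rw [map_smul, inner_smul_right]
  have hd : ∀ i, inner ℝ (frame Φ e k z) (coframe Φ e i z) = if i = k then (1 : ℝ) else 0 :=
    fun i => by rw [real_inner_comm]; exact hF.dual i k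
  have hdI : ∀ i, inner ℝ (frame Φ e k z) (mulI (coframe Φ e i z)) = (0 : ℝ) :=
    fun i => by rw [inner_mulI_right, real_inner_comm, hF.lag' i k, neg_zero]
  have hc : ∀ i, dd v (dd (e k) (frame Φ e i)) z = dd (e k) (dd v (frame Φ e i)) z :=
    fun i => dd_comm h.isOpen (h.frame_smooth i) v (e k) hz
  have hc2 : dd v (dd (e k) Φ) z = dd v (frame Φ e k) z := rfl
  have hc3 : dd (e k) (dd v Φ) z = dd v (frame Φ e k) z := (h.dd_frame k v hz).symm
  have hk : dd (e k) Φ z = frame Φ e k z := rfl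
  have hcon : inner ℝ (dd v (frame Φ e k) z) (mulI (Φ z)) = inner ℝ (dd v Φ z)
      (mulI (frame Φ e k z)) := by
    rw [inner_mulI_right, real_inner_comm, h.inner_mulI_dd_frame k v hz, neg_neg]
  have hanti : inner ℝ (frame Φ e k z) (mulI (dd v Φ z)) = -(inner ℝ (dd v Φ z)
      (mulI (frame Φ e k z)) : ℝ) := by
    rw [inner_mulI_right, real_inner_comm]
  have hsum : ∑ i, inner ℝ (dd v (frame Φ e i) z) (mulI (Φ z)) * (if i = k then (1 : ℝ) else 0)
      = inner ℝ (dd v (frame Φ e k) z) (mulI (Φ z)) := by simp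
  simp only [h.inner_mulI_dd_coframe_expand _ _ _ hz, hc, hc2, hc3, hk, hg, hg', hd, hdI,
    hanti, hcon, hVk, Fin.sum_univ_two] at hsum ⊢
  -- The double sums of products of frame derivatives agree after exchanging the two summation
  -- indices (the trace of a commutator vanishes). What is left are contact terms, matched by
  -- evaluating the Kronecker sum `hsum`.
  linear_combination hsum

end IsLegendrianOn

end Frames

/-! ### First variation of the area density and divergences of tangential fields -/

section Variation

variable {E : Type*} [NormedAddCommGroup E] [NormedSpace ℝ E]

/-- The coordinates of the gradient of the Legendrian angle. -/
noncomputable def gradCoord (Φ : E → C3) (e : Fin 2 → E) (k : Fin 2) (z : E) : ℝ :=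
  inner ℝ (angleGrad Φ e z) (coframe Φ e k z)

/-- The coordinates of `-i B(Z, Z)`, where `Z` is the gradient of the Legendrian angle. -/
noncomputable def cubicCoord (Φ : E → C3) (e : Fin 2 → E) (k : Fin 2) (z : E) : ℝ :=
  ∑ l, gradCoord Φ e l z * inner ℝ (dd (e l) (angleGrad Φ e) z) (mulI (coframe Φ e k z))

/-- The coordinates of the flux of the first variation of the Willmore functional. -/
noncomputable def fluxCoord (Φ : E → C3) (e : Fin 2 → E) (v : E) (k : Fin 2) (z : E) : ℝ :=
  (1 / 2 * (angleForm Φ e v z - inner ℝ (angleGrad Φ e z) (dd v Φ z))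
    - 1 / 2 * (inner ℝ (dd v Φ z) (mulI (Φ z))
      * (1 / 4 * inner ℝ (angleGrad Φ e z) (angleGrad Φ e z) + 1))) * gradCoord Φ e k z
  + (1 / 4 * inner ℝ (angleGrad Φ e z) (angleGrad Φ e z) + 1)
      * inner ℝ (dd v Φ z) (coframe Φ e k z)
  + 1 / 4 * inner ℝ (dd v Φ z) (mulI (Φ z)) * cubicCoord Φ e k z

variable {Φ : E → C3} {e : Fin 2 → E} {Ω : Set E}

namespace IsLegendrianOn

variable (h : IsLegendrianOn Φ e Ω)
include h

/-- Jacobi's formula for `√(det g)`, with the trace of `g⁻¹ ∂ᵥg` expressed through the dual frame.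
-/
theorem dd_density (v : E) {z : E} (hz : z ∈ Ω) :
    dd v (density Φ e) z
      = density Φ e z * ∑ i, inner ℝ (dd v (frame Φ e i) z) (coframe Φ e i z) := by
  have hpos := h.det_pos z hz
  have hρ : 0 < density Φ e z := Real.sqrt_pos.2 hpos
  have d := h.differentiableAt hz h.density_smooth
  have dg := fun i j => h.differentiableAt hz (h.gram_smooth i j)
  have df := fun i => h.differentiableAt hz (h.frame_smooth i)
  -- The squared density is polynomial in the Gram matrix, which avoids differentiating the square
  -- root.
  have hsq : ∀ x ∈ Ω, density Φ e x * density Φ e x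
      = frameGram Φ e x 0 0 * frameGram Φ e x 1 1
        - frameGram Φ e x 0 1 * frameGram Φ e x 0 1 := by
    intro x hx
    rw [density, Real.mul_self_sqrt (h.det_pos x hx).le, Matrix.det_fin_two, frameGram_comm x 1 0]
  have key := dd_congr_of_isOpen h.isOpen hsq v hz
  have hdg : ∀ i j, dd v (fun x => frameGram Φ e x i j) z
      = inner ℝ (frame Φ e i z) (dd v (frame Φ e j) z)
        + inner ℝ (dd v (frame Φ e i) z) (frame Φ e j z) :=
    fun i j => dd_inner (df i) (df j)
  rw [dd_mul d d, dd_sub ((dg 0 0).fun_mul (dg 1 1)) ((dg 0 1).fun_mul (dg 0 1)), dd_mul (dg 0 0)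
      (dg 1 1),
    dd_mul (dg 0 1) (dg 0 1)] at key
  simp only [hdg] at key
  have hz2 := hsq z hz
  have hdet : (frameGram Φ e z).det = density Φ e z * density Φ e z := by
    rw [density, Real.mul_self_sqrt hpos.le]
  rw [Fin.sum_univ_two, coframe_zero, coframe_one, hdet]
  simp only [inner_smul_right, inner_sub_right]
  have hc : ∀ i j, inner ℝ (frame Φ e i z) (dd v (frame Φ e j) z)
      = inner ℝ (dd v (frame Φ e j) z) (frame Φ e i z) := fun i j => real_inner_comm _ _
  simp only [hc] at key
  field_simp
  linear_combination key / 2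

theorem inner_angleGrad_frame (k : Fin 2) {z : E} (hz : z ∈ Ω) :
    inner ℝ (angleGrad Φ e z) (frame Φ e k z) = angleForm Φ e (e k) z := by
  rw [angleGrad, sum_inner]
  simp [-Fin.sum_univ_two, inner_smul_left, (h.legendrianFrame hz).dual]

theorem inner_angleGrad_base {z : E} (hz : z ∈ Ω) :
    inner ℝ (angleGrad Φ e z) (Φ z) = (0 : ℝ) := by
  rw [angleGrad, sum_inner]
  exact Finset.sum_eq_zero fun k _ => by
    rw [inner_smul_left, real_inner_comm, (h.legendrianFrame hz).base', mul_zero]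

theorem inner_angleGrad_mulI_base {z : E} (hz : z ∈ Ω) :
    inner ℝ (angleGrad Φ e z) (mulI (Φ z)) = (0 : ℝ) := by
  rw [angleGrad, sum_inner]
  exact Finset.sum_eq_zero fun k _ => by
    rw [inner_smul_left, inner_mulI_right, real_inner_comm, (h.legendrianFrame hz).baseI',
      neg_zero, mul_zero]

theorem inner_angleGrad_mulI_frame (k : Fin 2) {z : E} (hz : z ∈ Ω) :
    inner ℝ (angleGrad Φ e z) (mulI (frame Φ e k z)) = (0 : ℝ) := by
  rw [angleGrad, sum_inner]
  exact Finset.sum_eq_zero fun j _ => by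
    rw [inner_smul_left, (h.legendrianFrame hz).lag', mul_zero]

theorem inner_angleGrad_mulI_coframe (k : Fin 2) {z : E} (hz : z ∈ Ω) :
    inner ℝ (angleGrad Φ e z) (mulI (coframe Φ e k z)) = (0 : ℝ) := by
  rw [angleGrad, sum_inner]
  exact Finset.sum_eq_zero fun j _ => by
    rw [inner_smul_left, h.coframe_lag j k hz, mul_zero]

theorem angleGrad_eq_sum {z : E} (hz : z ∈ Ω) :
    angleGrad Φ e z = ∑ k, gradCoord Φ e k z • frame Φ e k z := by
  have key := (h.legendrianFrame hz).expand (angleGrad Φ e z)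
  have a1 : inner ℝ (Φ z) (angleGrad Φ e z) = (0 : ℝ) := by
    rw [real_inner_comm, h.inner_angleGrad_base hz]
  have a2 : inner ℝ (mulI (Φ z)) (angleGrad Φ e z) = (0 : ℝ) := by
    rw [real_inner_comm, h.inner_angleGrad_mulI_base hz]
  have a3 : ∀ k, inner ℝ (mulI (coframe Φ e k z)) (angleGrad Φ e z) = (0 : ℝ) := fun k => by
    rw [real_inner_comm, h.inner_angleGrad_mulI_coframe k hz]
  have a4 : ∀ k, inner ℝ (coframe Φ e k z) (angleGrad Φ e z) = gradCoord Φ e k z := fun k =>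
    real_inner_comm _ _
  simp only [a1, a2, a3, a4, zero_smul, add_zero, zero_add] at key
  exact key

theorem angleForm_eq (k : Fin 2) {z : E} (hz : z ∈ Ω) :
    angleForm Φ e (e k) z
      = ∑ i, inner ℝ (dd (e k) (frame Φ e i) z) (mulI (coframe Φ e i z)) := by
  have : inner ℝ (frame Φ e k z) (mulI (Φ z)) = (0 : ℝ) := by
    rw [inner_mulI_right, real_inner_comm, h.contact z hz k, neg_zero]
  rw [angleForm, show dd (e k) Φ z = frame Φ e k z from rfl, this, zero_add]

/-- The Laplacian of the immersion, in divergence form. -/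
theorem sum_dd_density_smul_coframe {z : E} (hz : z ∈ Ω) :
    ∑ i, dd (e i) (fun x => density Φ e x • coframe Φ e i x) z
      = density Φ e z • (mulI (angleGrad Φ e z) - (2 : ℝ) • Φ z) := by
  have hF := h.legendrianFrame hz
  have dρ := h.differentiableAt hz h.density_smooth
  have dc := fun i => h.differentiableAt hz (h.coframe_smooth i)
  simp_rw [dd_smul dρ (dc _), h.dd_density _ hz]
  -- The components are compared one by one. Along `Φ` the value -2 is minus the sum of `⟪Fᵢ, Fⁱ⟫`
  -- over the two indices. The tangential components cancel against the derivative of the density.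
  -- Along `iFⱼ` the equality of mixed derivatives produces `angleForm (e j)`.
  refine ext_inner_left ℝ fun W => ?_
  rw [hF.inner_expand W (∑ i, _), hF.inner_expand W (density Φ e z • _)]
  have hsymm := fun i j => h.dd_frame_comm i j hz
  have e1 : ∀ i j, inner ℝ (frame Φ e j z) (coframe Φ e i z) = if i = j then (1 : ℝ) else 0 :=
    fun i j => by rw [real_inner_comm]; exact hF.dual i j
  have e2 : ∀ i j, inner ℝ (mulI (frame Φ e j z)) (coframe Φ e i z) = (0 : ℝ) :=
    fun i j => by rw [real_inner_comm, hF.lag']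
  have e3 : ∀ j, inner ℝ (frame Φ e j z) (mulI (angleGrad Φ e z)) = (0 : ℝ) := fun j => by
    rw [inner_mulI_right, real_inner_comm, h.inner_angleGrad_mulI_frame j hz, neg_zero]
  have e4 : ∀ j, inner ℝ (mulI (frame Φ e j z)) (mulI (angleGrad Φ e z))
      = ∑ i, inner ℝ (dd (e j) (frame Φ e i) z) (mulI (coframe Φ e i z)) := fun j => by
    rw [inner_mulI_mulI, real_inner_comm, h.inner_angleGrad_frame j hz, h.angleForm_eq j hz]
  have e5 : inner ℝ (Φ z) (mulI (angleGrad Φ e z)) = (0 : ℝ) := by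
    rw [inner_mulI_right, real_inner_comm, h.inner_angleGrad_mulI_base hz, neg_zero]
  have e6 : inner ℝ (mulI (Φ z)) (mulI (angleGrad Φ e z)) = (0 : ℝ) := by
    rw [inner_mulI_mulI, real_inner_comm, h.inner_angleGrad_base hz]
  have e7 : ∀ j, inner ℝ (frame Φ e j z) (Φ z) = (0 : ℝ) := fun j => by
    rw [real_inner_comm]; exact hF.base j
  have e8 : ∀ j, inner ℝ (mulI (frame Φ e j z)) (Φ z) = (0 : ℝ) := fun j => by
    rw [real_inner_comm]; exact hF.baseI j
  have e9 : inner ℝ (mulI (Φ z)) (Φ z) = (0 : ℝ) := by rw [real_inner_comm, inner_mulI_self]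
  have e10 : ∀ i, inner ℝ (mulI (Φ z)) (coframe Φ e i z) = (0 : ℝ) := fun i => by
    rw [inner_mulI_left, hF.baseI', neg_zero]
  have e11 : ∀ i, inner ℝ (dd (e i) Φ z) (coframe Φ e i z) = (1 : ℝ) := fun i => by
    exact (e1 i i).trans (if_pos rfl)
  have e12 : ∀ i, inner ℝ (dd (e i) Φ z) (mulI (coframe Φ e i z)) = (0 : ℝ) := fun i => by
    have := e2 i i
    rw [inner_mulI_left, neg_eq_zero] at this
    exact this
  simp only [inner_sum, inner_add_right, inner_sub_right, inner_smul_right,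
    h.inner_dd_coframe _ _ hz, h.inner_mulI_dd_coframe _ _ hz, h.inner_frame_dd_coframe _ _ _ hz,
    h.inner_mulI_frame_dd_coframe _ _ _ hz, inner_mulI_mulI, e1, e2, e3, e4, e5, e6, e7, e8, e9,
    e10, e11, e12, hF.base', h.norm z hz, Fin.sum_univ_two]
  simp only [hsymm 0 1]
  simp
  ring

/-- The divergence of the vector field with coordinates `⟪A, F^k⟫`. -/
theorem sum_dd_density_mul {A : E → C3} (hA : ContDiffOn ℝ ∞ A Ω) {z : E} (hz : z ∈ Ω) :
    ∑ k, dd (e k) (fun x => density Φ e x * inner ℝ (A x) (coframe Φ e k x)) z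
      = density Φ e z * (∑ k, inner ℝ (dd (e k) A z) (coframe Φ e k z)
        + inner ℝ (A z) (mulI (angleGrad Φ e z)) - 2 * inner ℝ (A z) (Φ z)) := by
  have hS : ∀ k, ContDiffOn ℝ ∞ (fun x => density Φ e x • coframe Φ e k x) Ω :=
    fun k => h.density_smooth.smul (h.coframe_smooth k)
  have : ∀ k, dd (e k) (fun x => density Φ e x * inner ℝ (A x) (coframe Φ e k x)) z
      = inner ℝ (A z) (dd (e k) (fun x => density Φ e x • coframe Φ e k x) z)
        + inner ℝ (dd (e k) A z) (density Φ e z • coframe Φ e k z) := by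
    intro k
    rw [← dd_inner (h.differentiableAt hz hA) (h.differentiableAt hz (hS k))]
    congr 1
    ext x
    rw [inner_smul_right]
  simp_rw [this, Finset.sum_add_distrib, ← inner_sum, h.sum_dd_density_smul_coframe hz,
    inner_smul_right, inner_sub_right, inner_smul_right, ← Finset.mul_sum]
  ring

/-- The product rule gives two terms, and they coincide because the contact condition may also be
differentiated in the direction `v`. This is how the contact Hamiltonian determines the normal part
of the variation field. -/
theorem dd_contact (v : E) (k : Fin 2) {z : E} (hz : z ∈ Ω) :
    dd (e k) (fun x => (inner ℝ (dd v Φ x) (mulI (Φ x)) : ℝ)) z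
      = 2 * inner ℝ (dd v Φ z) (mulI (frame Φ e k z)) := by
  have d := h.differentiableAt hz h.smooth
  have dI : DifferentiableAt ℝ (fun x => mulI (Φ x)) z := mulI.differentiableAt.comp z d
  rw [dd_inner (h.differentiableAt hz (h.smooth.dd h.isOpen v)) dI, dd_clm mulI d,
    ← h.dd_frame k v hz, inner_mulI_right (dd v (frame Φ e k) z), real_inner_comm (Φ z) (mulI _),
    h.inner_mulI_dd_frame k v hz]
  change inner ℝ (dd v Φ z) (mulI (frame Φ e k z)) + _ = _
  ring

/-- First variation of the area density. -/
theorem dd_density_eq_divergence (v : E) {z : E} (hz : z ∈ Ω) :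
    dd v (density Φ e) z
      = ∑ k, dd (e k) (fun x => density Φ e x * inner ℝ (dd v Φ x) (coframe Φ e k x)) z
        - 1 / 2 * density Φ e z * ∑ k, gradCoord Φ e k z
          * dd (e k) (fun x => (inner ℝ (dd v Φ x) (mulI (Φ x)) : ℝ)) z := by
  have hV : inner ℝ (dd v Φ z) (Φ z) = (0 : ℝ) := by rw [real_inner_comm, h.inner_dd v hz]
  -- This is the mean curvature term `⟪V, H⟫`; by `dd_contact` it becomes half the derivative of the
  -- contact Hamiltonian along `Z`.
  have hH : inner ℝ (dd v Φ z) (mulI (angleGrad Φ e z))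
      = ∑ k, gradCoord Φ e k z * inner ℝ (dd v Φ z) (mulI (frame Φ e k z)) := by
    rw [h.angleGrad_eq_sum hz, map_sum, inner_sum]
    exact Finset.sum_congr rfl fun k _ => by rw [map_smul, inner_smul_right]
  rw [h.sum_dd_density_mul (h.smooth.dd h.isOpen v) hz, hV, hH, h.dd_density v hz]
  simp_rw [h.dd_contact v _ hz, h.dd_frame _ v hz, Fin.sum_univ_two]
  ring

end IsLegendrianOn

end Variation

/-! ### The Codazzi equation for the cubic form -/

section Codazzi

variable {E : Type*} [NormedAddCommGroup E] [NormedSpace ℝ E]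
  {Φ : E → C3} {e : Fin 2 → E} {Ω : Set E}

namespace IsLegendrianOn

variable (h : IsLegendrianOn Φ e Ω)
include h

theorem gradCoord_smooth (k : Fin 2) : ContDiffOn ℝ ∞ (gradCoord Φ e k) Ω :=
  h.angleGrad_smooth.inner ℝ (h.coframe_smooth k)

theorem mulI_angleGrad_smooth : ContDiffOn ℝ ∞ (fun x => mulI (angleGrad Φ e x)) Ω :=
  mulI.contDiff.comp_contDiffOn h.angleGrad_smooth

theorem cubicCoord_smooth (k : Fin 2) : ContDiffOn ℝ ∞ (cubicCoord Φ e k) Ω :=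
  ContDiffOn.sum fun l _ => (h.gradCoord_smooth l).mul
    ((h.angleGrad_smooth.dd h.isOpen (e l)).inner ℝ (mulI.contDiff.comp_contDiffOn
        (h.coframe_smooth k)))

theorem inner_mulI_angleGrad_dd_coframe (v : E) (i : Fin 2) {z : E} (hz : z ∈ Ω) :
    inner ℝ (mulI (angleGrad Φ e z)) (dd v (coframe Φ e i) z)
      = inner ℝ (dd v (angleGrad Φ e) z) (mulI (coframe Φ e i z)) := by
  rw [inner_mulI_left, h.dd_inner_mulI_const h.angleGrad_smooth (h.coframe_smooth i)
    (fun _ hz => h.inner_angleGrad_mulI_coframe i hz) v hz, neg_neg]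

theorem inner_angleGrad_eq_sum (W : C3) {z : E} (hz : z ∈ Ω) :
    inner ℝ (angleGrad Φ e z) W = ∑ k, gradCoord Φ e k z * inner ℝ (frame Φ e k z) W := by
  conv_lhs => rw [h.angleGrad_eq_sum hz, sum_inner]
  exact Finset.sum_congr rfl fun k _ => by rw [inner_smul_left]; rfl

theorem inner_mulI_angleGrad_eq_sum (W : C3) {z : E} (hz : z ∈ Ω) :
    inner ℝ (mulI (angleGrad Φ e z)) W
      = ∑ k, gradCoord Φ e k z * inner ℝ (mulI (frame Φ e k z)) W := by
  simp_rw [inner_mulI_left, h.inner_angleGrad_eq_sum _ hz, mul_neg, Finset.sum_neg_distrib]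

theorem inner_mulI_angleGrad_coframe (i : Fin 2) {z : E} (hz : z ∈ Ω) :
    inner ℝ (mulI (angleGrad Φ e z)) (coframe Φ e i z) = (0 : ℝ) := by
  rw [inner_mulI_left, h.inner_angleGrad_mulI_coframe i hz, neg_zero]

/-- The density can be moved inside the derivative because `iZ` is orthogonal to the dual frame. In
this form a further divergence meets the sum of `∂ᵢ(ρFⁱ)`, the Laplacian of the immersion. -/
theorem density_mul_cubicCoord (i : Fin 2) {z : E} (hz : z ∈ Ω) :
    density Φ e z * cubicCoord Φ e i z = ∑ k, gradCoord Φ e k z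
      * inner ℝ (mulI (angleGrad Φ e z)) (dd (e k) (fun x => density Φ e x • coframe Φ e i x) z)
          := by
  have dρ := h.differentiableAt hz h.density_smooth
  have dc := fun i => h.differentiableAt hz (h.coframe_smooth i)
  simp_rw [dd_smul dρ (dc _), inner_add_right, inner_smul_right,
    h.inner_mulI_angleGrad_coframe i hz, h.inner_mulI_angleGrad_dd_coframe _ i hz, cubicCoord,
    Finset.mul_sum]
  exact Finset.sum_congr rfl fun k _ => by ring

/-- The divergence of `-i B(Z, Z)`, computed with the Codazzi equation. -/
theorem sum_dd_density_mul_cubicCoord {z : E} (hz : z ∈ Ω) :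
    ∑ i, dd (e i) (fun x => density Φ e x * cubicCoord Φ e i x) z
      = density Φ e z * (∑ l, gradCoord Φ e l z
          * inner ℝ (angleGrad Φ e z) (dd (e l) (angleGrad Φ e) z)
        + 2 * ∑ i, ∑ m, inner ℝ (dd (e i) (angleGrad Φ e) z) (coframe Φ e m z)
          * inner ℝ (mulI (angleGrad Φ e z)) (dd (e m) (coframe Φ e i) z)) := by
  have hF := h.legendrianFrame hz
  have sS : ∀ i, ContDiffOn ℝ ∞ (fun x => density Φ e x • coframe Φ e i x) Ω :=
    fun i => h.density_smooth.smul (h.coframe_smooth i)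
  have dρ := h.differentiableAt hz h.density_smooth
  have dc := fun i => h.differentiableAt hz (h.coframe_smooth i)
  have dgc := fun i => h.differentiableAt hz (h.gradCoord_smooth i)
  have dZ := h.differentiableAt hz h.angleGrad_smooth
  have dIZ := h.differentiableAt hz h.mulI_angleGrad_smooth
  have dS : ∀ k i, DifferentiableAt ℝ
      (dd (e k) (fun x => density Φ e x • coframe Φ e i x)) z :=
    fun k i => h.differentiableAt hz ((sS i).dd h.isOpen (e k))
  have dΦ := h.differentiableAt hz h.smooth
  set Z := angleGrad Φ e with hZ
  set S : Fin 2 → E → C3 := fun i x => density Φ e x • coframe Φ e i x with hS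
  -- Product rule, with the second derivatives of `ρFⁱ` interchanged; this interchange is the
  -- Codazzi equation in the present notation.
  have hmul : ∀ i, dd (e i) (fun x => density Φ e x * cubicCoord Φ e i x) z
      = ∑ k, (gradCoord Φ e k z * (inner ℝ (mulI (Z z)) (dd (e k) (dd (e i) (S i)) z)
          + inner ℝ (mulI (dd (e i) Z z)) (dd (e k) (S i) z))
        + dd (e i) (gradCoord Φ e k) z * inner ℝ (mulI (Z z)) (dd (e k) (S i) z)) := by
    intro i
    rw [dd_congr_of_isOpen h.isOpen (fun x hx => h.density_mul_cubicCoord i hx) (e i) hz,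
      dd_sum fun k _ => (dgc k).fun_mul (dIZ.inner ℝ (dS k i))]
    refine Finset.sum_congr rfl fun k _ => ?_
    rw [dd_mul (dgc k) (dIZ.inner ℝ (dS k i)), dd_inner dIZ (dS k i), dd_clm mulI dZ,
      dd_comm h.isOpen (sS i) (e i) (e k) hz]
  -- Summed over `i`, the second derivatives become the derivative of `ρ(iZ - 2Φ)`, and pairing with
  -- `iZ` discards the `Φ` part.
  have hthird : ∀ k, ∑ i, inner ℝ (mulI (Z z)) (dd (e k) (dd (e i) (S i)) z)
      = dd (e k) (density Φ e) z * inner ℝ (Z z) (Z z)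
        + density Φ e z * inner ℝ (Z z) (dd (e k) Z z) := by
    intro k
    have d2 : DifferentiableAt ℝ (fun x => (2 : ℝ) • Φ x) z := dΦ.fun_const_smul 2
    have d3 : DifferentiableAt ℝ (fun x => mulI (angleGrad Φ e x) - (2 : ℝ) • Φ x) z :=
      dIZ.fun_sub d2
    rw [← inner_sum, ← dd_sum fun i _ => dS i i, dd_congr_of_isOpen h.isOpen
      (fun x hx => h.sum_dd_density_smul_coframe hx) (e k) hz, dd_smul dρ d3, dd_sub dIZ d2,
      dd_clm mulI dZ]
    have h2 : dd (e k) (fun x => (2 : ℝ) • Φ x) z = (2 : ℝ) • frame Φ e k z := by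
      rw [frame, dd, dd, fderiv_fun_const_smul dΦ]
      rfl
    have h3 : inner ℝ (mulI (Z z)) (frame Φ e k z) = (0 : ℝ) := by
      rw [inner_mulI_left, hZ, h.inner_angleGrad_mulI_frame k hz, neg_zero]
    have h4 : inner ℝ (mulI (Z z)) (Φ z) = (0 : ℝ) := by
      rw [inner_mulI_left, hZ, h.inner_angleGrad_mulI_base hz, neg_zero]
    change inner ℝ (mulI (Z z)) (density Φ e z • (mulI (dd (e k) Z z)
      - dd (e k) (fun x => (2 : ℝ) • Φ x) z) + _) = _
    rw [h2]
    simp only [inner_add_right, inner_sub_right, inner_smul_right, inner_mulI_mulI, h3, h4]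
    ring
  have hdS : ∀ k i, dd (e k) (S i) z = density Φ e z • dd (e k) (coframe Φ e i) z
      + dd (e k) (density Φ e) z • coframe Φ e i z := fun k i => dd_smul dρ (dc i)
  -- The Laplacian of the immersion paired with `iZ`; it removes the terms in which the density is
  -- differentiated.
  have hdiv : ∑ i, inner ℝ (mulI (dd (e i) Z z)) (coframe Φ e i z) = -(inner ℝ (Z z) (Z z) : ℝ)
      := by
    have h1 := congrArg (fun W => inner ℝ (mulI (Z z)) W) (h.sum_dd_density_smul_coframe hz)
    have h2 : ∀ i, inner ℝ (mulI (Z z)) (dd (e i) (S i) z)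
        = -(density Φ e z * inner ℝ (mulI (dd (e i) Z z)) (coframe Φ e i z)) := by
      intro i
      rw [hdS, inner_add_right, inner_smul_right, inner_smul_right,
        h.inner_mulI_angleGrad_coframe i hz, h.inner_mulI_angleGrad_dd_coframe _ i hz,
        inner_mulI_left]
      ring
    have h4 : inner ℝ (mulI (Z z)) (Φ z) = (0 : ℝ) := by
      rw [inner_mulI_left, hZ, h.inner_angleGrad_mulI_base hz, neg_zero]
    have hρ : density Φ e z ≠ 0 := (Real.sqrt_pos.2 (h.det_pos z hz)).ne'
    simp only [inner_sum] at h1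
    change ∑ i, inner ℝ (mulI (Z z)) (dd (e i) (S i) z) = _ at h1
    simp_rw [h2, inner_smul_right, inner_sub_right, inner_smul_right] at h1
    change _ = density Φ e z * (inner ℝ (mulI (Z z)) (mulI (Z z))
      - 2 * inner ℝ (mulI (Z z)) (Φ z)) at h1
    rw [h4, inner_mulI_mulI, Finset.sum_neg_distrib, ← Finset.mul_sum] at h1
    apply mul_left_cancel₀ hρ
    linarith
  have hgc : ∀ i m, dd (e i) (gradCoord Φ e m) z = inner ℝ (dd (e i) Z z) (coframe Φ e m z)
      - ∑ k, gradCoord Φ e k z * inner ℝ (dd (e k) (frame Φ e i) z) (coframe Φ e m z) := by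
    intro i m
    change dd (e i) (fun x => (inner ℝ (Z x) (coframe Φ e m x) : ℝ)) z = _
    rw [dd_inner dZ (dc m), h.inner_angleGrad_eq_sum _ hz]
    simp_rw [h.inner_frame_dd_coframe m _ _ hz, h.dd_frame_comm _ i hz, mul_neg,
      Finset.sum_neg_distrib]
    ring
  have hZF : ∀ i, inner ℝ (mulI (dd (e i) Z z)) (Φ z) = (0 : ℝ) := by
    intro i
    have := h.dd_inner_mulI_const h.angleGrad_smooth h.smooth
      (fun _ hz => h.inner_angleGrad_mulI_base hz) (e i) hz
    have h5 := h.inner_angleGrad_mulI_frame i hz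
    rw [frame] at h5
    rw [inner_mulI_left, ← this, h5]
  have hQ : ∀ i m, inner ℝ (mulI (dd (e i) Z z)) (coframe Φ e m z)
      = -(inner ℝ (mulI (Z z)) (dd (e i) (coframe Φ e m) z) : ℝ) := by
    intro i m
    rw [h.inner_mulI_angleGrad_dd_coframe _ m hz, inner_mulI_left]
  -- Of the two summands, the first cancels the Christoffel terms of `hgc`. The second, contracted
  -- with the coordinates of `Z`, is one copy of the Hessian paired with `B(·,·)` against `iZ`; the
  -- other copy comes from `hgc`, hence the factor 2.
  have hexp : ∀ k i, inner ℝ (mulI (dd (e i) Z z)) (dd (e k) (coframe Φ e i) z)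
      = ∑ m, (inner ℝ (mulI (Z z)) (dd (e i) (coframe Φ e m) z)
          * inner ℝ (dd (e k) (frame Φ e m) z) (coframe Φ e i z)
        + inner ℝ (dd (e i) Z z) (coframe Φ e m z)
          * inner ℝ (mulI (frame Φ e k z)) (dd (e m) (coframe Φ e i) z)) := by
    intro k i
    have h6 : inner ℝ (dd (e k) Φ z) (mulI (coframe Φ e i z)) = (0 : ℝ) := by
      rw [inner_mulI_right, neg_eq_zero]
      change inner ℝ (mulI (frame Φ e k z)) (coframe Φ e i z) = (0 : ℝ)
      rw [real_inner_comm]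
      exact hF.lag' i k
    rw [hF.inner_expand]
    simp only [hZF, hQ, h.inner_mulI_dd_coframe _ _ hz, h6, h.inner_frame_dd_coframe _ _ _ hz,
      h.inner_mulI_frame_dd_coframe _ _ _ hz, inner_mulI_mulI, Fin.sum_univ_two]
    simp only [h.dd_frame_comm 0 k hz, h.dd_frame_comm 1 k hz]
    ring
  have hIZ : ∀ m i, inner ℝ (mulI (Z z)) (dd (e m) (coframe Φ e i) z)
      = ∑ k, gradCoord Φ e k z * inner ℝ (mulI (frame Φ e k z)) (dd (e m) (coframe Φ e i) z) :=
    fun m i => h.inner_mulI_angleGrad_eq_sum _ hz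
  have h8 : ∀ k i, inner ℝ (mulI (Z z)) (dd (e k) (S i) z)
      = density Φ e z * inner ℝ (mulI (Z z)) (dd (e k) (coframe Φ e i) z) := by
    intro k i
    rw [hdS, inner_add_right, inner_smul_right, inner_smul_right,
      h.inner_mulI_angleGrad_coframe i hz]
    ring
  have h9 : ∀ k i, inner ℝ (mulI (dd (e i) Z z)) (dd (e k) (S i) z)
      = density Φ e z * inner ℝ (mulI (dd (e i) Z z)) (dd (e k) (coframe Φ e i) z)
        + dd (e k) (density Φ e) z * inner ℝ (mulI (dd (e i) Z z)) (coframe Φ e i z) := by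
    intro k i
    rw [hdS, inner_add_right, inner_smul_right, inner_smul_right]
  have ht0 := hthird 0
  have ht1 := hthird 1
  simp only [hmul, h8, h9, hexp, hgc]
  simp only [Fin.sum_univ_two] at hdiv ht0 ht1 ⊢
  have q00 := hIZ 0 0
  have q01 := hIZ 0 1
  have q10 := hIZ 1 0
  have q11 := hIZ 1 1
  simp only [Fin.sum_univ_two] at q00 q01 q10 q11
  linear_combination gradCoord Φ e 0 z * ht0 + gradCoord Φ e 1 z * ht1
    + (gradCoord Φ e 0 z * dd (e 0) (density Φ e) z
      + gradCoord Φ e 1 z * dd (e 1) (density Φ e) z) * hdiv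
    - density Φ e z * (inner ℝ (dd (e 0) Z z) (coframe Φ e 0 z) * q00
      + inner ℝ (dd (e 0) Z z) (coframe Φ e 1 z) * q10
      + inner ℝ (dd (e 1) Z z) (coframe Φ e 0 z) * q01
      + inner ℝ (dd (e 1) Z z) (coframe Φ e 1 z) * q11)

end IsLegendrianOn

end Codazzi

/-! ### First variation of the Willmore integrand as a divergence -/

section WillmoreVariation

variable {E : Type*} [NormedAddCommGroup E] [NormedSpace ℝ E]
  {Φ : E → C3} {e : Fin 2 → E} {Ω : Set E}

/-- The Willmore integrand with respect to the coordinates. -/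
noncomputable def willmoreDensity (Φ : E → C3) (e : Fin 2 → E) (z : E) : ℝ :=
  (1 / 4 * inner ℝ (angleGrad Φ e z) (angleGrad Φ e z) + 1) * density Φ e z

namespace IsLegendrianOn

variable (h : IsLegendrianOn Φ e Ω)
include h

theorem willmoreDensity_smooth : ContDiffOn ℝ ∞ (willmoreDensity Φ e) Ω :=
  ((contDiffOn_const.mul (h.angleGrad_smooth.inner ℝ h.angleGrad_smooth)).add
    contDiffOn_const).mul h.density_smooth

theorem contact_smooth (v : E) :
    ContDiffOn ℝ ∞ (fun x => (inner ℝ (dd v Φ x) (mulI (Φ x)) : ℝ)) Ω :=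
  (h.smooth.dd h.isOpen v).inner ℝ (mulI.contDiff.comp_contDiffOn h.smooth)

theorem fluxCoord_smooth (v : E) (k : Fin 2) : ContDiffOn ℝ ∞ (fluxCoord Φ e v k) Ω := by
  have s1 := h.angleGrad_smooth.inner ℝ h.angleGrad_smooth
  have s2 := (contDiffOn_const (c := (1 / 4 : ℝ)).mul s1).add
    (contDiffOn_const (c := (1 : ℝ)) (s := Ω) (n := ∞))
  have s3 := h.smooth.dd h.isOpen v
  exact ((((contDiffOn_const.mul ((h.angleForm_smooth v).sub (h.angleGrad_smooth.inner ℝ s3))).sub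
    (contDiffOn_const.mul ((h.contact_smooth v).mul s2))).mul (h.gradCoord_smooth k)).add
    (s2.mul (s3.inner ℝ (h.coframe_smooth k)))).add
    ((contDiffOn_const.mul (h.contact_smooth v)).mul (h.cubicCoord_smooth k))

theorem sum_inner_coframe_mul_comm (A B : C3) {z : E} (hz : z ∈ Ω) :
    ∑ j, inner ℝ A (coframe Φ e j z) * inner ℝ (frame Φ e j z) B
      = (∑ j, inner ℝ A (frame Φ e j z) * inner ℝ (coframe Φ e j z) B : ℝ) := by
  simp only [h.frame_eq_sum _ hz, inner_sum, sum_inner, inner_smul_left, inner_smul_right,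
    Fin.sum_univ_two, conj_trivial, frameGram_comm z 1 0, inner_add_left, inner_add_right]
  ring

/-- Both sides are derivatives of `angleForm` minus a term containing a mixed second derivative of
`Φ`; closedness of the angle form and symmetry of that derivative give the claim. -/
theorem inner_dd_angleGrad_frame_comm (i j : Fin 2) {z : E} (hz : z ∈ Ω) :
    inner ℝ (dd (e i) (angleGrad Φ e) z) (frame Φ e j z)
      = inner ℝ (dd (e j) (angleGrad Φ e) z) (frame Φ e i z) := by
  have key : ∀ i j, dd (e i) (angleForm Φ e (e j)) z
      = inner ℝ (angleGrad Φ e z) (dd (e i) (frame Φ e j) z)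
        + inner ℝ (dd (e i) (angleGrad Φ e) z) (frame Φ e j z) := by
    intro i j
    rw [← dd_inner (h.differentiableAt hz h.angleGrad_smooth)
      (h.differentiableAt hz (h.frame_smooth j))]
    exact dd_congr_of_isOpen h.isOpen (fun x hx => (h.inner_angleGrad_frame j hx).symm) _ hz
  have h1 := key i j
  have h2 := key j i
  rw [h.dd_angleForm (e i) j hz, h2, h.dd_frame_comm i j hz] at h1
  linarith

/-- By closedness the variation of `θₖ` is the `k`-th derivative of the variation of θ. The leading
term is then a derivative along `Z`, which integrates by parts when `Z` is divergence free. -/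
theorem inner_angleGrad_dd (v : E) {z : E} (hz : z ∈ Ω) :
    inner ℝ (angleGrad Φ e z) (dd v (angleGrad Φ e) z)
      = ∑ k, gradCoord Φ e k z * (dd (e k) (angleForm Φ e v) z
        - inner ℝ (angleGrad Φ e z) (dd v (frame Φ e k) z)) := by
  rw [h.inner_angleGrad_eq_sum _ hz]
  refine Finset.sum_congr rfl fun k _ => ?_
  rw [← h.dd_angleForm v k hz, ← dd_congr_of_isOpen h.isOpen
    (fun x hx => h.inner_angleGrad_frame k hx) v hz,
    dd_inner (h.differentiableAt hz h.angleGrad_smooth) (h.differentiableAt hz (h.frame_smooth k)),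
    real_inner_comm]
  ring

/-- First variation of the Willmore integrand of a contact stationary surface. -/
theorem dd_willmoreDensity (v : E) {z : E} (hz : z ∈ Ω)
    (hdiv : ∑ k, dd (e k) (fun x => density Φ e x * gradCoord Φ e k x) z = 0)
    (htr : ∑ i, ∑ m, inner ℝ (dd (e i) (angleGrad Φ e) z) (coframe Φ e m z)
      * inner ℝ (mulI (angleGrad Φ e z)) (dd (e m) (coframe Φ e i) z) = (0 : ℝ)) :
    dd v (willmoreDensity Φ e) z
      = ∑ k, dd (e k) (fun x => density Φ e x * fluxCoord Φ e v k x) z := by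
  have hF := h.legendrianFrame hz
  have sV := h.smooth.dd h.isOpen v
  have dρ := h.differentiableAt hz h.density_smooth
  have dZ := h.differentiableAt hz h.angleGrad_smooth
  have dV := h.differentiableAt hz sV
  have dθ := h.differentiableAt hz (h.angleForm_smooth v)
  have du := h.differentiableAt hz (h.contact_smooth v)
  have sZZ := h.angleGrad_smooth.inner ℝ h.angleGrad_smooth
  have dZZ := h.differentiableAt hz sZZ
  have sZV := h.angleGrad_smooth.inner ℝ sV
  have dZV := h.differentiableAt hz sZV
  set Z := angleGrad Φ e with hZ
  set V := dd v Φ with hV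
  set ρ := density Φ e with hρ
  set θ := angleForm Φ e v with hθ
  let u : E → ℝ := fun x => inner ℝ (V x) (mulI (Φ x))
  let E' : E → ℝ := fun x => 1 / 4 * inner ℝ (Z x) (Z x) + 1
  -- The coefficient of `Z` in the flux: half of `∂ᵥθ - ⟪Z, V⟫` from the variation of `|Z|²/4`, and
  -- `-uE/2` from the variation of the area element.
  let a : E → ℝ := fun x => 1 / 2 * (θ x - inner ℝ (Z x) (V x)) - 1 / 2 * (u x * E' x)
  have sE : ContDiffOn ℝ ∞ E' Ω := (contDiffOn_const.mul sZZ).add contDiffOn_const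
  have dE := h.differentiableAt hz sE
  have sa : ContDiffOn ℝ ∞ a Ω :=
    (contDiffOn_const.mul ((h.angleForm_smooth v).sub sZV)).sub
      (contDiffOn_const.mul ((h.contact_smooth v).mul sE))
  have da := h.differentiableAt hz sa
  have hdE : ∀ w, dd w E' z = 1 / 2 * inner ℝ (Z z) (dd w Z z) := by
    intro w
    change dd w (fun x => 1 / 4 * inner ℝ (Z x) (Z x) + 1) z = _
    rw [dd_add (dZZ.const_mul _) (differentiableAt_const _), dd_const_mul _ dZZ, dd_const,
      dd_inner dZ dZ, real_inner_comm (Z z)]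
    ring
  have hda : ∀ k, dd (e k) a z = 1 / 2 * (dd (e k) θ z - (inner ℝ (Z z) (dd (e k) V z)
      + inner ℝ (dd (e k) Z z) (V z)))
      - 1 / 2 * (u z * (1 / 2 * inner ℝ (Z z) (dd (e k) Z z)) + dd (e k) u z * E' z) := by
    intro k
    change dd (e k) (fun x => 1 / 2 * (θ x - inner ℝ (Z x) (V x)) - 1 / 2 * (u x * E' x)) z = _
    rw [dd_sub ((dθ.fun_sub dZV).const_mul _) ((du.fun_mul dE).const_mul _),
      dd_const_mul _ (dθ.fun_sub dZV), dd_const_mul _ (du.fun_mul dE), dd_sub dθ dZV,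
      dd_inner dZ dV, dd_mul du dE, hdE]
  have dρz : ∀ k, DifferentiableAt ℝ (fun x => ρ x * gradCoord Φ e k x) z :=
    fun k => h.differentiableAt hz (h.density_smooth.mul (h.gradCoord_smooth k))
  have dρT : ∀ k, DifferentiableAt ℝ (fun x => ρ x * inner ℝ (V x) (coframe Φ e k x)) z :=
    fun k => h.differentiableAt hz (h.density_smooth.mul (sV.inner ℝ (h.coframe_smooth k)))
  have dρc : ∀ k, DifferentiableAt ℝ (fun x => ρ x * cubicCoord Φ e k x) z :=
    fun k => h.differentiableAt hz (h.density_smooth.mul (h.cubicCoord_smooth k))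
  have hflux : ∀ k, dd (e k) (fun x => ρ x * fluxCoord Φ e v k x) z
      = (a z * dd (e k) (fun x => ρ x * gradCoord Φ e k x) z
          + dd (e k) a z * (ρ z * gradCoord Φ e k z))
        + (E' z * dd (e k) (fun x => ρ x * inner ℝ (V x) (coframe Φ e k x)) z
          + dd (e k) E' z * (ρ z * inner ℝ (V z) (coframe Φ e k z)))
        + (1 / 4 * u z * dd (e k) (fun x => ρ x * cubicCoord Φ e k x) z
          + 1 / 4 * dd (e k) u z * (ρ z * cubicCoord Φ e k z)) := by
    intro k
    have : (fun x => ρ x * fluxCoord Φ e v k x) = fun x => a x * (ρ x * gradCoord Φ e k x)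
        + E' x * (ρ x * inner ℝ (V x) (coframe Φ e k x))
        + 1 / 4 * u x * (ρ x * cubicCoord Φ e k x) := by
      ext x
      simp only [fluxCoord, a, E', u]
      ring
    rw [this, dd_add ((da.fun_mul (dρz k)).fun_add (dE.fun_mul (dρT k)))
      ((du.const_mul _).fun_mul (dρc k)), dd_add (da.fun_mul (dρz k)) (dE.fun_mul (dρT k)),
      dd_mul da (dρz k), dd_mul dE (dρT k), dd_mul (du.const_mul _) (dρc k), dd_const_mul _ du]
  have hcub := h.sum_dd_density_mul_cubicCoord hz
  rw [htr, mul_zero, add_zero] at hcub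
  have harea := h.dd_density_eq_divergence v hz
  have hZv := h.inner_angleGrad_dd v hz
  -- Here `V` is split into its tangential part and its normal part, whose components along `iFʲ`
  -- are `∂ⱼu/2`. There is no contribution along `Φ` or `iΦ`, since `⟪V, Φ⟫ = 0` and `⟪iΦ, ∂ₖZ⟫ =
  -- 0`.
  have hVZ : ∀ k, inner ℝ (dd (e k) Z z) (V z)
      = ∑ j, (inner ℝ (V z) (coframe Φ e j z) * inner ℝ (dd (e k) Z z) (frame Φ e j z)
        + 1 / 2 * dd (e j) u z * inner ℝ (dd (e k) Z z) (mulI (coframe Φ e j z))) := by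
    intro k
    have h1 : inner ℝ (V z) (Φ z) = (0 : ℝ) := by rw [real_inner_comm, h.inner_dd v hz]
    have h2 : inner ℝ (mulI (Φ z)) (dd (e k) Z z) = (0 : ℝ) := by
      have := h.dd_inner_mulI_const h.angleGrad_smooth h.smooth
        (fun _ hz => h.inner_angleGrad_mulI_base hz) (e k) hz
      have h5 := h.inner_angleGrad_mulI_frame k hz
      rw [frame] at h5
      rw [h5] at this
      rw [real_inner_comm]
      linarith
    have h3 := h.sum_inner_coframe_mul_comm (mulI (V z)) (mulI (dd (e k) Z z)) hz
    have hu : ∀ j, dd (e j) u z = 2 * inner ℝ (V z) (mulI (frame Φ e j z)) :=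
      fun j => h.dd_contact v j hz
    rw [real_inner_comm, hF.inner_expand (V z), h1, h2]
    simp only [inner_mulI_left (V z), inner_mulI_right _ (dd (e k) Z z), Fin.sum_univ_two] at h3
    simp only [hu, Fin.sum_univ_two, real_inner_comm _ (dd (e k) Z z)]
    linear_combination h3
  have hsym := h.inner_dd_angleGrad_frame_comm 0 1 hz
  have hZe : ∀ k, inner ℝ (Z z) (dd (e k) Z z)
      = ∑ l, gradCoord Φ e l z * inner ℝ (dd (e k) Z z) (frame Φ e l z) := by
    intro k
    rw [h.inner_angleGrad_eq_sum _ hz]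
    exact Finset.sum_congr rfl fun l _ => by rw [real_inner_comm]
  have hVk : ∀ k, dd v (frame Φ e k) z = dd (e k) V z := fun k => h.dd_frame k v hz
  have hw : dd v (willmoreDensity Φ e) z
      = E' z * dd v ρ z + 1 / 2 * inner ℝ (Z z) (dd v Z z) * ρ z := by
    rw [← hdE]
    exact dd_mul dE dρ
  rw [hw]
  have hVZ0 := hVZ 0
  have hVZ1 := hVZ 1
  have hZe0 := hZe 0
  have hZe1 := hZe 1
  simp only [hVk, Fin.sum_univ_two] at hZv hdiv hcub harea hVZ0 hVZ1 hZe0 hZe1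
  have hck : ∀ k, cubicCoord Φ e k z
      = gradCoord Φ e 0 z * inner ℝ (dd (e 0) Z z) (mulI (coframe Φ e k z))
        + gradCoord Φ e 1 z * inner ℝ (dd (e 1) Z z) (mulI (coframe Φ e k z)) :=
    fun k => Fin.sum_univ_two _
  simp only [hflux, hda, hdE, Fin.sum_univ_two, hck]
  -- The first line inserts the variations of area and of `|Z|²`, the vanishing of `Div Z`, and the
  -- Codazzi identity for `u/4` times the cubic term. The remaining lines match the tangential part
  -- of `⟪∂_Z Z, V⟫` with the derivative of `E'` along `Vᵀ` by symmetry of the Hessian, and its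
  -- normal part with the derivative of `u` along the cubic field.
  linear_combination E' z * harea + 1 / 2 * ρ z * hZv - a z * hdiv - 1 / 4 * u z * hcub
    + 1 / 2 * ρ z * (gradCoord Φ e 0 z * hVZ0 + gradCoord Φ e 1 z * hVZ1)
    - 1 / 2 * ρ z * (inner ℝ (V z) (coframe Φ e 0 z) * hZe0
      + inner ℝ (V z) (coframe Φ e 1 z) * hZe1)
    + 1 / 2 * ρ z * (gradCoord Φ e 0 z * inner ℝ (V z) (coframe Φ e 1 z)
      - gradCoord Φ e 1 z * inner ℝ (V z) (coframe Φ e 0 z)) * hsym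

end IsLegendrianOn

end WillmoreVariation

/-! ### The geometry of a parametrized surface in terms of the frame -/

theorem dd_dd {E F : Type*} [NormedAddCommGroup E] [NormedSpace ℝ E] [NormedAddCommGroup F]
    [NormedSpace ℝ F] {k : E → F} {z : E} (hk : DifferentiableAt ℝ (fderiv ℝ k) z) (v w : E) :
    dd v (dd w k) z = fderiv ℝ (fderiv ℝ k) z v w := by
  have := (hk.hasFDerivAt.clm_apply (hasFDerivAt_const w z)).fderiv
  rw [dd, show dd w k = fun y => (fderiv ℝ k y) w from rfl, this]
  simp

theorem frameGram_inv_comm {E : Type*} [NormedAddCommGroup E] [NormedSpace ℝ E] (Φ : E → C3)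
    (e : Fin 2 → E) (z : E) (i j : Fin 2) :
    (frameGram Φ e z)⁻¹ i j = (frameGram Φ e z)⁻¹ j i := by
  have := frameGram_comm (Φ := Φ) (e := e) z 0 1
  fin_cases i <;> fin_cases j <;> simp [frameGram_inv_apply, Matrix.adjugate_fin_two, this]

/-- Differentiate the Lagrangian condition. Together with the symmetry of second derivatives this
makes the cubic form `⟪∂ᵢFⱼ, iFₖ⟫` symmetric in all three indices. -/
theorem IsLegendrianOn.inner_dd_frame_symm {E : Type*} [NormedAddCommGroup E] [NormedSpace ℝ E]
    {Φ : E → C3} {e : Fin 2 → E} {Ω : Set E} (h : IsLegendrianOn Φ e Ω) (v : E) (j k : Fin 2)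
    {z : E} (hz : z ∈ Ω) :
    inner ℝ (dd v (frame Φ e j) z) (mulI (frame Φ e k z))
      = inner ℝ (dd v (frame Φ e k) z) (mulI (frame Φ e j z)) := by
  have := h.dd_inner_mulI_const (h.frame_smooth j) (h.frame_smooth k)
    (fun _ hz => h.frame_lag j k hz) v hz
  rw [inner_mulI_right, real_inner_comm, neg_inj] at this
  exact this.symm

section Parametrized

variable {F : Plane → C3} {U : Set Plane}

theorem tangentPart_eq (F : Plane → C3) (p : Plane) (W : C3) :
    tangentPart F p W = ∑ k, (inner ℝ W (coframe F coordVec k p) : ℝ) • coordVec k := by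
  rw [tangentPart, Finset.sum_comm]
  refine Finset.sum_congr rfl fun k _ => ?_
  rw [← Finset.sum_smul, coframe, inner_sum]
  congr 1
  refine Finset.sum_congr rfl fun i _ => ?_
  rw [inner_smul_right, frameGram_inv_comm]
  rfl

theorem fderiv_tangentPart (F : Plane → C3) (p : Plane) (W : C3) :
    fderiv ℝ F p (tangentPart F p W)
      = ∑ k, (inner ℝ W (coframe F coordVec k p) : ℝ) • frame F coordVec k p := by
  rw [tangentPart_eq, map_sum]
  exact Finset.sum_congr rfl fun k _ => by rw [map_smul]; rfl

theorem coframe_inner_dd_frame (v : Plane) (j k : Fin 2) {p : Plane} :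
    inner ℝ (dd v (frame F coordVec j) p) (mulI (coframe F coordVec k p))
      = ∑ l, (frameGram F coordVec p)⁻¹ k l
        * inner ℝ (dd v (frame F coordVec j) p) (mulI (frame F coordVec l p)) := by
  rw [coframe, map_sum, inner_sum]
  exact Finset.sum_congr rfl fun l _ => by rw [map_smul, inner_smul_right]

variable (h : IsLegendrianOn F coordVec U)
include h

theorem normalPart_eq (W : C3) {p : Plane} (hp : p ∈ U) :
    normalPart F p W = (inner ℝ (mulI (F p)) W : ℝ) • mulI (F p)
      + ∑ k, (inner ℝ (mulI (coframe F coordVec k p)) W : ℝ) • mulI (frame F coordVec k p) := by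
  have := (h.legendrianFrame hp).expand W
  rw [normalPart, fderiv_tangentPart]
  simp only [real_inner_comm W, Finset.sum_add_distrib] at this ⊢
  conv_lhs => enter [1, 1]; rw [this]
  abel

theorem secondFF_eq_normalPart (i j : Fin 2) {p : Plane} (hp : p ∈ U) :
    secondFF F p (coordVec i) (coordVec j)
      = normalPart F p (dd (coordVec i) (frame F coordVec j) p) := by
  have hd : DifferentiableAt ℝ (fderiv ℝ F) p :=
    ((h.smooth.fderiv_of_isOpen h.isOpen (m := ∞) (by simp)).contDiffAt
      (h.isOpen.mem_nhds hp)).differentiableAt (by simp)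
  rw [secondFF, ← dd_dd hd]
  rfl

/-- Differentiating the contact condition leaves a product that the Lagrangian condition kills.
Hence the second fundamental form has no Reeb component. -/
theorem inner_mulI_dd_frame_eq_zero (i j : Fin 2) {p : Plane} (hp : p ∈ U) :
    inner ℝ (mulI (F p)) (dd (coordVec i) (frame F coordVec j) p) = (0 : ℝ) := by
  rw [inner_mulI_left, h.inner_mulI_dd_frame j _ hp, neg_neg]
  exact h.frame_lag i j hp

theorem secondFF_eq (i j : Fin 2) {p : Plane} (hp : p ∈ U) :
    secondFF F p (coordVec i) (coordVec j)
      = ∑ k, (inner ℝ (dd (coordVec i) (frame F coordVec j) p)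
        (mulI (coframe F coordVec k p)) : ℝ) • mulI (frame F coordVec k p) := by
  rw [secondFF_eq_normalPart h i j hp, normalPart_eq h _ hp, inner_mulI_dd_frame_eq_zero h i j hp,
    zero_smul, zero_add]
  simp only [real_inner_comm]

theorem secondFF_bilin (v w : Plane) {p : Plane} (hp : p ∈ U) :
    secondFF F p v w = ∑ i, ∑ j, (v i * w j) • secondFF F p (coordVec i) (coordVec j) := by
  have hv : ∀ v : Plane, v = ∑ i, v i • coordVec i := by
    intro v
    ext i
    fin_cases i <;> simp [coordVec, Fin.sum_univ_two]
  have hN : ∀ (ι : Type) (s : Finset ι) (c : ι → ℝ) (W : ι → C3),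
      normalPart F p (∑ i ∈ s, c i • W i) = ∑ i ∈ s, c i • normalPart F p (W i) := by
    intro ι s c W
    simp only [normalPart_eq h _ hp, inner_sum, inner_smul_right, Finset.sum_smul, smul_add,
      Finset.smul_sum, smul_smul, Finset.sum_add_distrib]
    rw [Finset.sum_comm]
  conv_lhs => rw [secondFF, hv v, hv w]
  simp only [map_sum, map_smul, sum_apply, smul_apply,
    Finset.smul_sum, smul_smul]
  simp only [← Finset.sum_product', hN]
  simp only [Finset.sum_product, Fin.sum_univ_two, secondFF]
  module

/-- The mean curvature traces the cubic form over its first two indices, while the angle form traces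
it over the last two; total symmetry makes the traces agree. -/
theorem meanCurv_eq {p : Plane} (hp : p ∈ U) :
    meanCurv F p = mulI (angleGrad F coordVec p) := by
  rw [meanCurv, h.angleGrad_eq_sum hp, map_sum]
  simp_rw [secondFF_eq h _ _ hp, Finset.smul_sum, smul_smul]
  have hg : ∀ k, gradCoord F coordVec k p = ∑ i, ∑ j, (gram F p)⁻¹ i j
      * inner ℝ (dd (coordVec i) (frame F coordVec j) p) (mulI (coframe F coordVec k p)) := by
    intro k
    have h1 : gradCoord F coordVec k p
        = ∑ l, angleForm F coordVec (coordVec l) p * (frameGram F coordVec p)⁻¹ k l := by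
      rw [gradCoord, angleGrad, sum_inner]
      refine Finset.sum_congr rfl fun l _ => ?_
      rw [inner_smul_left]
      conv_lhs => rw [coframe.eq_1 F coordVec k p]
      have hdu : ∀ j, inner ℝ (coframe F coordVec l p) (frame F coordVec j p)
        = if l = j then (1 : ℝ) else 0 := fun j => (h.legendrianFrame hp).dual l j
      simp [-Fin.sum_univ_two, inner_sum, inner_smul_right, hdu]
    have h2 := h.dd_frame_comm 0 1 hp
    have h3 := h.inner_dd_frame_symm (coordVec 0) 0 1 hp
    have h4 := h.inner_dd_frame_symm (coordVec 1) 0 1 hp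
    have h5 := frameGram_inv_comm F coordVec p 1 0
    rw [h1]
    simp only [h.angleForm_eq _ hp, coframe_inner_dd_frame]
    change _ = ∑ i, ∑ j, (frameGram F coordVec p)⁻¹ i j * _
    simp only [Fin.sum_univ_two, h5]
    simp only [h2] at h3 h4 ⊢
    simp only [← h3, ← h4]
    ring
  simp_rw [map_smul, hg, Finset.sum_smul]
  rw [Finset.sum_comm' (s := Finset.univ) (t := fun _ => Finset.univ) (t' := Finset.univ)
    (s' := fun _ => Finset.univ) (by simp)]
  simp only [Fin.sum_univ_two]
  abel

theorem neg_I_smul_meanCurv {p : Plane} (hp : p ∈ U) :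
    -(Complex.I • meanCurv F p) = angleGrad F coordVec p := by
  rw [meanCurv_eq h hp, ← mulI_apply, mulI_mulI, neg_neg]

theorem contactJ_meanCurv {p : Plane} (hp : p ∈ U) :
    contactJ (F p) (meanCurv F p) = -angleGrad F coordVec p := by
  have : contactForm (F p) (meanCurv F p) = 0 := by
    rw [contactForm, reeb, meanCurv_eq h hp, ← mulI_apply, inner_mulI_mulI, real_inner_comm,
      h.inner_angleGrad_base hp]
  rw [contactJ, this, zero_smul, sub_zero, ← neg_I_smul_meanCurv h hp, neg_neg]

theorem fderiv_fieldJH {p : Plane} (hp : p ∈ U) :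
    fderiv ℝ F p (fieldJH F p) = -angleGrad F coordVec p := by
  rw [fieldJH, fderiv_tangentPart, contactJ_meanCurv h hp]
  conv_rhs => rw [h.angleGrad_eq_sum hp, ← Finset.sum_neg_distrib]
  refine Finset.sum_congr rfl fun k _ => ?_
  rw [inner_neg_left, neg_smul]
  rfl

theorem covDeriv_fieldJH (v : Plane) {p : Plane} (hp : p ∈ U) :
    covDeriv F (fieldJH F) p v = -∑ k, (inner ℝ (dd v (angleGrad F coordVec) p)
      (coframe F coordVec k p) : ℝ) • coordVec k := by
  have h1 : fderiv ℝ (fun q => fderiv ℝ F q (fieldJH F q)) p v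
      = -dd v (angleGrad F coordVec) p := by
    have := dd_congr_of_isOpen h.isOpen (fun q hq => fderiv_fieldJH h hq) v hp
    rw [dd] at this
    rw [this, dd, fderiv_fun_neg]
    rfl
  rw [covDeriv, h1, tangentPart_eq, ← Finset.sum_neg_distrib]
  exact Finset.sum_congr rfl fun k _ => by rw [inner_neg_left, neg_smul]

theorem inner_secondFF_mulI_angleGrad (i j : Fin 2) {p : Plane} (hp : p ∈ U) :
    inner ℝ (secondFF F p (coordVec i) (coordVec j)) (mulI (angleGrad F coordVec p))
      = inner ℝ (dd (coordVec i) (frame F coordVec j) p) (mulI (angleGrad F coordVec p)) := by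
  rw [secondFF_eq h i j hp, sum_inner]
  conv_rhs => rw [h.angleGrad_eq_sum hp, map_sum, inner_sum]
  have h2 : ∀ k, inner ℝ (frame F coordVec k p) (angleGrad F coordVec p)
      = angleForm F coordVec (coordVec k) p := fun k => by
    rw [real_inner_comm, h.inner_angleGrad_frame k hp]
  have h3 : ∀ k, gradCoord F coordVec k p
      = ∑ l, (frameGram F coordVec p)⁻¹ k l * angleForm F coordVec (coordVec l) p := by
    intro k
    rw [gradCoord, coframe, inner_sum]
    exact Finset.sum_congr rfl fun l _ => by
      rw [inner_smul_right, h.inner_angleGrad_frame l hp]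
  have h5 := frameGram_inv_comm F coordVec p 1 0
  simp only [inner_smul_left, map_smul, inner_smul_right, inner_mulI_mulI, h2, h3,
    coframe_inner_dd_frame, Fin.sum_univ_two, conj_trivial, h5]
  ring

theorem inner_mulI_angleGrad_dd_coframe_eq (m j : Fin 2) {p : Plane} (hp : p ∈ U) :
    inner ℝ (mulI (angleGrad F coordVec p)) (dd (coordVec m) (coframe F coordVec j) p)
      = ∑ i, (frameGram F coordVec p)⁻¹ i j
        * inner ℝ (dd (coordVec m) (frame F coordVec i) p) (mulI (angleGrad F coordVec p)) := by
  have h1 : ∀ i, inner ℝ (dd (coordVec m) (frame F coordVec i) p) (mulI (angleGrad F coordVec p))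
      = ∑ k, gradCoord F coordVec k p
        * inner ℝ (dd (coordVec m) (frame F coordVec k) p) (mulI (frame F coordVec i p)) := by
    intro i
    conv_lhs => rw [h.angleGrad_eq_sum hp, map_sum, inner_sum]
    exact Finset.sum_congr rfl fun k _ => by
      rw [map_smul, inner_smul_right, h.inner_dd_frame_symm _ i k hp]
  rw [h.inner_mulI_angleGrad_eq_sum _ hp]
  simp only [h.inner_mulI_frame_dd_coframe _ _ _ hp, h1, coframe_inner_dd_frame,
    Fin.sum_univ_two, frameGram_inv_comm F coordVec p 1 0]
  rw [frameGram_inv_comm F coordVec p 0 j, frameGram_inv_comm F coordVec p 1 j]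
  ring

/-- Up to sign, the trace in the hypothesis is the Hessian of the angle contracted with `⟪B(·,·),
iZ⟫`, which is the extra term in the divergence of the cubic field. -/
theorem traceTerm_eq {p : Plane} (hp : p ∈ U) :
    traceTerm F p = -∑ i, ∑ m, inner ℝ (dd (coordVec i) (angleGrad F coordVec) p)
      (coframe F coordVec m p) * inner ℝ (mulI (angleGrad F coordVec p))
        (dd (coordVec m) (coframe F coordVec i) p) := by
  have h1 : ∀ i j, inner ℝ (secondFF F p (coordVec i) (covDeriv F (fieldJH F) p (coordVec j)))
      (meanCurv F p) = -∑ m, inner ℝ (dd (coordVec j) (angleGrad F coordVec) p)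
        (coframe F coordVec m p) * inner ℝ (dd (coordVec m) (frame F coordVec i) p)
          (mulI (angleGrad F coordVec p)) := by
    intro i j
    rw [covDeriv_fieldJH h _ hp, secondFF_bilin h _ _ hp, meanCurv_eq h hp]
    have hcoef : ∀ (c : Fin 2 → ℝ) (b : Fin 2), (-∑ k, c k • coordVec k : Plane) b = -c b := by
      intro c b
      fin_cases b <;> simp [coordVec, Fin.sum_univ_two]
    have hc : ∀ a b : Fin 2, (coordVec a : Plane) b = if b = a then 1 else 0 := by
      intro a b
      simp [coordVec]
    simp only [hcoef, hc, sum_inner, inner_smul_left, inner_secondFF_mulI_angleGrad h _ _ hp,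
      conj_trivial, ite_mul, zero_mul, one_mul, Finset.sum_ite_irrel, Finset.sum_const_zero,
      Finset.sum_ite_eq', Finset.mem_univ, if_true, neg_mul, Finset.sum_neg_distrib, neg_inj]
    exact Finset.sum_congr rfl fun m _ => by rw [h.dd_frame_comm m i hp]
  rw [traceTerm]
  simp only [h1, inner_mulI_angleGrad_dd_coframe_eq h _ _ hp]
  change ∑ i, ∑ j, (frameGram F coordVec p)⁻¹ i j * _ = _
  simp only [Fin.sum_univ_two]
  ring

end Parametrized

/-! ### Invariance under changes of parameters -/

/-- The flux vector field of the first variation of the Willmore functional, for the variation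
field `V`. -/
noncomputable def flux (F V : Plane → C3) (p : Plane) : Plane :=
  (1 / 2 * (inner ℝ (V p) (mulI (F p))
      + ∑ i, ∑ j, (gram F p)⁻¹ i j * inner ℝ (fderiv ℝ V p (coordVec i))
        (mulI (fderiv ℝ F p (coordVec j)))
      - inner ℝ (-(Complex.I • meanCurv F p)) (V p))
    - 1 / 2 * (inner ℝ (V p) (mulI (F p))
      * (1 / 4 * ‖meanCurv F p‖ ^ 2 + 1))) • tangentPart F p (-(Complex.I • meanCurv F p))
  + (1 / 4 * ‖meanCurv F p‖ ^ 2 + 1) • tangentPart F p (V p)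
  + (1 / 4 * inner ℝ (V p) (mulI (F p))) • tangentPart F p (-mulI (secondFF F p
      (tangentPart F p (-(Complex.I • meanCurv F p)))
      (tangentPart F p (-(Complex.I • meanCurv F p)))))

/-- `F'` is the reparametrization `F ∘ φ` of the Legendrian immersion `F`. -/
structure IsReparametrization (F F' : Plane → C3) (φ : Plane → Plane) (U U' : Set Plane) :
    Prop where
  legendrian : IsLegendrianOn F coordVec U
  isOpen : IsOpen U'
  smooth : ContDiffOn ℝ ∞ φ U'
  mapsTo : MapsTo φ U' U
  injective : ∀ p ∈ U', Function.Injective (fderiv ℝ φ p)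
  eq : ∀ p ∈ U', F' p = F (φ p)

theorem plane_eq_sum (v : Plane) : v = ∑ i, v i • coordVec i := by
  ext i
  fin_cases i <;> simp [coordVec, Fin.sum_univ_two]

namespace IsReparametrization

variable {F F' : Plane → C3} {φ : Plane → Plane} {U U' : Set Plane}
  (h : IsReparametrization F F' φ U U')
include h

theorem differentiableAt {p : Plane} (hp : p ∈ U') : DifferentiableAt ℝ φ p :=
  h.smooth.differentiableAt_of_isOpen h.isOpen hp

theorem fderiv_comp_of_eq {W W' : Plane → C3} (hW : ∀ p ∈ U, DifferentiableAt ℝ W p)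
    (heq : ∀ p ∈ U', W' p = W (φ p)) {p : Plane} (hp : p ∈ U') :
    fderiv ℝ W' p = (fderiv ℝ W (φ p)).comp (fderiv ℝ φ p) := by
  have : W' =ᶠ[nhds p] W ∘ φ := Filter.eventuallyEq_of_mem (h.isOpen.mem_nhds hp) heq
  rw [this.fderiv_eq, fderiv_comp p (hW _ (h.mapsTo hp)) (h.differentiableAt hp)]

theorem fderiv_eq {p : Plane} (hp : p ∈ U') :
    fderiv ℝ F' p = (fderiv ℝ F (φ p)).comp (fderiv ℝ φ p) :=
  h.fderiv_comp_of_eq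
    (fun _ hq => h.legendrian.smooth.differentiableAt_of_isOpen h.legendrian.isOpen hq) h.eq hp

theorem fderiv_apply {p : Plane} (hp : p ∈ U') (v : Plane) :
    fderiv ℝ F' p v = fderiv ℝ F (φ p) (fderiv ℝ φ p v) := by
  rw [h.fderiv_eq hp]
  rfl

theorem fderiv_fderiv_apply {p : Plane} (hp : p ∈ U') (v w : Plane) :
    fderiv ℝ (fderiv ℝ F') p v w
      = fderiv ℝ (fderiv ℝ F) (φ p) (fderiv ℝ φ p v) (fderiv ℝ φ p w)
        + fderiv ℝ F (φ p) (fderiv ℝ (fderiv ℝ φ) p v w) := by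
  have heq : fderiv ℝ F' =ᶠ[nhds p] fun q => (fderiv ℝ F (φ q)).comp (fderiv ℝ φ q) :=
    Filter.eventuallyEq_of_mem (h.isOpen.mem_nhds hp) fun q hq => h.fderiv_eq hq
  have d1 : DifferentiableAt ℝ (fderiv ℝ F) (φ p) :=
    (h.legendrian.smooth.fderiv_of_isOpen h.legendrian.isOpen (m := ∞)
      (by simp)).differentiableAt_of_isOpen h.legendrian.isOpen (h.mapsTo hp)
  have d2 : DifferentiableAt ℝ (fderiv ℝ φ) p :=
    (h.smooth.fderiv_of_isOpen h.isOpen (m := ∞) (by simp)).differentiableAt_of_isOpen h.isOpen hp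
  have d3 : HasFDerivAt (fun q => fderiv ℝ F (φ q))
      ((fderiv ℝ (fderiv ℝ F) (φ p)).comp (fderiv ℝ φ p)) p :=
    d1.hasFDerivAt.comp p (h.differentiableAt hp).hasFDerivAt
  rw [heq.fderiv_eq, (d3.clm_comp d2.hasFDerivAt).fderiv]
  simp [add_comm]

theorem jacobian_det_ne_zero {p : Plane} (hp : p ∈ U') :
    (Matrix.of fun k i => (fderiv ℝ φ p (coordVec i)) k : Matrix (Fin 2) (Fin 2) ℝ).det ≠ 0 := by
  intro hdet
  obtain ⟨v, hv, hv0⟩ := Matrix.exists_mulVec_eq_zero_iff.2 hdet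
  apply hv
  have hz : fderiv ℝ φ p (∑ i, v i • coordVec i) = 0 := by
    rw [map_sum]
    ext k
    have := congrFun hv0 k
    simpa [Matrix.mulVec, dotProduct, Fin.sum_univ_two, mul_comm] using this
  have h0 : (∑ i, v i • coordVec i : Plane) = 0 :=
    h.injective p hp (by rw [hz, map_zero])
  ext k
  have := congrArg (fun w : Plane => w k) h0
  fin_cases k <;> simpa [coordVec, Fin.sum_univ_two] using this

theorem gram_eq {p : Plane} (hp : p ∈ U') :
    gram F' p = (Matrix.of fun k i => (fderiv ℝ φ p (coordVec i)) k).transpose * gram F (φ p)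
      * (Matrix.of fun k i => (fderiv ℝ φ p (coordVec i)) k) := by
  ext i j
  rw [gram, Matrix.of_apply, h.fderiv_apply hp, h.fderiv_apply hp,
    plane_eq_sum (fderiv ℝ φ p (coordVec i)), plane_eq_sum (fderiv ℝ φ p (coordVec j))]
  simp only [map_sum, map_smul, sum_inner, inner_sum, inner_smul_left, inner_smul_right,
    Matrix.mul_apply, Matrix.transpose_apply, Matrix.of_apply, gram,
    Fin.sum_univ_two, map_add, inner_add_left, inner_add_right, conj_trivial]
  simp [coordVec]
  ring

theorem gram_det_eq {p : Plane} (hp : p ∈ U') :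
    (gram F' p).det
      = (Matrix.of fun k i => (fderiv ℝ φ p (coordVec i)) k : Matrix (Fin 2) (Fin 2) ℝ).det ^ 2
        * (gram F (φ p)).det := by
  rw [h.gram_eq hp, Matrix.det_mul, Matrix.det_mul, Matrix.det_transpose]
  ring

/-- The trace of a bilinear map with respect to the induced metric is invariant. -/
theorem trace_eq {G : Type*} [AddCommGroup G] [Module ℝ G] {b : Plane → Plane → G}
    (hb : ∀ v w, b v w = ∑ i, ∑ j, (v i * w j) • b (coordVec i) (coordVec j)) {p : Plane}
    (hp : p ∈ U') :
    ∑ i, ∑ j, (gram F' p)⁻¹ i j • b (fderiv ℝ φ p (coordVec i)) (fderiv ℝ φ p (coordVec j))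
      = ∑ i, ∑ j, (gram F (φ p))⁻¹ i j • b (coordVec i) (coordVec j) := by
  set P : Matrix (Fin 2) (Fin 2) ℝ := Matrix.of fun k i => (fderiv ℝ φ p (coordVec i)) k with hP
  have hPdet : IsUnit P.det := (h.jacobian_det_ne_zero hp).isUnit
  have hPT : IsUnit P.transpose.det := by rwa [Matrix.det_transpose]
  -- Since the new Gram matrix is `Pᵀ g P`, its inverse transforms contravariantly and absorbs the
  -- Jacobians coming from the two arguments of `b`.
  have key : P * (gram F' p)⁻¹ * P.transpose = (gram F (φ p))⁻¹ := by
    rw [h.gram_eq hp, Matrix.mul_inv_rev, Matrix.mul_inv_rev, ← Matrix.mul_assoc,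
      Matrix.mul_nonsing_inv P hPdet, Matrix.one_mul, Matrix.mul_assoc,
      Matrix.nonsing_inv_mul _ hPT, Matrix.mul_one]
  rw [← key]
  simp_rw [fun i j => hb (fderiv ℝ φ p (coordVec i)) (fderiv ℝ φ p (coordVec j)),
    Matrix.mul_apply, Matrix.transpose_apply, hP, Matrix.of_apply, Fin.sum_univ_two]
  module

/-- The tangential part is the metric trace of `(v, w) ↦ ⟪W, dF v⟫ w`, so `trace_eq` applies. -/
theorem map_tangentPart {p : Plane} (hp : p ∈ U') (W : C3) :
    fderiv ℝ φ p (tangentPart F' p W) = tangentPart F (φ p) W := by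
  have := h.trace_eq (b := fun v w => (inner ℝ W (fderiv ℝ F (φ p) v) : ℝ) • w) (by
    intro v w
    conv_lhs => rw [plane_eq_sum v, plane_eq_sum w]
    simp only [map_smul, map_add, inner_add_right, inner_smul_right, Fin.sum_univ_two]
    module) hp
  simp only [tangentPart, map_sum, map_smul, h.fderiv_apply hp, mul_smul]
  exact this

theorem normalPart_eq {p : Plane} (hp : p ∈ U') (W : C3) :
    normalPart F' p W = normalPart F (φ p) W := by
  rw [normalPart, normalPart, h.fderiv_apply hp, h.map_tangentPart hp, h.eq p hp]

/-- The chain rule adds `dF` applied to a second derivative of `φ`; this is tangential and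
disappears in the normal part. -/
theorem secondFF_eq {p : Plane} (hp : p ∈ U') (v w : Plane) :
    secondFF F' p v w = secondFF F (φ p) (fderiv ℝ φ p v) (fderiv ℝ φ p w) := by
  have hq := h.mapsTo hp
  have h0 : ∀ x, normalPart F (φ p) (fderiv ℝ F (φ p) x) = 0 := by
    intro x
    have hF := h.legendrian.legendrianFrame hq
    have e1 : ∀ k, inner ℝ (mulI (F (φ p))) (fderiv ℝ F (φ p) (coordVec k)) = (0 : ℝ) := by
      intro k
      rw [inner_mulI_left, neg_eq_zero]
      exact hF.baseI k
    have e2 : ∀ j k, inner ℝ (mulI (coframe F coordVec j (φ p))) (fderiv ℝ F (φ p) (coordVec k))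
        = (0 : ℝ) := by
      intro j k
      rw [inner_mulI_left, neg_eq_zero]
      exact hF.lag' j k
    rw [LegendrianSurface.normalPart_eq h.legendrian _ hq, plane_eq_sum x]
    simp only [map_sum, map_smul, inner_sum, inner_smul_right, e1, e2, mul_zero,
      Finset.sum_const_zero, zero_smul, add_zero]
  have hadd : ∀ a b, normalPart F (φ p) (a + b)
      = normalPart F (φ p) a + normalPart F (φ p) b := by
    intro a b
    simp only [LegendrianSurface.normalPart_eq h.legendrian _ hq, inner_add_right, add_smul,
      Finset.sum_add_distrib]
    abel
  rw [secondFF, secondFF, h.normalPart_eq hp, h.fderiv_fderiv_apply hp, hadd, h0, add_zero]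

theorem meanCurv_eq {p : Plane} (hp : p ∈ U') : meanCurv F' p = meanCurv F (φ p) := by
  simp only [meanCurv, h.secondFF_eq hp]
  exact h.trace_eq (fun v w => secondFF_bilin h.legendrian v w (h.mapsTo hp)) hp

theorem map_fieldJH {p : Plane} (hp : p ∈ U') :
    fderiv ℝ φ p (fieldJH F' p) = fieldJH F (φ p) := by
  rw [fieldJH, fieldJH, h.map_tangentPart hp, h.meanCurv_eq hp, h.eq p hp]

theorem map_covDeriv {p : Plane} (hp : p ∈ U') (v : Plane) :
    fderiv ℝ φ p (covDeriv F' (fieldJH F') p v)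
      = covDeriv F (fieldJH F) (φ p) (fderiv ℝ φ p v) := by
  have d1 : ∀ q ∈ U, DifferentiableAt ℝ (fun x => fderiv ℝ F x (fieldJH F x)) q := fun q hq =>
    ((h.legendrian.angleGrad_smooth.neg).congr
      (fun x hx => fderiv_fieldJH h.legendrian hx)).differentiableAt_of_isOpen
          h.legendrian.isOpen hq
  rw [covDeriv, covDeriv, h.map_tangentPart hp, h.fderiv_comp_of_eq
    (W := fun x => fderiv ℝ F x (fieldJH F x)) d1 (fun q hq => by
      rw [h.fderiv_apply hq, h.map_fieldJH hq]) hp]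
  rfl

theorem traceTerm_eq {p : Plane} (hp : p ∈ U') : traceTerm F' p = traceTerm F (φ p) := by
  have hq := h.mapsTo hp
  have hc : ∀ w, covDeriv F (fieldJH F) (φ p) w
      = ∑ j, w j • covDeriv F (fieldJH F) (φ p) (coordVec j) := by
    intro w
    conv_lhs => rw [plane_eq_sum w]
    simp only [covDeriv, tangentPart_eq, map_sum, map_smul, sum_inner, inner_smul_left,
      Fin.sum_univ_two, map_add, inner_add_left, inner_add_right, conj_trivial]
    module
  have := h.trace_eq (b := fun v w => (inner ℝ (secondFF F (φ p) v
      (covDeriv F (fieldJH F) (φ p) w)) (meanCurv F (φ p)) : ℝ)) (by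
    intro v w
    rw [hc w]
    conv_lhs => rw [secondFF_bilin h.legendrian _ _ hq]
    conv_rhs =>
      enter [2, i, 2, j, 2]
      rw [secondFF_bilin h.legendrian _ _ hq]
    simp only [sum_inner, inner_smul_left, Fin.sum_univ_two, map_add, inner_add_left,
        inner_add_right, conj_trivial, smul_eq_mul,
      PiLp.add_apply, PiLp.smul_apply]
    simp [coordVec]
    ring) hp
  simp only [traceTerm, h.secondFF_eq hp, h.map_covDeriv hp, h.meanCurv_eq hp]
  exact this

/-- Each ingredient of the flux is a metric trace or a tangential part. Its covariance makes the
flux a vector field on the abstract surface, so contributions of different charts can be added. -/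
theorem map_flux {V V' : Plane → C3} (hV : ∀ q ∈ U, DifferentiableAt ℝ V q)
    (heq : ∀ q ∈ U', V' q = V (φ q)) {p : Plane} (hp : p ∈ U') :
    fderiv ℝ φ p (flux F' V' p) = flux F V (φ p) := by
  have hθ := h.trace_eq (b := fun v w => (inner ℝ (fderiv ℝ V (φ p) v)
      (mulI (fderiv ℝ F (φ p) w)) : ℝ)) (by
    intro v w
    conv_lhs => rw [plane_eq_sum v, plane_eq_sum w]
    simp only [map_sum, map_smul, inner_sum, sum_inner, inner_smul_left, inner_smul_right,
      Fin.sum_univ_two, map_add, inner_add_left, inner_add_right, conj_trivial, smul_eq_mul]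
    ring) hp
  have hθ' : ∑ i, ∑ j, (gram F' p)⁻¹ i j * inner ℝ (fderiv ℝ V' p (coordVec i))
        (mulI (fderiv ℝ F' p (coordVec j)))
      = ∑ i, ∑ j, (gram F (φ p))⁻¹ i j * inner ℝ (fderiv ℝ V (φ p) (coordVec i))
        (mulI (fderiv ℝ F (φ p) (coordVec j))) := by
    simp only [h.fderiv_apply hp, h.fderiv_comp_of_eq hV heq hp]
    exact hθ
  simp only [flux, map_add, map_smul, h.map_tangentPart hp, h.secondFF_eq hp, h.meanCurv_eq hp,
    hθ', h.eq p hp, heq p hp]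

end IsReparametrization

/-! ### One-parameter families of parametrized surfaces -/

/-- The coordinate directions of the plane in `ℝ × Plane`. -/
noncomputable def spaceVec (i : Fin 2) : ℝ × Plane := (0, coordVec i)

/-- The time direction in `ℝ × Plane`. -/
noncomputable def timeVec : ℝ × Plane := (1, 0)

theorem dd_spaceVec {G : Type*} [NormedAddCommGroup G] [NormedSpace ℝ G] {k : ℝ × Plane → G}
    {t : ℝ} {p : Plane} (hk : DifferentiableAt ℝ k (t, p)) (i : Fin 2) :
    dd (spaceVec i) k (t, p) = dd (coordVec i) (fun q => k (t, q)) p := by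
  have h1 : HasFDerivAt (fun q : Plane => (t, q)) (ContinuousLinearMap.inr ℝ ℝ Plane) p :=
    hasFDerivAt_prodMk_right t p
  have h2 := (hk.hasFDerivAt.comp p h1).fderiv
  rw [dd, dd, show (fun q => k (t, q)) = k ∘ fun q => (t, q) from rfl, h2]
  rfl

theorem hasDerivAt_timeVec {G : Type*} [NormedAddCommGroup G] [NormedSpace ℝ G]
    {k : ℝ × Plane → G} {t : ℝ} {p : Plane} (hk : DifferentiableAt ℝ k (t, p)) :
    HasDerivAt (fun s => k (s, p)) (dd timeVec k (t, p)) t := by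
  have h1 : HasFDerivAt (fun s : ℝ => (s, p)) (ContinuousLinearMap.inl ℝ ℝ Plane) t :=
    hasFDerivAt_prodMk_left t p
  have h2 := (hk.hasFDerivAt.comp t h1).hasDerivAt
  exact h2

namespace IsLegendrianOn

variable {Φ : ℝ × Plane → C3} {Ω : Set (ℝ × Plane)} (h : IsLegendrianOn Φ spaceVec Ω)
include h

theorem frame_slice (i : Fin 2) {t : ℝ} {p : Plane} (hp : (t, p) ∈ Ω) :
    frame Φ spaceVec i (t, p) = frame (fun q => Φ (t, q)) coordVec i p :=
  dd_spaceVec (h.differentiableAt hp h.smooth) i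

theorem frameGram_slice {t : ℝ} {p : Plane} (hp : (t, p) ∈ Ω) :
    frameGram Φ spaceVec (t, p) = frameGram (fun q => Φ (t, q)) coordVec p := by
  ext i j
  simp only [frameGram, Matrix.of_apply, h.frame_slice _ hp]

theorem coframe_slice (i : Fin 2) {t : ℝ} {p : Plane} (hp : (t, p) ∈ Ω) :
    coframe Φ spaceVec i (t, p) = coframe (fun q => Φ (t, q)) coordVec i p := by
  simp only [coframe, h.frameGram_slice hp, h.frame_slice _ hp]

theorem density_slice {t : ℝ} {p : Plane} (hp : (t, p) ∈ Ω) :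
    density Φ spaceVec (t, p) = areaDensity (fun q => Φ (t, q)) p := by
  rw [density, h.frameGram_slice hp]
  rfl

theorem slice (t : ℝ) : IsLegendrianOn (fun q => Φ (t, q)) coordVec {p | (t, p) ∈ Ω} where
  isOpen := h.isOpen.preimage (by fun_prop)
  smooth := h.smooth.comp (t := Ω) (f := fun q : Plane => (t, q)) (by fun_prop) fun _ hq => hq
  norm p hp := h.norm _ hp
  contact p hp i := by rw [← h.frame_slice i hp]; exact h.contact _ hp i
  det_pos p hp := by rw [← h.frameGram_slice hp]; exact h.det_pos _ hp

theorem dd_slice {G : Type*} [NormedAddCommGroup G] [NormedSpace ℝ G] {k : ℝ × Plane → G}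
    (hk : ContDiffOn ℝ ∞ k Ω) {k' : Plane → G} {t : ℝ} (hkk : ∀ q, (t, q) ∈ Ω → k (t, q) = k' q)
    (i : Fin 2) {p : Plane} (hp : (t, p) ∈ Ω) :
    dd (spaceVec i) k (t, p) = dd (coordVec i) k' p := by
  rw [dd_spaceVec (h.differentiableAt hp hk)]
  exact dd_congr_of_isOpen (h.slice t).isOpen hkk _ hp

theorem angleForm_slice (k : Fin 2) {t : ℝ} {p : Plane} (hp : (t, p) ∈ Ω) :
    angleForm Φ spaceVec (spaceVec k) (t, p)
      = angleForm (fun q => Φ (t, q)) coordVec (coordVec k) p := by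
  rw [h.angleForm_eq k hp, (h.slice t).angleForm_eq k hp]
  refine Finset.sum_congr rfl fun i _ => ?_
  rw [h.dd_slice (h.frame_smooth i) (fun q hq => h.frame_slice i hq) k hp, h.coframe_slice i hp]

theorem angleGrad_slice {t : ℝ} {p : Plane} (hp : (t, p) ∈ Ω) :
    angleGrad Φ spaceVec (t, p) = angleGrad (fun q => Φ (t, q)) coordVec p := by
  simp only [angleGrad, h.angleForm_slice _ hp, h.coframe_slice _ hp]

theorem gradCoord_slice (k : Fin 2) {t : ℝ} {p : Plane} (hp : (t, p) ∈ Ω) :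
    gradCoord Φ spaceVec k (t, p) = gradCoord (fun q => Φ (t, q)) coordVec k p := by
  simp only [gradCoord, h.angleGrad_slice hp, h.coframe_slice _ hp]

theorem dd_angleGrad_slice (i : Fin 2) {t : ℝ} {p : Plane} (hp : (t, p) ∈ Ω) :
    dd (spaceVec i) (angleGrad Φ spaceVec) (t, p)
      = dd (coordVec i) (angleGrad (fun q => Φ (t, q)) coordVec) p :=
  h.dd_slice h.angleGrad_smooth (fun _ hq => h.angleGrad_slice hq) i hp

theorem willmoreDensity_slice {t : ℝ} {p : Plane} (hp : (t, p) ∈ Ω) :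
    willmoreDensity Φ spaceVec (t, p)
      = (1 / 4 * ‖meanCurv (fun q => Φ (t, q)) p‖ ^ 2 + 1)
        * areaDensity (fun q => Φ (t, q)) p := by
  rw [willmoreDensity, h.angleGrad_slice hp, h.density_slice hp, ← inner_mulI_mulI,
    ← meanCurv_eq (h.slice t) hp, real_inner_self_eq_norm_sq]

theorem traceTerm_slice {t : ℝ} {p : Plane} (hp : (t, p) ∈ Ω) :
    traceTerm (fun q => Φ (t, q)) p
      = -∑ i, ∑ m, inner ℝ (dd (spaceVec i) (angleGrad Φ spaceVec) (t, p))
        (coframe Φ spaceVec m (t, p)) * inner ℝ (mulI (angleGrad Φ spaceVec (t, p)))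
          (dd (spaceVec m) (coframe Φ spaceVec i) (t, p)) := by
  rw [traceTerm_eq (h.slice t) hp]
  simp only [h.dd_angleGrad_slice _ hp, h.angleGrad_slice hp, h.coframe_slice _ hp,
    h.dd_slice (h.coframe_smooth _) (fun _ hq => h.coframe_slice _ hq) _ hp]

theorem flux_slice {t : ℝ} {p : Plane} (hp : (t, p) ∈ Ω) :
    flux (fun q => Φ (t, q)) (fun q => dd timeVec Φ (t, q)) p
      = ∑ k, fluxCoord Φ spaceVec timeVec k (t, p) • coordVec k := by
  have hs := h.slice t
  have hp' : p ∈ {p | (t, p) ∈ Ω} := hp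
  have hZ : -(Complex.I • meanCurv (fun q => Φ (t, q)) p) = angleGrad Φ spaceVec (t, p) := by
    rw [neg_I_smul_meanCurv hs hp', h.angleGrad_slice hp]
  have hH : ‖meanCurv (fun q => Φ (t, q)) p‖ ^ 2
      = inner ℝ (angleGrad Φ spaceVec (t, p)) (angleGrad Φ spaceVec (t, p)) := by
    rw [← real_inner_self_eq_norm_sq, meanCurv_eq hs hp', inner_mulI_mulI, h.angleGrad_slice hp]
  -- The trace of `⟪∂ᵢV, i∂ⱼΦ⟫` is the time derivative of the angle because time and space
  -- derivatives of `Φ` commute.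
  have hθ : inner ℝ (dd timeVec Φ (t, p)) (mulI (Φ (t, p)))
      + ∑ i, ∑ j, (gram (fun q => Φ (t, q)) p)⁻¹ i j
        * inner ℝ (fderiv ℝ (fun q => dd timeVec Φ (t, q)) p (coordVec i))
          (mulI (fderiv ℝ (fun q => Φ (t, q)) p (coordVec j)))
      = angleForm Φ spaceVec timeVec (t, p) := by
    rw [angleForm]
    congr 1
    refine Finset.sum_congr rfl fun i _ => ?_
    rw [h.coframe_slice i hp, h.dd_frame i _ hp, h.dd_slice (k' := fun q => dd timeVec Φ (t, q))
      (h.smooth.dd h.isOpen timeVec) (fun _ _ => rfl) i hp, coframe, map_sum, inner_sum]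
    refine Finset.sum_congr rfl fun j _ => ?_
    rw [map_smul, inner_smul_right]
    rfl
  have hz : tangentPart (fun q => Φ (t, q)) p (angleGrad Φ spaceVec (t, p))
      = ∑ k, gradCoord Φ spaceVec k (t, p) • coordVec k := by
    rw [tangentPart_eq]
    simp only [gradCoord, h.coframe_slice _ hp]
  have hc : ∀ k, inner ℝ (-mulI (secondFF (fun q => Φ (t, q)) p
        (∑ k, gradCoord Φ spaceVec k (t, p) • coordVec k)
        (∑ k, gradCoord Φ spaceVec k (t, p) • coordVec k)))
        (coframe (fun q => Φ (t, q)) coordVec k p)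
      = cubicCoord Φ spaceVec k (t, p) := by
    intro k
    have hcoef : ∀ b, (∑ k, gradCoord Φ spaceVec k (t, p) • coordVec k : Plane) b
        = gradCoord Φ spaceVec b (t, p) := by
      intro b
      fin_cases b <;> simp [coordVec, Fin.sum_univ_two]
    have hdZ : ∀ l, inner ℝ (dd (spaceVec l) (angleGrad Φ spaceVec) (t, p))
        (mulI (coframe Φ spaceVec k (t, p)))
        = ∑ j, gradCoord Φ spaceVec j (t, p)
          * inner ℝ (dd (spaceVec l) (frame Φ spaceVec j) (t, p))
            (mulI (coframe Φ spaceVec k (t, p))) := by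
      intro l
      rw [← h.inner_mulI_angleGrad_dd_coframe _ k hp, h.inner_mulI_angleGrad_eq_sum _ hp]
      simp only [h.inner_mulI_frame_dd_coframe _ _ _ hp]
    have hIF : ∀ i j, inner ℝ (-mulI (secondFF (fun q => Φ (t, q)) p (coordVec i) (coordVec j)))
        (coframe (fun q => Φ (t, q)) coordVec k p)
        = inner ℝ (dd (coordVec i) (frame (fun q => Φ (t, q)) coordVec j) p)
          (mulI (coframe (fun q => Φ (t, q)) coordVec k p)) := by
      intro i j
      have hd : ∀ l, inner ℝ (frame (fun q => Φ (t, q)) coordVec l p)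
          (coframe (fun q => Φ (t, q)) coordVec k p) = if l = k then (1 : ℝ) else 0 := by
        intro l
        rw [real_inner_comm]
        exact ((hs.legendrianFrame hp').dual k l).trans (by simp [eq_comm])
      rw [secondFF_eq hs i j hp', inner_neg_left, inner_mulI_left, neg_neg, sum_inner]
      simp only [inner_smul_left, inner_mulI_mulI, hd, conj_trivial, mul_ite, mul_one, mul_zero,
        Finset.sum_ite_eq', Finset.mem_univ, if_true]
    rw [secondFF_bilin hs _ _ hp', cubicCoord]
    simp only [hdZ, hcoef, Finset.mul_sum, map_sum, ← Finset.sum_neg_distrib, sum_inner]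
    refine Finset.sum_congr rfl fun i _ => Finset.sum_congr rfl fun j _ => ?_
    rw [map_smul, ← smul_neg, inner_smul_left, hIF,
      h.dd_slice (h.frame_smooth j) (fun q hq => h.frame_slice j hq) i hp, h.coframe_slice k hp]
    simp only [conj_trivial]
    ring
  rw [flux, hZ, hH, hθ, hz, tangentPart_eq, tangentPart_eq]
  simp only [hc, Finset.smul_sum, smul_smul, ← Finset.sum_add_distrib, ← add_smul]
  refine Finset.sum_congr rfl fun k _ => ?_
  rw [fluxCoord, h.coframe_slice k hp]

/-- First variation of the Willmore integrand of a family of Legendrian immersions. -/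
theorem dd_timeVec_willmoreDensity {t : ℝ} {p : Plane} (hp : (t, p) ∈ Ω)
    (hdiv : ∑ k, dd (coordVec k) (fun q => areaDensity (fun q => Φ (t, q)) q
      * gradCoord (fun q => Φ (t, q)) coordVec k q) p = 0)
    (htr : traceTerm (fun q => Φ (t, q)) p = 0) :
    dd timeVec (willmoreDensity Φ spaceVec) (t, p)
      = ∑ k, dd (coordVec k) (fun q => areaDensity (fun q => Φ (t, q)) q
        * flux (fun q => Φ (t, q)) (fun q => dd timeVec Φ (t, q)) q k) p := by
  rw [h.dd_willmoreDensity timeVec hp]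
  · refine Finset.sum_congr rfl fun k _ => ?_
    refine h.dd_slice (h.density_smooth.mul (h.fluxCoord_smooth timeVec k)) (fun q hq => ?_) k hp
    rw [h.density_slice hq, h.flux_slice hq]
    congr 1
    fin_cases k <;> simp [coordVec, Fin.sum_univ_two]
  · rw [← hdiv]
    refine Finset.sum_congr rfl fun k _ => ?_
    refine h.dd_slice (h.density_smooth.mul (h.gradCoord_smooth k)) (fun q hq => ?_) k hp
    rw [h.density_slice hq, h.gradCoord_slice k hq]
  · rw [h.traceTerm_slice hp] at htr
    linarith

/-- First variation of the area density of a family of Legendrian immersions. -/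
theorem dd_timeVec_density {t : ℝ} {p : Plane} (hp : (t, p) ∈ Ω) :
    dd timeVec (density Φ spaceVec) (t, p)
      = ∑ k, dd (coordVec k) (fun q => areaDensity (fun q => Φ (t, q)) q
          * (inner ℝ (dd timeVec Φ (t, q)) (coframe (fun q => Φ (t, q)) coordVec k q)
            - 1 / 2 * inner ℝ (dd timeVec Φ (t, q)) (mulI (Φ (t, q)))
              * gradCoord (fun q => Φ (t, q)) coordVec k q)) p
        + 1 / 2 * inner ℝ (dd timeVec Φ (t, p)) (mulI (Φ (t, p)))
          * ∑ k, dd (coordVec k) (fun q => areaDensity (fun q => Φ (t, q)) q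
            * gradCoord (fun q => Φ (t, q)) coordVec k q) p := by
  have hs := h.slice t
  have hu := h.contact_smooth timeVec
  have hT : ∀ k, ContDiffOn ℝ ∞ (fun x => density Φ spaceVec x
      * inner ℝ (dd timeVec Φ x) (coframe Φ spaceVec k x)) Ω := fun k =>
    h.density_smooth.mul ((h.smooth.dd h.isOpen timeVec).inner ℝ (h.coframe_smooth k))
  have hz : ∀ k, ContDiffOn ℝ ∞ (fun x => density Φ spaceVec x * gradCoord Φ spaceVec k x) Ω :=
    fun k => h.density_smooth.mul (h.gradCoord_smooth k)
  have e1 : ∀ k, dd (coordVec k) (fun q => areaDensity (fun q => Φ (t, q)) q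
            * gradCoord (fun q => Φ (t, q)) coordVec k q) p
      = dd (spaceVec k) (fun x => density Φ spaceVec x * gradCoord Φ spaceVec k x) (t, p) := by
    intro k
    refine (h.dd_slice (hz k) (fun q hq => ?_) k hp).symm
    rw [h.density_slice hq, h.gradCoord_slice k hq]
  have e2 : ∀ k, dd (coordVec k) (fun q => areaDensity (fun q => Φ (t, q)) q
          * (inner ℝ (dd timeVec Φ (t, q)) (coframe (fun q => Φ (t, q)) coordVec k q)
            - 1 / 2 * inner ℝ (dd timeVec Φ (t, q)) (mulI (Φ (t, q)))
              * gradCoord (fun q => Φ (t, q)) coordVec k q)) p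
      = dd (spaceVec k) (fun x => density Φ spaceVec x
          * inner ℝ (dd timeVec Φ x) (coframe Φ spaceVec k x)
        - 1 / 2 * inner ℝ (dd timeVec Φ x) (mulI (Φ x))
          * (density Φ spaceVec x * gradCoord Φ spaceVec k x)) (t, p) := by
    intro k
    refine (h.dd_slice ((hT k).sub ((contDiffOn_const.mul hu).mul (hz k))) (fun q hq => ?_)
      k hp).symm
    rw [h.density_slice hq, h.gradCoord_slice k hq, h.coframe_slice k hq]
    ring
  have dT := fun k => h.differentiableAt hp (hT k)
  have dz := fun k => h.differentiableAt hp (hz k)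
  have du := h.differentiableAt hp hu
  -- The product rule moves the derivative off the contact Hamiltonian, leaving it as an
  -- undifferentiated factor of `Div Z`.
  have e3 : ∀ k, dd (spaceVec k) (fun x => density Φ spaceVec x
          * inner ℝ (dd timeVec Φ x) (coframe Φ spaceVec k x)
        - 1 / 2 * inner ℝ (dd timeVec Φ x) (mulI (Φ x))
          * (density Φ spaceVec x * gradCoord Φ spaceVec k x)) (t, p)
      = dd (spaceVec k) (fun x => density Φ spaceVec x
          * inner ℝ (dd timeVec Φ x) (coframe Φ spaceVec k x)) (t, p)
        - (1 / 2 * inner ℝ (dd timeVec Φ (t, p)) (mulI (Φ (t, p)))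
            * dd (spaceVec k) (fun x => density Φ spaceVec x * gradCoord Φ spaceVec k x) (t, p)
          + 1 / 2 * dd (spaceVec k) (fun x => (inner ℝ (dd timeVec Φ x) (mulI (Φ x)) : ℝ)) (t, p)
            * (density Φ spaceVec (t, p) * gradCoord Φ spaceVec k (t, p))) := by
    intro k
    rw [dd_sub (dT k) ((du.const_mul _).fun_mul (dz k)), dd_mul (du.const_mul _) (dz k),
      dd_const_mul _ du]
  simp only [e1, e2, e3, h.dd_density_eq_divergence timeVec hp, Fin.sum_univ_two]
  ring

end IsLegendrianOn

/-! ### Integrals over the parameter plane -/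

theorem integral_dd_eq_zero {g : Plane → ℝ} (hg : ContDiff ℝ 1 g) (hc : HasCompactSupport g)
    (v : Plane) : ∫ p, dd v g p = 0 := by
  have hint : Integrable (fun p => fderiv ℝ g p v) volume :=
    ((hg.continuous_fderiv (by simp)).clm_apply continuous_const).integrable_of_hasCompactSupport
      ((hc.fderiv ℝ).comp_left (g := fun L : Plane →L[ℝ] ℝ => L v) rfl)
  have h1 := integral_mul_fderiv_eq_neg_fderiv_mul_of_integrable (μ := volume)
    (f := fun _ : Plane => (1 : ℝ)) (g := g) (v := v) (by simp) (by simpa using hint)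
    (by simpa using hg.continuous.integrable_of_hasCompactSupport hc)
    (fun x _ => differentiableAt_const _)
    (fun x _ => hg.differentiable (by simp) x)
  simpa [dd] using h1

/-- A function vanishing off a compact subset of `U` extends by zero to a smooth function with
compact support on the whole plane. -/
theorem setIntegral_dd_eq_zero {U K : Set Plane} (hU : IsOpen U) (hK : IsCompact K) (hKU : K ⊆ U)
    {g : Plane → ℝ} (hg : ContDiffOn ℝ ∞ g U) (hg0 : ∀ p ∈ U, p ∉ K → g p = 0) (v : Plane) :
    ∫ p in U, dd v g p = 0 := by
  have hz : ∀ p, p ∉ K → U.indicator g p = 0 := by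
    intro p hp
    by_cases hpU : p ∈ U
    · rw [indicator_of_mem hpU, hg0 p hpU hp]
    · exact indicator_of_notMem hpU g
  have heq : ∀ p ∈ U, U.indicator g =ᶠ[nhds p] g := fun p hp =>
    Filter.eventuallyEq_of_mem (hU.mem_nhds hp) fun q hq => indicator_of_mem hq g
  have heq0 : ∀ p, p ∉ K → U.indicator g =ᶠ[nhds p] fun _ => 0 := fun p hp =>
    Filter.eventuallyEq_of_mem (hK.isClosed.isOpen_compl.mem_nhds hp) fun q hq => hz q hq
  have hsm : ContDiff ℝ 1 (U.indicator g) := by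
    rw [contDiff_iff_contDiffAt]
    intro p
    by_cases hp : p ∈ K
    · exact (((hg.contDiffAt (hU.mem_nhds (hKU hp))).of_le (by simp)).congr_of_eventuallyEq
        (heq p (hKU hp)))
    · exact contDiffAt_const.congr_of_eventuallyEq (heq0 p hp)
  have hcs : HasCompactSupport (U.indicator g) := HasCompactSupport.intro hK hz
  rw [← integral_dd_eq_zero hsm hcs v, ← integral_indicator hU.measurableSet]
  congr 1
  ext p
  by_cases hp : p ∈ U
  · rw [indicator_of_mem hp, dd_congr (heq p hp)]
  · rw [indicator_of_notMem hp, dd_congr (heq0 p fun h => hp (hKU h)), dd_const]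

theorem hasDerivAt_setIntegral_mul {U Q : Set Plane} (hU : IsOpen U) (hQ : IsCompact Q)
    (hQU : Q ⊆ U) {ε : ℝ} (hε : 0 < ε) {w : ℝ × Plane → ℝ}
    (hw : ContDiffOn ℝ ∞ w (Ioo (-ε) ε ×ˢ U)) {κ : Plane → ℝ} (hκ : ContinuousOn κ Q) :
    HasDerivAt (fun t => ∫ p in Q, κ p * w (t, p)) (∫ p in Q, κ p * dd timeVec w (0, p)) 0 := by
  have hΩ : IsOpen (Ioo (-ε) ε ×ˢ U) := isOpen_Ioo.prod hU
  have hdw := hw.dd hΩ timeVec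
  -- Halving the time interval makes the parameter region compact, so a constant dominates the time
  -- derivatives.
  have hI : Icc (-(ε / 2)) (ε / 2) ⊆ Ioo (-ε) ε := fun t ht =>
    ⟨by linarith [ht.1], by linarith [ht.2]⟩
  have hcomp : IsCompact (Icc (-(ε / 2)) (ε / 2) ×ˢ Q) := isCompact_Icc.prod hQ
  have hsub : Icc (-(ε / 2)) (ε / 2) ×ˢ Q ⊆ Ioo (-ε) ε ×ˢ U := prod_mono hI hQU
  have hcont : ∀ {k : ℝ × Plane → ℝ}, ContDiffOn ℝ ∞ k (Ioo (-ε) ε ×ˢ U) → ∀ t ∈ Ioo (-ε) ε,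
      ContinuousOn (fun p => κ p * k (t, p)) Q := fun hk t ht =>
    hκ.mul (hk.continuousOn.comp (by fun_prop) fun p hp => ⟨ht, hQU hp⟩)
  have hc2 : ContinuousOn (fun z : ℝ × Plane => κ z.2 * dd timeVec w z)
      (Icc (-(ε / 2)) (ε / 2) ×ˢ Q) :=
    (hκ.comp continuousOn_snd fun z hz => hz.2).mul (hdw.continuousOn.mono hsub)
  obtain ⟨C, hC⟩ := hcomp.exists_bound_of_continuousOn hc2
  have h0 : (0 : ℝ) ∈ Ioo (-ε) ε := ⟨by linarith, hε⟩
  refine (hasDerivAt_integral_of_dominated_loc_of_deriv_le (μ := volume.restrict Q)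
    (bound := fun _ => C) (s := Icc (-(ε / 2)) (ε / 2)) (F' := fun t p => κ p * dd timeVec w (t, p))
    (Icc_mem_nhds (by linarith) (by linarith)) ?_ ?_ ?_ ?_ ?_ ?_).2
  · filter_upwards [isOpen_Ioo.mem_nhds h0] with t ht
    exact (hcont hw t ht).aestronglyMeasurable hQ.measurableSet
  · exact (hcont hw 0 h0).integrableOn_compact hQ
  · exact (hcont hdw 0 h0).aestronglyMeasurable hQ.measurableSet
  · refine (ae_restrict_mem hQ.measurableSet).mono fun p hp t ht => ?_
    exact hC (t, p) ⟨ht, hp⟩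
  · exact (continuousOn_const (c := C)).integrableOn_compact hQ
  · refine (ae_restrict_mem hQ.measurableSet).mono fun p hp t ht => ?_
    exact (hasDerivAt_timeVec (hw.differentiableAt_of_isOpen hΩ ⟨hI ht, hQU hp⟩)).const_mul _

/-! ### Legendrian immersions of a surface read in charts -/

theorem frameGram_det_pos {E : Type*} [NormedAddCommGroup E] [NormedSpace ℝ E] {Φ : E → C3}
    {e : Fin 2 → E} {z : E}
    (hinj : ∀ a b : ℝ, a • frame Φ e 0 z + b • frame Φ e 1 z = 0 → a = 0 ∧ b = 0) :
    0 < (frameGram Φ e z).det := by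
  have h1 : 0 < frameGram Φ e z 1 1 := by
    have h : (0 : ℝ) < inner ℝ (frame Φ e 1 z) (frame Φ e 1 z) :=
      real_inner_self_pos.2 fun h0 => by
        have := (hinj 0 1 (by rw [h0]; simp)).2
        norm_num at this
    exact h
  -- The component of `F₀` orthogonal to `F₁`, scaled by `g₁₁`; its squared norm is `g₁₁ det g`.
  have h2 : 0 < inner ℝ (frameGram Φ e z 1 1 • frame Φ e 0 z
      + (-frameGram Φ e z 0 1) • frame Φ e 1 z) (frameGram Φ e z 1 1 • frame Φ e 0 z
      + (-frameGram Φ e z 0 1) • frame Φ e 1 z) :=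
    real_inner_self_pos.2 fun h0 => h1.ne' (hinj _ _ h0).1
  have h3 : inner ℝ (frameGram Φ e z 1 1 • frame Φ e 0 z
      + (-frameGram Φ e z 0 1) • frame Φ e 1 z) (frameGram Φ e z 1 1 • frame Φ e 0 z
      + (-frameGram Φ e z 0 1) • frame Φ e 1 z)
      = frameGram Φ e z 1 1 * (frameGram Φ e z).det := by
    have hg : ∀ i j, (inner ℝ (frame Φ e i z) (frame Φ e j z) : ℝ) = frameGram Φ e z i j :=
      fun _ _ => rfl
    simp only [inner_add_left, inner_add_right, inner_smul_left, inner_smul_right, hg,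
      Matrix.det_fin_two, conj_trivial, frameGram_comm z 1 0]
    ring
  rw [h3] at h2
  exact pos_of_mul_pos_right h2 h1.le

section Charts

variable {M : Type*} [TopologicalSpace M] [ChartedSpace Plane M]

theorem mfderiv_eq_fderiv_inChart {f : M → C3} {x : M}
    (hf : MDifferentiableAt (𝓡 2) 𝓘(ℝ, C3) f x) :
    mfderiv (𝓡 2) 𝓘(ℝ, C3) f x = fderiv ℝ (inChart f x) (extChartAt (𝓡 2) x x) := by
  unfold mfderiv
  refine (if_pos hf).trans ?_
  rw [ModelWithCorners.range_eq_univ, fderivWithin_univ]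
  rfl

theorem IsLegendrianImmersion.inner_inChart {f : M → C3} (hf : IsLegendrianImmersion f)
    (c : M) (p : Plane) : inner ℝ (inChart f c p) (inChart f c p) = (1 : ℝ) := by
  have := hf.mem_sphere ((extChartAt (𝓡 2) c).symm p)
  rw [mem_sphere_zero_iff_norm] at this
  rw [real_inner_self_eq_norm_sq, inChart, Function.comp_apply, this, one_pow]

/-- The overlap of two charts, in the parameter domain of the second one. -/
def overlap (c x : M) : Set Plane :=
  (extChartAt (𝓡 2) x).target ∩ (extChartAt (𝓡 2) x).symm ⁻¹' (extChartAt (𝓡 2) c).source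

theorem isOpen_overlap (c x : M) : IsOpen (overlap c x) :=
  (continuousOn_extChartAt_symm x).isOpen_inter_preimage (isOpen_extChartAt_target x)
    (isOpen_extChartAt_source c)

theorem transition_mapsTo (c x : M) :
    MapsTo (extChartAt (𝓡 2) c ∘ (extChartAt (𝓡 2) x).symm) (overlap c x) (overlap x c) := by
  intro p hp
  refine ⟨(extChartAt (𝓡 2) c).map_source hp.2, ?_⟩
  simp only [mem_preimage, Function.comp_apply]
  rw [(extChartAt (𝓡 2) c).left_inv hp.2]
  exact (extChartAt (𝓡 2) x).map_target hp.1

theorem transition_leftInv (c x : M) {p : Plane} (hp : p ∈ overlap c x) :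
    (extChartAt (𝓡 2) x ∘ (extChartAt (𝓡 2) c).symm)
      ((extChartAt (𝓡 2) c ∘ (extChartAt (𝓡 2) x).symm) p) = p := by
  simp only [Function.comp_apply]
  rw [(extChartAt (𝓡 2) c).left_inv hp.2, (extChartAt (𝓡 2) x).right_inv hp.1]

theorem inChart_transition {G : Type*} (g : M → G) (c x : M) {p : Plane} (hp : p ∈ overlap c x) :
    (g ∘ (extChartAt (𝓡 2) x).symm) p = (g ∘ (extChartAt (𝓡 2) c).symm)
      ((extChartAt (𝓡 2) c ∘ (extChartAt (𝓡 2) x).symm) p) := by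
  simp only [Function.comp_apply]
  rw [(extChartAt (𝓡 2) c).left_inv hp.2]

theorem mem_overlap_self {c x : M} (hx : x ∈ (extChartAt (𝓡 2) c).source) :
    extChartAt (𝓡 2) x x ∈ overlap c x :=
  ⟨mem_extChartAt_target x, by simpa [extChartAt_to_inv] using hx⟩

theorem transition_self (c x : M) :
    (extChartAt (𝓡 2) c ∘ (extChartAt (𝓡 2) x).symm) (extChartAt (𝓡 2) x x)
      = extChartAt (𝓡 2) c x := by
  simp

variable [IsManifold (𝓡 2) ∞ M]

theorem contDiffOn_comp_extChartAt_symm {G : Type*} [NormedAddCommGroup G] [NormedSpace ℝ G]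
    {f : M → G} (hf : ContMDiff (𝓡 2) 𝓘(ℝ, G) ∞ f) (c : M) :
    ContDiffOn ℝ ∞ (f ∘ (extChartAt (𝓡 2) c).symm) (extChartAt (𝓡 2) c).target :=
  (hf.comp_contMDiffOn (contMDiffOn_extChartAt_symm (n := ∞) c)).contDiffOn

theorem contDiffOn_family {ε : ℝ} {F : ℝ → M → C3}
    (hF : ContMDiffOn (𝓘(ℝ, ℝ).prod (𝓡 2)) 𝓘(ℝ, C3) ∞ (fun z : ℝ × M => F z.1 z.2)
      (Ioo (-ε) ε ×ˢ univ)) (c : M) :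
    ContDiffOn ℝ ∞ (fun z : ℝ × Plane => inChart (F z.1) c z.2)
      (Ioo (-ε) ε ×ˢ (extChartAt (𝓡 2) c).target) := by
  rw [← contMDiffOn_iff_contDiffOn, modelWithCornersSelf_prod, ← chartedSpaceSelf_prod]
  have h1 : ContMDiffOn (𝓘(ℝ, ℝ).prod 𝓘(ℝ, Plane)) (𝓘(ℝ, ℝ).prod (𝓡 2)) ∞
      (fun z : ℝ × Plane => (z.1, (extChartAt (𝓡 2) c).symm z.2))
      (Ioo (-ε) ε ×ˢ (extChartAt (𝓡 2) c).target) :=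
    contMDiffOn_fst.prodMk ((contMDiffOn_extChartAt_symm (n := ∞) c).comp contMDiffOn_snd
      fun z hz => hz.2)
  exact hF.comp h1 fun z hz => ⟨hz.1, mem_univ _⟩

theorem fderiv_inChart {f : M → C3} (hf : ContMDiff (𝓡 2) 𝓘(ℝ, C3) ∞ f) (c : M) {p : Plane}
    (hp : p ∈ (extChartAt (𝓡 2) c).target) (v : Plane) :
    fderiv ℝ (inChart f c) p v = mfderiv (𝓡 2) 𝓘(ℝ, C3) f ((extChartAt (𝓡 2) c).symm p)
      (mfderiv 𝓘(ℝ, Plane) (𝓡 2) (extChartAt (𝓡 2) c).symm p v) := by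
  have h1 : MDifferentiableAt 𝓘(ℝ, Plane) (𝓡 2) (extChartAt (𝓡 2) c).symm p := by
    have := mdifferentiableWithinAt_extChartAt_symm (I := 𝓡 2) hp
    rwa [ModelWithCorners.range_eq_univ, mdifferentiableWithinAt_univ] at this
  rw [← mfderiv_eq_fderiv, inChart, mfderiv_comp p (hf.mdifferentiableAt (by simp)) h1]
  rfl

theorem mfderiv_extChartAt_symm_injective (c : M) {p : Plane}
    (hp : p ∈ (extChartAt (𝓡 2) c).target) :
    Function.Injective (mfderiv 𝓘(ℝ, Plane) (𝓡 2) (extChartAt (𝓡 2) c).symm p) := by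
  have h := isInvertible_mfderivWithin_extChartAt_symm (I := 𝓡 2) hp
  rw [ModelWithCorners.range_eq_univ, mfderivWithin_univ] at h
  exact h.injective

theorem IsLegendrianImmersion.fderiv_inChart_injective {f : M → C3} (hf : IsLegendrianImmersion f)
    (c : M) {p : Plane} (hp : p ∈ (extChartAt (𝓡 2) c).target) :
    Function.Injective (fderiv ℝ (inChart f c) p) := by
  intro v w hvw
  rw [fderiv_inChart hf.smooth c hp, fderiv_inChart hf.smooth c hp] at hvw
  exact mfderiv_extChartAt_symm_injective c hp (hf.immersion _ hvw)

theorem linearIndependent_of_injective {F : Plane → C3} {p : Plane}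
    (hF : Function.Injective (fderiv ℝ F p)) (a b : ℝ)
    (hab : a • fderiv ℝ F p (coordVec 0) + b • fderiv ℝ F p (coordVec 1) = 0) :
    a = 0 ∧ b = 0 := by
  rw [← map_smul, ← map_smul, ← map_add, ← map_zero (fderiv ℝ F p)] at hab
  have := hF hab
  exact ⟨by simpa [coordVec] using congrArg (fun w : Plane => w 0) this,
    by simpa [coordVec] using congrArg (fun w : Plane => w 1) this⟩

theorem IsLegendrianImmersion.contact_inChart {f : M → C3} (hf : IsLegendrianImmersion f)
    (c : M) {p : Plane} (hp : p ∈ (extChartAt (𝓡 2) c).target) (v : Plane) :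
    inner ℝ (inChart f c p) (mulI (fderiv ℝ (inChart f c) p v)) = (0 : ℝ) := by
  rw [inner_mulI_right, neg_eq_zero, fderiv_inChart hf.smooth c hp]
  have := hf.isotropic _ (mfderiv 𝓘(ℝ, Plane) (𝓡 2) (extChartAt (𝓡 2) c).symm p v)
  exact this

theorem IsLegendrianImmersion.inChart {f : M → C3} (hf : IsLegendrianImmersion f) (c : M) :
    IsLegendrianOn (inChart f c) coordVec (extChartAt (𝓡 2) c).target where
  isOpen := isOpen_extChartAt_target c
  smooth := contDiffOn_comp_extChartAt_symm hf.smooth c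
  norm p _ := hf.inner_inChart c p
  contact _ hp _ := hf.contact_inChart c hp _
  det_pos _ hp := frameGram_det_pos
    (linearIndependent_of_injective (hf.fderiv_inChart_injective c hp))

theorem IsLegendrianVariation.inChart {f : M → C3} {ε : ℝ} {K : Set M} {F : ℝ → M → C3}
    (hF : IsLegendrianVariation f ε K F) (c : M) :
    IsLegendrianOn (fun z : ℝ × Plane => LegendrianSurface.inChart (F z.1) c z.2) spaceVec
      (Ioo (-ε) ε ×ˢ (extChartAt (𝓡 2) c).target) := by
  have hopen : IsOpen (Ioo (-ε) ε ×ˢ (extChartAt (𝓡 2) c).target) :=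
    isOpen_Ioo.prod (isOpen_extChartAt_target c)
  have hsm := contDiffOn_family hF.smooth c
  have hfr : ∀ z ∈ Ioo (-ε) ε ×ˢ (extChartAt (𝓡 2) c).target, ∀ i,
      frame (fun z : ℝ × Plane => LegendrianSurface.inChart (F z.1) c z.2) spaceVec i z
        = fderiv ℝ (LegendrianSurface.inChart (F z.1) c) z.2 (coordVec i) := by
    intro z hz i
    exact dd_spaceVec (hsm.differentiableAt_of_isOpen hopen hz) i
  refine ⟨hopen, hsm, fun z hz => (hF.legendrian z.1 hz.1).inner_inChart c z.2, ?_, ?_⟩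
  · intro z hz i
    rw [hfr z hz i]
    exact (hF.legendrian z.1 hz.1).contact_inChart c hz.2 _
  · intro z hz
    refine frameGram_det_pos ?_
    rw [hfr z hz 0, hfr z hz 1]
    exact linearIndependent_of_injective
      ((hF.legendrian z.1 hz.1).fderiv_inChart_injective c hz.2)

theorem contDiffOn_transition (c x : M) :
    ContDiffOn ℝ ∞ (extChartAt (𝓡 2) c ∘ (extChartAt (𝓡 2) x).symm) (overlap c x) :=
  ((contMDiffOn_extChartAt (n := ∞) (x := c)).comp ((contMDiffOn_extChartAt_symm (n := ∞) x).mono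
    inter_subset_left) fun p hp => by simpa using hp.2).contDiffOn

/-- The chain rule for the reverse transition map provides a left inverse. -/
theorem fderiv_transition_injective (c x : M) {p : Plane} (hp : p ∈ overlap c x) :
    Function.Injective
      (fderiv ℝ (extChartAt (𝓡 2) c ∘ (extChartAt (𝓡 2) x).symm) p) := by
  have d1 := (contDiffOn_transition c x).differentiableAt_of_isOpen (isOpen_overlap c x) hp
  have d2 := (contDiffOn_transition x c).differentiableAt_of_isOpen (isOpen_overlap x c)
    (transition_mapsTo c x hp)
  have h1 := (d2.hasFDerivAt.comp p d1.hasFDerivAt).fderiv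
  have h2 : (extChartAt (𝓡 2) x ∘ (extChartAt (𝓡 2) c).symm)
      ∘ (extChartAt (𝓡 2) c ∘ (extChartAt (𝓡 2) x).symm) =ᶠ[nhds p] id :=
    Filter.eventuallyEq_of_mem ((isOpen_overlap c x).mem_nhds hp)
      fun q hq => transition_leftInv c x hq
  rw [h2.fderiv_eq, fderiv_id] at h1
  refine Function.LeftInverse.injective (g := fderiv ℝ
    (extChartAt (𝓡 2) x ∘ (extChartAt (𝓡 2) c).symm)
    ((extChartAt (𝓡 2) c ∘ (extChartAt (𝓡 2) x).symm) p)) fun v => ?_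
  exact (congrArg (fun L : Plane →L[ℝ] Plane => L v) h1).symm

theorem IsLegendrianImmersion.isReparametrization {f : M → C3} (hf : IsLegendrianImmersion f)
    (c x : M) :
    IsReparametrization (LegendrianSurface.inChart f c) (LegendrianSurface.inChart f x)
      (extChartAt (𝓡 2) c ∘ (extChartAt (𝓡 2) x).symm) (extChartAt (𝓡 2) c).target
      (overlap c x) where
  legendrian := hf.inChart c
  isOpen := isOpen_overlap c x
  smooth := contDiffOn_transition c x
  mapsTo := (transition_mapsTo c x).mono_right inter_subset_left
  injective _ hp := fderiv_transition_injective c x hp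
  eq _ hp := inChart_transition f c x hp

theorem IsLegendrianImmersion.meanCurvAt_eq {f : M → C3} (hf : IsLegendrianImmersion f) {c x : M}
    (hx : x ∈ (extChartAt (𝓡 2) c).source) :
    meanCurvAt f x = meanCurv (LegendrianSurface.inChart f c) (extChartAt (𝓡 2) c x) := by
  rw [meanCurvAt, (hf.isReparametrization c x).meanCurv_eq (mem_overlap_self hx), transition_self]

theorem IsLegendrianImmersion.traceTermAt_eq {f : M → C3} (hf : IsLegendrianImmersion f) {c x : M}
    (hx : x ∈ (extChartAt (𝓡 2) c).source) :
    traceTermAt f x = traceTerm (LegendrianSurface.inChart f c) (extChartAt (𝓡 2) c x) := by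
  rw [traceTermAt, (hf.isReparametrization c x).traceTerm_eq (mem_overlap_self hx),
    transition_self]

/-- The derivative of the function `χ` along the flux vector field, at the point `x`. -/
noncomputable def fluxDeriv (f V : M → C3) (χ : M → ℝ) (x : M) : ℝ :=
  fderiv ℝ (χ ∘ (extChartAt (𝓡 2) x).symm) (extChartAt (𝓡 2) x x)
    (flux (LegendrianSurface.inChart f x) (LegendrianSurface.inChart V x) (extChartAt (𝓡 2) x x))

theorem IsLegendrianImmersion.fluxDeriv_eq {f : M → C3} (hf : IsLegendrianImmersion f)
    {V : M → C3} (hV : ContMDiff (𝓡 2) 𝓘(ℝ, C3) ∞ V) {χ : M → ℝ}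
    (hχ : ContMDiff (𝓡 2) 𝓘(ℝ, ℝ) ∞ χ) {c x : M} (hx : x ∈ (extChartAt (𝓡 2) c).source) :
    fluxDeriv f V χ x = fderiv ℝ (χ ∘ (extChartAt (𝓡 2) c).symm) (extChartAt (𝓡 2) c x)
      (flux (LegendrianSurface.inChart f c) (LegendrianSurface.inChart V c)
        (extChartAt (𝓡 2) c x)) := by
  have h := hf.isReparametrization c x
  have hp := mem_overlap_self hx
  have hopen := isOpen_extChartAt_target (I := 𝓡 2) c
  have h1 := h.map_flux (V := LegendrianSurface.inChart V c) (V' := LegendrianSurface.inChart V x)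
    (fun q hq => (contDiffOn_comp_extChartAt_symm hV c).differentiableAt_of_isOpen hopen hq)
    (fun q hq => inChart_transition V c x hq) hp
  have heq : χ ∘ (extChartAt (𝓡 2) x).symm =ᶠ[nhds (extChartAt (𝓡 2) x x)]
      (χ ∘ (extChartAt (𝓡 2) c).symm) ∘ (extChartAt (𝓡 2) c ∘ (extChartAt (𝓡 2) x).symm) :=
    Filter.eventuallyEq_of_mem ((isOpen_overlap c x).mem_nhds hp)
      fun q hq => inChart_transition χ c x hq
  rw [fluxDeriv, heq.fderiv_eq, fderiv_comp _
    ((contDiffOn_comp_extChartAt_symm hχ c).differentiableAt_of_isOpen hopen (h.mapsTo hp))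
    (h.differentiableAt hp)]
  rw [transition_self] at h1 ⊢
  rw [← h1]
  rfl

end Charts

/-! ### The area measure -/

theorem clm_det_eq (L : Plane →L[ℝ] Plane) :
    L.det = (Matrix.of fun k i => (L (coordVec i)) k : Matrix (Fin 2) (Fin 2) ℝ).det := by
  rw [ContinuousLinearMap.det, ← LinearMap.det_toMatrix (EuclideanSpace.basisFun (Fin 2) ℝ).toBasis]
  congr 1

theorem IsLegendrianOn.continuousOn_areaDensity {F : Plane → C3} {U : Set Plane}
    (h : IsLegendrianOn F coordVec U) : ContinuousOn (areaDensity F) U :=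
  h.density_smooth.continuousOn

section Measures

variable {M : Type*} [TopologicalSpace M] [ChartedSpace Plane M]

theorem image_extChartAt_eq {c : M} {K : Set M} (hc : K ⊆ (extChartAt (𝓡 2) c).source) :
    (extChartAt (𝓡 2) c).target ∩ (extChartAt (𝓡 2) c).symm ⁻¹' K = extChartAt (𝓡 2) c '' K := by
  rw [(extChartAt (𝓡 2) c).image_eq_target_inter_inv_preimage hc]

theorem isCompact_image_extChartAt {c : M} {K : Set M} (hK : IsCompact K)
    (hc : K ⊆ (extChartAt (𝓡 2) c).source) : IsCompact (extChartAt (𝓡 2) c '' K) :=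
  hK.image_of_continuousOn ((continuousOn_extChartAt c).mono hc)

theorem image_extChartAt_subset {c : M} {K : Set M} (hc : K ⊆ (extChartAt (𝓡 2) c).source) :
    extChartAt (𝓡 2) c '' K ⊆ (extChartAt (𝓡 2) c).target := by
  rw [← image_extChartAt_eq hc]
  exact inter_subset_left

theorem aemeasurable_extChartAt_symm [MeasurableSpace M] [BorelSpace M] (c : M) :
    AEMeasurable (extChartAt (𝓡 2) c).symm (volume.restrict (extChartAt (𝓡 2) c).target) :=
  (continuousOn_extChartAt_symm c).aemeasurable (isOpen_extChartAt_target c).measurableSet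

theorem measurableSet_target_inter_preimage [MeasurableSpace M] [BorelSpace M] (c : M)
    {A : Set M} (hA : MeasurableSet A) :
    MeasurableSet ((extChartAt (𝓡 2) c).target ∩ (extChartAt (𝓡 2) c).symm ⁻¹' A) := by
  classical
  -- The inverse chart is controlled only on its target; replacing it by a constant outside gives a
  -- globally measurable map.
  have h := (continuousOn_extChartAt_symm (I := 𝓡 2) c).measurable_piecewise
    (g := fun _ => c) continuousOn_const (isOpen_extChartAt_target c).measurableSet
  have h2 := (h hA).inter (isOpen_extChartAt_target (I := 𝓡 2) c).measurableSet
  convert h2 using 1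
  ext p
  by_cases hp : p ∈ (extChartAt (𝓡 2) c).target
  · simp only [mem_inter_iff, mem_preimage, piecewise_eq_of_mem _ _ _ hp, and_comm]
  · simp only [mem_inter_iff, hp, false_and, and_false]

theorem chartArea_apply [MeasurableSpace M] [BorelSpace M] (f : M → C3) (c : M) {A : Set M}
    (hA : MeasurableSet A) :
    chartArea f c A = ∫⁻ p in (extChartAt (𝓡 2) c).target ∩ (extChartAt (𝓡 2) c).symm ⁻¹' A,
      ENNReal.ofReal (areaDensity (inChart f c) p) := by
  rw [chartArea, Measure.map_apply_of_aemeasurable ((aemeasurable_extChartAt_symm c).mono_ac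
    (withDensity_absolutelyContinuous _ _)) hA, withDensity_apply', Measure.restrict_restrict']
  · rw [inter_comm]
  · exact (isOpen_extChartAt_target c).measurableSet

variable [IsManifold (𝓡 2) ∞ M]

theorem IsLegendrianImmersion.areaDensity_transition {f : M → C3} (hf : IsLegendrianImmersion f)
    (c x : M) {p : Plane} (hp : p ∈ overlap c x) :
    areaDensity (LegendrianSurface.inChart f x) p
      = |(fderiv ℝ (extChartAt (𝓡 2) c ∘ (extChartAt (𝓡 2) x).symm) p).det|
        * areaDensity (LegendrianSurface.inChart f c)
          ((extChartAt (𝓡 2) c ∘ (extChartAt (𝓡 2) x).symm) p) := by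
  rw [areaDensity, (hf.isReparametrization c x).gram_det_eq hp, Real.sqrt_mul (sq_nonneg _),
    Real.sqrt_sq_eq_abs, clm_det_eq, areaDensity]

/-- Change of variables under the transition map: the density acquires the absolute Jacobian
determinant. -/
theorem chartArea_eq [MeasurableSpace M] [BorelSpace M] {f : M → C3}
    (hf : IsLegendrianImmersion f) {c x : M} {A : Set M}
    (hA : MeasurableSet A) (hc : A ⊆ (extChartAt (𝓡 2) c).source)
    (hx : A ⊆ (extChartAt (𝓡 2) x).source) : chartArea f c A = chartArea f x A := by
  have hsub : (extChartAt (𝓡 2) x).target ∩ (extChartAt (𝓡 2) x).symm ⁻¹' A ⊆ overlap c x :=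
    fun p hp => ⟨hp.1, hc hp.2⟩
  have himage : (extChartAt (𝓡 2) c ∘ (extChartAt (𝓡 2) x).symm) ''
      ((extChartAt (𝓡 2) x).target ∩ (extChartAt (𝓡 2) x).symm ⁻¹' A)
      = (extChartAt (𝓡 2) c).target ∩ (extChartAt (𝓡 2) c).symm ⁻¹' A := by
    ext q
    constructor
    · rintro ⟨p, hp, rfl⟩
      refine ⟨(transition_mapsTo c x (hsub hp)).1, ?_⟩
      rw [mem_preimage, Function.comp_apply, (extChartAt (𝓡 2) c).left_inv (hc hp.2)]
      exact hp.2
    · intro hq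
      have hq' : q ∈ overlap x c := ⟨hq.1, hx hq.2⟩
      refine ⟨_, ⟨(transition_mapsTo x c hq').1, ?_⟩, transition_leftInv x c hq'⟩
      rw [mem_preimage, Function.comp_apply, (extChartAt (𝓡 2) x).left_inv (hx hq.2)]
      exact hq.2
  have hms := measurableSet_target_inter_preimage x hA
  rw [chartArea_apply f c hA, chartArea_apply f x hA, ← himage,
    lintegral_image_eq_lintegral_abs_det_fderiv_mul volume hms
      (fun p hp => ((contDiffOn_transition c x).differentiableAt_of_isOpen (isOpen_overlap c x)
        (hsub hp)).hasFDerivAt.hasFDerivWithinAt)]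
  · refine setLIntegral_congr_fun hms fun p hp => ?_
    rw [hf.areaDensity_transition c x (hsub hp), ENNReal.ofReal_mul (abs_nonneg _)]
  · intro p hp q hq hpq
    rw [← transition_leftInv c x (hsub hp), hpq, transition_leftInv c x (hsub hq)]

variable [T2Space M] [SecondCountableTopology M]

theorem exists_finset_chartPartition {K : Set M} (hK : IsCompact K) :
    ∃ S : Finset M, ∀ c ∉ S, ∀ x ∈ K, chartPartition M c x = 0 := by
  refine ⟨((chartPartition M).locallyFinite.finite_nonempty_inter_compact hK).toFinset,
    fun c hc x hx => ?_⟩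
  by_contra h0
  exact hc (by simpa using ⟨x, h0, hx⟩)

theorem sum_chartPartition {K : Set M} {S : Finset M}
    (hS : ∀ c ∉ S, ∀ x ∈ K, chartPartition M c x = 0) {x : M} (hx : x ∈ K) :
    ∑ c ∈ S, chartPartition M c x = 1 := by
  rw [← (chartPartition M).sum_eq_one (mem_univ x)]
  refine (finsum_eq_sum_of_support_subset _ fun c hc => ?_).symm
  by_contra h
  exact hc (hS c h x hx)

theorem tsupport_chartPartition_subset (c : M) :
    tsupport (chartPartition M c) ⊆ (extChartAt (𝓡 2) c).source := by
  rw [extChartAt_source]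
  exact Classical.choose_spec (exists_chartPartition M) c

variable [MeasurableSpace M] [BorelSpace M]

/-- On the support of each partition function the area of its own chart may be replaced by that of
the chart at `c`; the partition functions then add up to one. -/
theorem areaMeasure_restrict {f : M → C3} (hf : IsLegendrianImmersion f) {c : M} {K : Set M}
    (hK : IsCompact K) (hc : K ⊆ (extChartAt (𝓡 2) c).source) :
    (areaMeasure f).restrict K = (chartArea f c).restrict K := by
  obtain ⟨S, hS⟩ := exists_finset_chartPartition hK
  have hKm := hK.isClosed.measurableSet
  have hm : ∀ d : M, Measurable fun x => ENNReal.ofReal (chartPartition M d x) := fun d =>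
    ENNReal.measurable_ofReal.comp (chartPartition M d).contMDiff.continuous.measurable
  ext A hA
  rw [Measure.restrict_apply hA, Measure.restrict_apply hA, areaMeasure,
    Measure.sum_apply _ (hA.inter hKm)]
  have hAK : MeasurableSet (A ∩ K) := hA.inter hKm
  have h1 : ∀ d : M, ((chartArea f d).withDensity fun x =>
      ENNReal.ofReal (chartPartition M d x)) (A ∩ K)
      = ∫⁻ x in A ∩ K, ENNReal.ofReal (chartPartition M d x) ∂(chartArea f c) := by
    intro d
    rw [withDensity_apply _ hAK]
    have hD : MeasurableSet (tsupport (chartPartition M d)) :=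
      (isClosed_tsupport _).measurableSet
    -- The two chart areas are comparable only inside both chart domains, so the integral is first
    -- cut down to the support of the partition function.
    have hz : ∀ ν : Measure M, ∫⁻ x in A ∩ K, ENNReal.ofReal (chartPartition M d x) ∂ν
        = ∫⁻ x in A ∩ K ∩ tsupport (chartPartition M d),
          ENNReal.ofReal (chartPartition M d x) ∂ν := by
      intro ν
      rw [← lintegral_inter_add_sdiff _ (A ∩ K) hD, setLIntegral_congr_fun (g := fun _ => 0)
        (hAK.diff hD), lintegral_zero, add_zero]
      intro x hx
      beta_reduce
      rw [image_eq_zero_of_notMem_tsupport hx.2, ENNReal.ofReal_zero]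
    rw [hz, hz (chartArea f c)]
    congr 1
    ext B hB
    rw [Measure.restrict_apply hB, Measure.restrict_apply hB]
    exact chartArea_eq hf (hB.inter (hAK.inter hD))
      (fun x hx => tsupport_chartPartition_subset d hx.2.2) (fun x hx => hc hx.2.1.2)
  simp_rw [h1]
  rw [tsum_eq_sum (s := S), ← lintegral_finsetSum _ fun d _ => hm d]
  · rw [← setLIntegral_one]
    refine setLIntegral_congr_fun hAK fun x hx => ?_
    rw [← ENNReal.ofReal_sum_of_nonneg fun d _ => (chartPartition M).nonneg d x,
      sum_chartPartition hS hx.2, ENNReal.ofReal_one]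
  · intro d hd
    rw [setLIntegral_congr_fun (g := fun _ => 0) hAK, lintegral_zero]
    intro x hx
    simp [hS d hd x hx.2]

theorem setIntegral_areaMeasure {f : M → C3} (hf : IsLegendrianImmersion f) {c : M} {K : Set M}
    (hK : IsCompact K) (hc : K ⊆ (extChartAt (𝓡 2) c).source) {g : M → ℝ} (hg : ContinuousOn g K) :
    ∫ x in K, g x ∂(areaMeasure f) = ∫ p in extChartAt (𝓡 2) c '' K,
      g ((extChartAt (𝓡 2) c).symm p) * areaDensity (inChart f c) p := by
  have hKm := hK.isClosed.measurableSet
  have hac := (aemeasurable_extChartAt_symm c).mono_ac (withDensity_absolutelyContinuous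
    (volume.restrict (extChartAt (𝓡 2) c).target)
    fun p => ENNReal.ofReal (areaDensity (inChart f c) p))
  have hQ := isCompact_image_extChartAt hK hc
  have hQm := hQ.isClosed.measurableSet
  have hT := (isOpen_extChartAt_target (I := 𝓡 2) c).measurableSet
  have hr : ((volume.restrict (extChartAt (𝓡 2) c).target).withDensity
      fun p => ENNReal.ofReal (areaDensity (inChart f c) p)).restrict
        ((extChartAt (𝓡 2) c).symm ⁻¹' K)
      = (volume.restrict (extChartAt (𝓡 2) c '' K)).withDensity
        fun p => ENNReal.ofReal (areaDensity (inChart f c) p) := by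
    ext B hB
    rw [Measure.restrict_apply hB, withDensity_apply', withDensity_apply _ hB,
      Measure.restrict_restrict' hT, Measure.restrict_restrict hB, ← image_extChartAt_eq hc,
      inter_assoc, inter_comm (_ ⁻¹' K)]
  have hgm : AEStronglyMeasurable g ((chartArea f c).restrict K) :=
    hg.aestronglyMeasurable hKm
  rw [areaMeasure_restrict hf hK hc]
  rw [chartArea, Measure.restrict_map_of_aemeasurable hac hKm] at hgm ⊢
  rw [integral_map (hac.mono_measure Measure.restrict_le_self) hgm, hr,
    integral_withDensity_eq_integral_toReal_smul₀]
  · refine setIntegral_congr_fun hQm fun p _ => ?_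
    rw [ENNReal.toReal_ofReal (r := areaDensity _ _) (Real.sqrt_nonneg _), smul_eq_mul, mul_comm]
  · exact ENNReal.measurable_ofReal.comp_aemeasurable
      (((hf.inChart c).continuousOn_areaDensity.mono
        (image_extChartAt_subset hc)).aemeasurable hQm)
  · exact Filter.Eventually.of_forall fun _ => ENNReal.ofReal_lt_top

/-- Needed so that continuous functions are integrable on compact sets and finite sums of integrals
can be combined. -/
theorem isLocallyFiniteMeasure_areaMeasure {f : M → C3} (hf : IsLegendrianImmersion f) :
    IsLocallyFiniteMeasure (areaMeasure f) := by
  have hloc : LocallyCompactSpace M := ChartedSpace.locallyCompactSpace Plane M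
  refine ⟨fun x => ?_⟩
  obtain ⟨K, hKx, hKs, hK⟩ := local_compact_nhds (extChartAt_source_mem_nhds (I := 𝓡 2) x)
  refine ⟨K, hKx, ?_⟩
  have hKm := hK.isClosed.measurableSet
  have h1 := congrArg (fun ν : Measure M => ν univ) (areaMeasure_restrict hf hK hKs)
  simp only [Measure.restrict_apply_univ] at h1
  rw [h1, chartArea_apply f x hKm, image_extChartAt_eq hKs]
  have hQ := isCompact_image_extChartAt hK hKs
  have hc : ContinuousOn (areaDensity (inChart f x)) (extChartAt (𝓡 2) x '' K) :=
    (hf.inChart x).continuousOn_areaDensity.mono (image_extChartAt_subset hKs)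
  exact (hc.integrableOn_compact hQ).lintegral_lt_top

end Measures

/-! ### The first variation of the Willmore functional -/

/-- Integration by parts: `∫ χ div X = -∫ dχ(X)` if `χ X` has compact support. -/
theorem setIntegral_mul_divergence {U Q : Set Plane} (hU : IsOpen U) (hQ : IsCompact Q)
    (hQU : Q ⊆ U) {χ : Plane → ℝ} (hχ : ContDiffOn ℝ ∞ χ U) {X : Fin 2 → Plane → ℝ}
    (hX : ∀ k, ContDiffOn ℝ ∞ (X k) U) (h0 : ∀ p ∈ U, p ∉ Q → ∀ k, χ p * X k p = 0) :
    ∫ p in Q, χ p * ∑ k, dd (coordVec k) (X k) p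
      = -∫ p in Q, ∑ k, dd (coordVec k) χ p * X k p := by
  have hp1 : ∀ k, ContDiffOn ℝ ∞ (fun p => χ p * X k p) U := fun k => hχ.mul (hX k)
  have hc1 : ContinuousOn (fun p => χ p * ∑ k, dd (coordVec k) (X k) p) Q :=
    (hχ.continuousOn.mul (continuousOn_finsetSum _ fun k _ =>
      ((hX k).dd hU (coordVec k)).continuousOn)).mono hQU
  have hc2 : ContinuousOn (fun p => ∑ k, dd (coordVec k) χ p * X k p) Q :=
    (continuousOn_finsetSum _ fun k _ =>
      ((hχ.dd hU (coordVec k)).continuousOn.mul (hX k).continuousOn)).mono hQU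
  -- The total derivatives of `χX` integrate to zero over `U`, and they vanish on `U` outside `Q`,
  -- so the same holds over `Q`.
  have hz : ∀ k, ∫ p in Q, dd (coordVec k) (fun p => χ p * X k p) p = 0 := by
    intro k
    rw [← setIntegral_dd_eq_zero hU hQ hQU (hp1 k) (fun p hp hpQ => h0 p hp hpQ k) (coordVec k)]
    refine (setIntegral_eq_of_subset_of_forall_sdiff_eq_zero hU.measurableSet hQU
      fun p hp => ?_).symm
    rw [dd_congr_of_isOpen (hU.sdiff hQ.isClosed) (k := fun _ => (0 : ℝ))
      (fun q hq => h0 q hq.1 hq.2 k) _ hp, dd_const]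
  rw [← add_eq_zero_iff_eq_neg, ← integral_add (hc1.integrableOn_compact hQ)
    (hc2.integrableOn_compact hQ)]
  have hsum : ∫ p in Q, ∑ k, dd (coordVec k) (fun p => χ p * X k p) p = 0 := by
    rw [integral_finsetSum _ fun k _ =>
      (((hp1 k).dd hU (coordVec k)).continuousOn.mono hQU).integrableOn_compact hQ]
    exact Finset.sum_eq_zero fun k _ => hz k
  rw [← hsum]
  refine setIntegral_congr_fun hQ.measurableSet fun p hp => ?_
  simp only [dd_mul (hχ.differentiableAt_of_isOpen hU (hQU hp))
    ((hX _).differentiableAt_of_isOpen hU (hQU hp)), Finset.mul_sum, ← Finset.sum_add_distrib]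

theorem flux_congr (F : Plane → C3) {V V' : Plane → C3} {p : Plane} (hV : V =ᶠ[nhds p] V') :
    flux F V p = flux F V' p := by
  simp only [flux, hV.fderiv_eq, hV.eq_of_nhds]

theorem flux_zero (F : Plane → C3) (p : Plane) : flux F (fun _ => 0) p = 0 := by
  simp [flux, tangentPart]

namespace IsLegendrianOn

theorem continuousOn_meanCurv {F : Plane → C3} {U : Set Plane}
    (h : IsLegendrianOn F coordVec U) : ContinuousOn (meanCurv F) U :=
  (mulI.continuous.comp_continuousOn h.angleGrad_smooth.continuousOn).congr
    fun _ hp => meanCurv_eq h hp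

variable {Φ : ℝ × Plane → C3} {Ω : Set (ℝ × Plane)} (h : IsLegendrianOn Φ spaceVec Ω)
include h

theorem flux_slice_smooth (t : ℝ) (k : Fin 2) :
    ContDiffOn ℝ ∞ (fun q => flux (fun q => Φ (t, q)) (fun q => dd timeVec Φ (t, q)) q k)
      {p | (t, p) ∈ Ω} := by
  refine ((h.fluxCoord_smooth timeVec k).comp (t := Ω) (f := fun q : Plane => (t, q))
    (by fun_prop) fun _ hq => hq).congr fun q hq => ?_
  rw [h.flux_slice hq]
  fin_cases k <;> simp [coordVec, Fin.sum_univ_two]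

end IsLegendrianOn

/-! ### The variational field and its flux on the abstract surface -/

section Variation

variable {M : Type*} [TopologicalSpace M] [ChartedSpace Plane M]

theorem inChart_extChartAt {G : Type*} (g : M → G) {c x : M}
    (hx : x ∈ (extChartAt (𝓡 2) c).source) :
    (g ∘ (extChartAt (𝓡 2) c).symm) (extChartAt (𝓡 2) c x) = g x := by
  rw [Function.comp_apply, (extChartAt (𝓡 2) c).left_inv hx]

theorem continuous_of_inChart {G : Type*} [TopologicalSpace G] {g : M → G}
    (hg : ∀ c, ContinuousOn (g ∘ (extChartAt (𝓡 2) c).symm) (extChartAt (𝓡 2) c).target) :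
    Continuous g := by
  rw [continuous_iff_continuousAt]
  intro x
  have h1 : ContinuousAt ((g ∘ (extChartAt (𝓡 2) x).symm) ∘ extChartAt (𝓡 2) x) x :=
    ((hg x).continuousAt ((isOpen_extChartAt_target x).mem_nhds
      (mem_extChartAt_target x))).comp (continuousAt_extChartAt x)
  refine h1.congr (Filter.eventuallyEq_of_mem (extChartAt_source_mem_nhds (I := 𝓡 2) x)
    fun y hy => inChart_extChartAt g hy)

/-- The variational vector field `∂F/∂t` at `t = 0`. -/
noncomputable def variationField (F : ℝ → M → C3) (x : M) : C3 := deriv (fun t => F t x) 0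

theorem contMDiff_of_inChart {G : Type*} [NormedAddCommGroup G] [NormedSpace ℝ G] {g : M → G}
    (hg : ∀ c, ContDiffOn ℝ ∞ (g ∘ (extChartAt (𝓡 2) c).symm) (extChartAt (𝓡 2) c).target) :
    ContMDiff (𝓡 2) 𝓘(ℝ, G) ∞ g := by
  intro x
  have h1 : ContMDiffAt (𝓡 2) 𝓘(ℝ, G) ∞
      ((g ∘ (extChartAt (𝓡 2) x).symm) ∘ extChartAt (𝓡 2) x) x :=
    (((hg x).contDiffAt ((isOpen_extChartAt_target x).mem_nhds
      (mem_extChartAt_target x))).contMDiffAt).comp x contMDiffAt_extChartAt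
  refine h1.congr_of_eventuallyEq (Filter.eventuallyEq_of_mem
    (extChartAt_source_mem_nhds (I := 𝓡 2) x) fun y hy => (inChart_extChartAt g hy).symm)

/-- Applied with the constant 0 off the support of a partition function, and with the constant 1 to
the sum of the partition functions near the support of the deformation. -/
theorem fluxDeriv_eq_zero {f V : M → C3} {χ : M → ℝ} {x : M} {a : ℝ}
    (hχ : χ =ᶠ[nhds x] fun _ => a) : fluxDeriv f V χ x = 0 := by
  have h1 : Filter.Tendsto (extChartAt (𝓡 2) x).symm (nhds (extChartAt (𝓡 2) x x)) (nhds x) := by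
    have := continuousAt_extChartAt_symm (I := 𝓡 2) x
    rwa [ContinuousAt, extChartAt_to_inv] at this
  have h2 : χ ∘ (extChartAt (𝓡 2) x).symm =ᶠ[nhds (extChartAt (𝓡 2) x x)] fun _ => a :=
    h1.eventually hχ
  rw [fluxDeriv, h2.fderiv_eq]
  simp

namespace IsLegendrianVariation

variable {f : M → C3} {ε : ℝ} {K : Set M} {F : ℝ → M → C3} (hF : IsLegendrianVariation f ε K F)
include hF

theorem variationField_eq_zero (hε : 0 < ε) {x : M} (hx : x ∉ K) : variationField F x = 0 := by
  have h : (fun t => F t x) =ᶠ[nhds 0] fun _ => f x :=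
    Filter.eventuallyEq_of_mem (isOpen_Ioo.mem_nhds ⟨by linarith, hε⟩)
      fun t ht => hF.support t ht x hx
  rw [variationField, h.deriv_eq, deriv_const]

theorem flux_eq_zero (hε : 0 < ε) (hK : IsClosed K) (c : M) {p : Plane}
    (hp : p ∈ (extChartAt (𝓡 2) c).target) (hpK : (extChartAt (𝓡 2) c).symm p ∉ K) :
    flux (LegendrianSurface.inChart f c) (LegendrianSurface.inChart (variationField F) c) p = 0
        := by
  rw [flux_congr _ (V' := fun _ => 0), flux_zero]
  have hopen := (continuousOn_extChartAt_symm (I := 𝓡 2) c).isOpen_inter_preimage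
    (isOpen_extChartAt_target c) hK.isOpen_compl
  exact Filter.eventuallyEq_of_mem (hopen.mem_nhds ⟨hp, hpK⟩)
    fun q hq => hF.variationField_eq_zero hε hq.2

theorem isLegendrianImmersion (hε : 0 < ε) : IsLegendrianImmersion f := by
  have := hF.legendrian 0 ⟨by linarith, hε⟩
  rwa [hF.initial] at this

variable [IsManifold (𝓡 2) ∞ M]

theorem variationField_inChart (hε : 0 < ε) (c : M) {p : Plane}
    (hp : p ∈ (extChartAt (𝓡 2) c).target) :
    LegendrianSurface.inChart (variationField F) c p
      = dd timeVec (fun z : ℝ × Plane => LegendrianSurface.inChart (F z.1) c z.2) (0, p) :=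
  (hasDerivAt_timeVec ((hF.inChart c).differentiableAt ⟨⟨by linarith, hε⟩, hp⟩
    (hF.inChart c).smooth)).deriv

theorem contMDiff_variationField (hε : 0 < ε) :
    ContMDiff (𝓡 2) 𝓘(ℝ, C3) ∞ (variationField F) := by
  refine contMDiff_of_inChart fun c => ?_
  refine ((((hF.inChart c).smooth.dd (hF.inChart c).isOpen timeVec)).comp
    (t := Ioo (-ε) ε ×ˢ (extChartAt (𝓡 2) c).target) (f := fun q : Plane => ((0 : ℝ), q))
    (by fun_prop) fun q hq => ⟨⟨by linarith, hε⟩, hq⟩).congr fun p hp => ?_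
  exact hF.variationField_inChart hε c hp

theorem flux_inChart (hε : 0 < ε) (c : M) {p : Plane} (hp : p ∈ (extChartAt (𝓡 2) c).target) :
    flux (LegendrianSurface.inChart f c) (LegendrianSurface.inChart (variationField F) c) p
      = flux (LegendrianSurface.inChart (F 0) c) (fun q => dd timeVec
        (fun z : ℝ × Plane => LegendrianSurface.inChart (F z.1) c z.2) (0, q)) p := by
  rw [hF.initial]
  exact flux_congr _ (Filter.eventuallyEq_of_mem ((isOpen_extChartAt_target c).mem_nhds hp)
    fun q hq => hF.variationField_inChart hε c hq)

theorem contDiffOn_flux (hε : 0 < ε) (c : M) (k : Fin 2) :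
    ContDiffOn ℝ ∞ (fun p => flux (LegendrianSurface.inChart f c)
      (LegendrianSurface.inChart (variationField F) c) p k) (extChartAt (𝓡 2) c).target := by
  refine (((hF.inChart c).flux_slice_smooth 0 k).mono
    fun p hp => ⟨⟨by linarith, hε⟩, hp⟩).congr fun p hp => ?_
  rw [hF.flux_inChart hε c hp]

theorem fluxDeriv_extChartAt_symm (hε : 0 < ε) {χ : M → ℝ} (hχ : ContMDiff (𝓡 2) 𝓘(ℝ, ℝ) ∞ χ)
    (c : M) {p : Plane} (hp : p ∈ (extChartAt (𝓡 2) c).target) :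
    fluxDeriv f (variationField F) χ ((extChartAt (𝓡 2) c).symm p)
      = ∑ k, dd (coordVec k) (χ ∘ (extChartAt (𝓡 2) c).symm) p
        * flux (LegendrianSurface.inChart f c)
          (LegendrianSurface.inChart (variationField F) c) p k := by
  rw [(hF.isLegendrianImmersion hε).fluxDeriv_eq (hF.contMDiff_variationField hε) hχ
    ((extChartAt (𝓡 2) c).map_target hp), (extChartAt (𝓡 2) c).right_inv hp]
  conv_lhs => rw [plane_eq_sum (flux _ _ p), map_sum]
  refine Finset.sum_congr rfl fun k _ => ?_
  rw [map_smul, smul_eq_mul, mul_comm]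
  rfl

theorem continuous_fluxDeriv (hε : 0 < ε) {χ : M → ℝ} (hχ : ContMDiff (𝓡 2) 𝓘(ℝ, ℝ) ∞ χ) :
    Continuous (fluxDeriv f (variationField F) χ) := by
  refine continuous_of_inChart fun c => ContinuousOn.congr (continuousOn_finsetSum _ fun k _ =>
    ((((contDiffOn_comp_extChartAt_symm hχ c).dd (isOpen_extChartAt_target c)
      (coordVec k)).continuousOn).mul (hF.contDiffOn_flux hε c k).continuousOn))
    fun p hp => hF.fluxDeriv_extChartAt_symm hε hχ c hp

end IsLegendrianVariation

variable [IsManifold (𝓡 2) ∞ M]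

theorem IsLegendrianImmersion.continuous_meanCurvAt {f : M → C3} (hf : IsLegendrianImmersion f) :
    Continuous (meanCurvAt f) := by
  refine continuous_of_inChart fun c => (hf.inChart c).continuousOn_meanCurv.congr fun p hp => ?_
  rw [Function.comp_apply, hf.meanCurvAt_eq ((extChartAt (𝓡 2) c).map_target hp),
    (extChartAt (𝓡 2) c).right_inv hp]

theorem sum_fluxDeriv {f V : M → C3} {ι : Type*} (S : Finset ι) {χ : ι → M → ℝ}
    (hχ : ∀ i, ContMDiff (𝓡 2) 𝓘(ℝ, ℝ) ∞ (χ i)) (x : M) :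
    ∑ i ∈ S, fluxDeriv f V (χ i) x = fluxDeriv f V (fun y => ∑ i ∈ S, χ i y) x := by
  have h1 : (fun y => ∑ i ∈ S, χ i y) ∘ (extChartAt (𝓡 2) x).symm
      = fun p => ∑ i ∈ S, (χ i ∘ (extChartAt (𝓡 2) x).symm) p := rfl
  have hd : ∀ i ∈ S, DifferentiableAt ℝ (χ i ∘ (extChartAt (𝓡 2) x).symm)
      (extChartAt (𝓡 2) x x) := fun i _ =>
    (contDiffOn_comp_extChartAt_symm (hχ i) x).differentiableAt_of_isOpen
      (isOpen_extChartAt_target x) (mem_extChartAt_target x)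
  rw [fluxDeriv, h1, fderiv_fun_sum hd, sum_apply]
  rfl

end Variation

/-! ### Gluing the chart contributions with a partition of unity -/

section WillmoreVariation

variable {M : Type*} [TopologicalSpace M] [ChartedSpace Plane M] [IsManifold (𝓡 2) ∞ M]
  [T2Space M] [SecondCountableTopology M]

theorem isCompact_inter_tsupport {K : Set M} (hK : IsCompact K) (c : M) :
    IsCompact (K ∩ tsupport (chartPartition M c)) :=
  hK.inter_right (isClosed_tsupport _)

theorem inter_tsupport_subset (K : Set M) (c : M) :
    K ∩ tsupport (chartPartition M c) ⊆ (extChartAt (𝓡 2) c).source :=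
  inter_subset_right.trans (tsupport_chartPartition_subset c)

variable [MeasurableSpace M] [BorelSpace M]

theorem setIntegral_chartPartition_mul {f : M → C3} (hf : IsLegendrianImmersion f) {K : Set M}
    (hK : IsCompact K) {g : M → ℝ} (hg : Continuous g) (c : M)
    (h0 : ∀ x ∉ tsupport (chartPartition M c), g x = 0) :
    ∫ x in K, g x ∂(areaMeasure f)
      = ∫ p in extChartAt (𝓡 2) c '' (K ∩ tsupport (chartPartition M c)),
        g ((extChartAt (𝓡 2) c).symm p) * areaDensity (inChart f c) p := by
  rw [← setIntegral_areaMeasure hf (isCompact_inter_tsupport hK c) (inter_tsupport_subset K c)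
    hg.continuousOn]
  exact (setIntegral_eq_of_subset_of_forall_sdiff_eq_zero hK.isClosed.measurableSet
    inter_subset_left fun x hx => h0 x fun h => hx.2 ⟨hx.1, h⟩)

theorem setIntegral_eq_sum_chartPartition {f : M → C3} (hf : IsLegendrianImmersion f) {K : Set M}
    (hK : IsCompact K) {S : Finset M} (hS : ∀ c ∉ S, ∀ x ∈ K, chartPartition M c x = 0)
    {g : M → ℝ} (hg : Continuous g) :
    ∫ x in K, g x ∂(areaMeasure f)
      = ∑ c ∈ S, ∫ p in extChartAt (𝓡 2) c '' (K ∩ tsupport (chartPartition M c)),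
        chartPartition M c ((extChartAt (𝓡 2) c).symm p) * g ((extChartAt (𝓡 2) c).symm p)
          * areaDensity (inChart f c) p := by
  have hloc := isLocallyFiniteMeasure_areaMeasure hf
  have hc : ∀ c, Continuous fun x => chartPartition M c x * g x := fun c =>
    (chartPartition M c).contMDiff.continuous.mul hg
  have h1 : ∀ c ∈ S, ∫ p in extChartAt (𝓡 2) c '' (K ∩ tsupport (chartPartition M c)),
        chartPartition M c ((extChartAt (𝓡 2) c).symm p) * g ((extChartAt (𝓡 2) c).symm p)
          * areaDensity (inChart f c) p
      = ∫ x in K, chartPartition M c x * g x ∂(areaMeasure f) := fun c _ =>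
    (setIntegral_chartPartition_mul hf hK (hc c) c fun x hx => by
      rw [image_eq_zero_of_notMem_tsupport hx, zero_mul]).symm
  rw [Finset.sum_congr rfl h1, ← integral_finsetSum _ fun c _ =>
    (hc c).continuousOn.integrableOn_compact hK]
  refine setIntegral_congr_fun hK.isClosed.measurableSet fun x hx => ?_
  rw [← Finset.sum_mul, sum_chartPartition hS hx, one_mul]

/-- The divergence `Div(JH)` vanishes in all charts, up to the factor `-√(det g)`. -/
def IsDivergenceFree (f : M → C3) : Prop :=
  ∀ c : M, ∀ p ∈ (extChartAt (𝓡 2) c).target, ∑ k, dd (coordVec k)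
    (fun q => areaDensity (inChart f c) q * gradCoord (inChart f c) coordVec k q) p = 0

namespace IsLegendrianVariation

variable {f : M → C3} {ε : ℝ} {K : Set M} {F : ℝ → M → C3} (hF : IsLegendrianVariation f ε K F)
include hF

/-- The contribution of one chart to the first variation of the Willmore functional. -/
theorem setIntegral_willmoreDensity (hε : 0 < ε) (hK : IsCompact K) (hdiv : IsDivergenceFree f)
    (htr : ∀ x, traceTermAt f x = 0) (c : M) :
    ∫ p in extChartAt (𝓡 2) c '' (K ∩ tsupport (chartPartition M c)),
        chartPartition M c ((extChartAt (𝓡 2) c).symm p) * dd timeVec (willmoreDensity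
          (fun z : ℝ × Plane => LegendrianSurface.inChart (F z.1) c z.2) spaceVec) (0, p)
      = -∫ x in K, fluxDeriv f (variationField F) (chartPartition M c) x ∂(areaMeasure f) := by
  have hf := hF.isLegendrianImmersion hε
  have hχ : ContMDiff (𝓡 2) 𝓘(ℝ, ℝ) ∞ (chartPartition M c) := (chartPartition M c).contMDiff
  have hU := isOpen_extChartAt_target (I := 𝓡 2) c
  have hKc := isCompact_inter_tsupport hK c
  have hsub := inter_tsupport_subset K c
  have hQ := isCompact_image_extChartAt hKc hsub
  have hQU := image_extChartAt_subset hsub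
  have hX : ∀ k, ContDiffOn ℝ ∞ (fun p => areaDensity (LegendrianSurface.inChart f c) p
      * flux (LegendrianSurface.inChart f c) (LegendrianSurface.inChart (variationField F) c) p k)
      (extChartAt (𝓡 2) c).target := fun k =>
    (hf.inChart c).density_smooth.mul (hF.contDiffOn_flux hε c k)
  have h0 : ∀ p ∈ (extChartAt (𝓡 2) c).target,
      p ∉ extChartAt (𝓡 2) c '' (K ∩ tsupport (chartPartition M c)) → ∀ k,
      (chartPartition M c ∘ (extChartAt (𝓡 2) c).symm) p
        * (areaDensity (LegendrianSurface.inChart f c) p * flux (LegendrianSurface.inChart f c)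
          (LegendrianSurface.inChart (variationField F) c) p k) = 0 := by
    intro p hp hpQ k
    by_cases hpK : (extChartAt (𝓡 2) c).symm p ∈ K
    · have : (extChartAt (𝓡 2) c).symm p ∉ tsupport (chartPartition M c) := fun h => by
        rw [← image_extChartAt_eq hsub] at hpQ
        exact hpQ ⟨hp, hpK, h⟩
      rw [Function.comp_apply, image_eq_zero_of_notMem_tsupport this, zero_mul]
    · rw [hF.flux_eq_zero hε hK.isClosed c hp hpK]
      simp
  have hpt : ∀ p ∈ (extChartAt (𝓡 2) c).target, dd timeVec (willmoreDensity
        (fun z : ℝ × Plane => LegendrianSurface.inChart (F z.1) c z.2) spaceVec) (0, p)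
      = ∑ k, dd (coordVec k) (fun p => areaDensity (LegendrianSurface.inChart f c) p
      * flux (LegendrianSurface.inChart f c) (LegendrianSurface.inChart (variationField F) c) p k)
        p := by
    intro p hp
    rw [(hF.inChart c).dd_timeVec_willmoreDensity ⟨⟨by linarith, hε⟩, hp⟩]
    · refine Finset.sum_congr rfl fun k _ => dd_congr_of_isOpen hU (fun q hq => ?_) _ hp
      rw [hF.flux_inChart hε c hq]
      simp only [hF.initial]
    · have := hdiv c p hp
      simp only [hF.initial]
      exact this
    · have := htr ((extChartAt (𝓡 2) c).symm p)
      rw [hf.traceTermAt_eq ((extChartAt (𝓡 2) c).map_target hp),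
        (extChartAt (𝓡 2) c).right_inv hp] at this
      simp only [hF.initial]
      exact this
  rw [setIntegral_chartPartition_mul hf hK (hF.continuous_fluxDeriv hε hχ) c]
  · rw [setIntegral_congr_fun hQ.measurableSet (g := fun p =>
      (chartPartition M c ∘ (extChartAt (𝓡 2) c).symm) p * ∑ k, dd (coordVec k)
        (fun p => areaDensity (LegendrianSurface.inChart f c) p * flux
          (LegendrianSurface.inChart f c) (LegendrianSurface.inChart (variationField F) c) p k) p),
      setIntegral_mul_divergence hU hQ hQU (contDiffOn_comp_extChartAt_symm hχ c) hX h0]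
    · congr 1
      refine setIntegral_congr_fun hQ.measurableSet fun p hp => ?_
      beta_reduce
      rw [hF.fluxDeriv_extChartAt_symm hε hχ c (hQU hp), Finset.sum_mul]
      exact Finset.sum_congr rfl fun k _ => by ring
    · intro p hp
      beta_reduce
      rw [hpt p (hQU hp)]
      rfl
  · intro x hx
    refine fluxDeriv_eq_zero (a := 0) ?_
    exact notMem_tsupport_iff_eventuallyEq.1 hx

/-- Each chart contributes minus the integral of the derivative of its partition function along the
flux. The flux is global, so the contributions add up to the derivative of the constant function 1.
-/
theorem hasDerivAt_willmore (hε : 0 < ε) (hK : IsCompact K) (hdiv : IsDivergenceFree f)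
    (htr : ∀ x, traceTermAt f x = 0) : HasDerivAt (fun t => willmore (F t) K) 0 0 := by
  have hf := hF.isLegendrianImmersion hε
  have hlc : LocallyCompactSpace M := ChartedSpace.locallyCompactSpace Plane M
  -- The sum of the chosen partition functions must be 1 on a neighbourhood of `K`, not only on `K`,
  -- for its derivative to vanish there.
  obtain ⟨K', hK', hKK'⟩ := exists_compact_superset hK
  obtain ⟨S, hS⟩ := exists_finset_chartPartition hK'
  have hSK : ∀ c ∉ S, ∀ x ∈ K, chartPartition M c x = 0 := fun c hc x hx =>
    hS c hc x (interior_subset (hKK' hx))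
  have h0 : (0 : ℝ) ∈ Ioo (-ε) ε := ⟨by linarith, hε⟩
  have heq : (fun t => willmore (F t) K) =ᶠ[nhds 0] fun t => ∑ c ∈ S,
      ∫ p in extChartAt (𝓡 2) c '' (K ∩ tsupport (chartPartition M c)),
        chartPartition M c ((extChartAt (𝓡 2) c).symm p) * willmoreDensity
          (fun z : ℝ × Plane => LegendrianSurface.inChart (F z.1) c z.2) spaceVec (t, p) := by
    refine Filter.eventuallyEq_of_mem (isOpen_Ioo.mem_nhds h0) fun t ht => ?_
    have hft := hF.legendrian t ht
    beta_reduce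
    have hcont : Continuous fun x => 1 / 4 * ‖meanCurvAt (F t) x‖ ^ 2 + 1 :=
      (continuous_const.mul (hft.continuous_meanCurvAt.norm.pow 2)).add continuous_const
    rw [willmore, setIntegral_eq_sum_chartPartition hft hK hSK hcont]
    refine Finset.sum_congr rfl fun c _ => setIntegral_congr_fun
      (isCompact_image_extChartAt (isCompact_inter_tsupport hK c)
        (inter_tsupport_subset K c)).measurableSet fun p hp => ?_
    have hp' := image_extChartAt_subset (inter_tsupport_subset K c) hp
    rw [(hF.inChart c).willmoreDensity_slice ⟨ht, hp'⟩,
      hft.meanCurvAt_eq ((extChartAt (𝓡 2) c).map_target hp'),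
      (extChartAt (𝓡 2) c).right_inv hp', mul_assoc]
  have hder : ∀ c ∈ S, HasDerivAt (fun t =>
      ∫ p in extChartAt (𝓡 2) c '' (K ∩ tsupport (chartPartition M c)),
        chartPartition M c ((extChartAt (𝓡 2) c).symm p) * willmoreDensity
          (fun z : ℝ × Plane => LegendrianSurface.inChart (F z.1) c z.2) spaceVec (t, p))
      (-∫ x in K, fluxDeriv f (variationField F) (chartPartition M c) x ∂(areaMeasure f)) 0 := by
    intro c _
    rw [← hF.setIntegral_willmoreDensity hε hK hdiv htr c]
    have hsub := inter_tsupport_subset K c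
    exact hasDerivAt_setIntegral_mul (isOpen_extChartAt_target c)
      (isCompact_image_extChartAt (isCompact_inter_tsupport hK c) hsub)
      (image_extChartAt_subset hsub) hε (hF.inChart c).willmoreDensity_smooth
      ((contDiffOn_comp_extChartAt_symm (chartPartition M c).contMDiff c).continuousOn.mono
        (image_extChartAt_subset hsub))
  have hsum := HasDerivAt.fun_sum hder
  have hloc := isLocallyFiniteMeasure_areaMeasure hf
  rw [Finset.sum_neg_distrib, ← integral_finsetSum _ fun c _ => (hF.continuous_fluxDeriv hε
    (chartPartition M c).contMDiff).continuousOn.integrableOn_compact hK,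
    setIntegral_congr_fun (g := fun _ => 0) hK.isClosed.measurableSet, integral_zero,
    neg_zero] at hsum
  · exact hsum.congr_of_eventuallyEq heq
  · intro x hx
    beta_reduce
    rw [sum_fluxDeriv S (fun c => (chartPartition M c).contMDiff)]
    refine fluxDeriv_eq_zero (a := 1) ?_
    exact Filter.eventuallyEq_of_mem (isOpen_interior.mem_nhds (hKK' hx)) fun y hy =>
      sum_chartPartition hS (interior_subset hy)

end IsLegendrianVariation

end WillmoreVariation

/-! ### The first variation of the area -/

section AreaVariation

variable {M : Type*} [TopologicalSpace M] [ChartedSpace Plane M] [IsManifold (𝓡 2) ∞ M]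
  [T2Space M] [SecondCountableTopology M] [MeasurableSpace M] [BorelSpace M]

/-- The divergence part of the variation of the density integrates to zero, because the variation
field vanishes off `K`. As `K` lies in one chart, no partition of unity is needed and the test
function is 1. -/
theorem IsLegendrianVariation.hasDerivAt_area {f : M → C3} {ε : ℝ} {K : Set M} {F : ℝ → M → C3}
    (hF : IsLegendrianVariation f ε K F) (hε : 0 < ε) (hK : IsCompact K) {c : M}
    (hc : K ⊆ (extChartAt (𝓡 2) c).source) :
    HasDerivAt (fun t => area (F t) K) (∫ p in extChartAt (𝓡 2) c '' K,
      1 / 2 * inner ℝ (LegendrianSurface.inChart (variationField F) c p)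
        (mulI (LegendrianSurface.inChart f c p)) * ∑ k, dd (coordVec k) (fun q => areaDensity
          (LegendrianSurface.inChart f c) q
            * gradCoord (LegendrianSurface.inChart f c) coordVec k q) p) 0 := by
  have hf := hF.isLegendrianImmersion hε
  have hU := isOpen_extChartAt_target (I := 𝓡 2) c
  have hQ := isCompact_image_extChartAt hK hc
  have hQU := image_extChartAt_subset hc
  have h0 : (0 : ℝ) ∈ Ioo (-ε) ε := ⟨by linarith, hε⟩
  have hV : ContDiffOn ℝ ∞ (LegendrianSurface.inChart (variationField F) c)
      (extChartAt (𝓡 2) c).target :=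
    contDiffOn_comp_extChartAt_symm (hF.contMDiff_variationField hε) c
  have hL := hf.inChart c
  set G := LegendrianSurface.inChart f c
  set V := LegendrianSurface.inChart (variationField F) c
  have hY : ∀ k, ContDiffOn ℝ ∞ (fun q => areaDensity G q
      * (inner ℝ (V q) (coframe G coordVec k q)
        - 1 / 2 * inner ℝ (V q) (mulI (G q)) * gradCoord G coordVec k q))
      (extChartAt (𝓡 2) c).target := fun k =>
    hL.density_smooth.mul ((hV.inner ℝ (hL.coframe_smooth k)).sub
      ((contDiffOn_const.mul (hV.inner ℝ (mulI.contDiff.comp_contDiffOn hL.smooth))).mul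
        (hL.gradCoord_smooth k)))
  have hV0 : ∀ p ∈ (extChartAt (𝓡 2) c).target, p ∉ extChartAt (𝓡 2) c '' K → V p = 0 := by
    intro p hp hpQ
    rw [← image_extChartAt_eq hc] at hpQ
    exact hF.variationField_eq_zero hε fun h => hpQ ⟨hp, h⟩
  have hz : ∀ k, ContDiffOn ℝ ∞ (fun q => areaDensity G q * gradCoord G coordVec k q)
      (extChartAt (𝓡 2) c).target := fun k => hL.density_smooth.mul (hL.gradCoord_smooth k)
  have hcY : ContinuousOn (fun p => (1 : ℝ) * ∑ k, dd (coordVec k) (fun q => areaDensity G q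
      * (inner ℝ (V q) (coframe G coordVec k q)
        - 1 / 2 * inner ℝ (V q) (mulI (G q)) * gradCoord G coordVec k q)) p)
      (extChartAt (𝓡 2) c '' K) :=
    (continuousOn_const.mul (continuousOn_finsetSum _ fun k _ =>
      ((hY k).dd hU (coordVec k)).continuousOn)).mono hQU
  have hcz : ContinuousOn (fun p => 1 / 2 * inner ℝ (V p) (mulI (G p)) *
      ∑ k, dd (coordVec k) (fun q => areaDensity G q * gradCoord G coordVec k q) p)
      (extChartAt (𝓡 2) c '' K) :=
    ((continuousOn_const.mul (hV.inner ℝ (mulI.contDiff.comp_contDiffOn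
      hL.smooth)).continuousOn).mul (continuousOn_finsetSum _ fun k _ =>
        ((hz k).dd hU (coordVec k)).continuousOn)).mono hQU
  have hd := hasDerivAt_setIntegral_mul hU hQ hQU hε (hF.inChart c).density_smooth
    (κ := fun _ => 1) continuousOn_const
  have hdiv := setIntegral_mul_divergence hU hQ hQU (χ := fun _ => 1) contDiffOn_const hY
    fun p hp hpQ k => by simp [hV0 p hp hpQ]
  simp only [dd_const, zero_mul, Finset.sum_const_zero, integral_zero, neg_zero] at hdiv
  have hval : ∫ p in extChartAt (𝓡 2) c '' K, 1 * dd timeVec (density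
        (fun z : ℝ × Plane => LegendrianSurface.inChart (F z.1) c z.2) spaceVec) (0, p)
      = ∫ p in extChartAt (𝓡 2) c '' K, 1 / 2 * inner ℝ (V p) (mulI (G p)) *
        ∑ k, dd (coordVec k) (fun q => areaDensity G q * gradCoord G coordVec k q) p := by
    refine Eq.trans ?_ ((integral_add (hcY.integrableOn_compact hQ)
      (hcz.integrableOn_compact hQ)).trans (by rw [hdiv, zero_add]))
    refine setIntegral_congr_fun hQ.measurableSet fun p hp => ?_
    beta_reduce
    rw [one_mul, one_mul, (hF.inChart c).dd_timeVec_density ⟨h0, hQU hp⟩,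
      ← hF.variationField_inChart hε c (hQU hp)]
    simp only [hF.initial]
    congr 1
    refine Finset.sum_congr rfl fun k _ => dd_congr_of_isOpen hU (fun q hq => ?_) _ (hQU hp)
    rw [← hF.variationField_inChart hε c hq]
  rw [hval] at hd
  refine hd.congr_of_eventuallyEq (Filter.eventuallyEq_of_mem (isOpen_Ioo.mem_nhds h0)
    fun t ht => ?_)
  beta_reduce
  rw [area, setIntegral_areaMeasure (hF.legendrian t ht) hK hc continuousOn_const]
  refine setIntegral_congr_fun hQ.measurableSet fun p hp => ?_
  rw [(hF.inChart c).density_slice ⟨ht, hQU hp⟩]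

theorem IsCsL.setIntegral_contact_mul {f : M → C3} (hf : IsCsL f) {ε : ℝ} {K : Set M}
    {F : ℝ → M → C3} (hF : IsLegendrianVariation f ε K F) (hε : 0 < ε) (hK : IsCompact K) {c : M}
    (hc : K ⊆ (extChartAt (𝓡 2) c).source) :
    ∫ p in extChartAt (𝓡 2) c '' K, 1 / 2 * inner ℝ (inChart (variationField F) c p)
      (mulI (inChart f c p)) * ∑ k, dd (coordVec k) (fun q => areaDensity (inChart f c) q
        * gradCoord (inChart f c) coordVec k q) p = 0 :=
  (hF.hasDerivAt_area hε hK hc).unique (hf.2 ε K F hε hK hF)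

end AreaVariation

/-! ### Hamiltonian shears -/

section Shear

variable {h : ℝ → ℝ} {b : Fin 3 → C3}

/-- The function `(X₁² + X₂²) / X₀²` of the coordinates `X_j = ⟪w, b_j⟫`. -/
noncomputable def slope (b : Fin 3 → C3) (w : C3) : ℝ :=
  (inner ℝ w (b 1) ^ 2 + inner ℝ w (b 2) ^ 2) / inner ℝ w (b 0) ^ 2

/-- The gradient of the function `X₀² h((X₁² + X₂²) / X₀²)` of the coordinates
`X_j = ⟪w, b_j⟫`. -/
noncomputable def shearField (h : ℝ → ℝ) (b : Fin 3 → C3) (w : C3) : C3 :=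
  (2 * (inner ℝ w (b 0) * (h (slope b w) - slope b w * deriv h (slope b w)))) • b 0
    + (2 * (inner ℝ w (b 1) * deriv h (slope b w))) • b 1
    + (2 * (inner ℝ w (b 2) * deriv h (slope b w))) • b 2

/-- The derivative of `slope b` at `w` in the direction `v`. -/
noncomputable def slopeDeriv (b : Fin 3 → C3) (w v : C3) : ℝ :=
  (2 * (inner ℝ w (b 1) * inner ℝ v (b 1) + inner ℝ w (b 2) * inner ℝ v (b 2))
    * inner ℝ w (b 0) - 2 * (inner ℝ w (b 1) ^ 2 + inner ℝ w (b 2) ^ 2) * inner ℝ v (b 0))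
    / inner ℝ w (b 0) ^ 3

theorem contDiffAt_slope {w : C3} (hw : (inner ℝ w (b 0) : ℝ) ≠ 0) :
    ContDiffAt ℝ ∞ (slope b) w := by
  have hX : ∀ j, ContDiffAt ℝ ∞ (fun w : C3 => (inner ℝ w (b j) : ℝ)) w := fun j =>
    contDiffAt_id.inner ℝ contDiffAt_const
  exact (((hX 1).pow 2).add ((hX 2).pow 2)).div ((hX 0).pow 2) (pow_ne_zero 2 hw)

theorem contDiffAt_shearField (hh : ContDiff ℝ ∞ h) {w : C3} (hw : (inner ℝ w (b 0) : ℝ) ≠ 0) :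
    ContDiffAt ℝ ∞ (shearField h b) w := by
  have hX : ∀ j, ContDiffAt ℝ ∞ (fun w : C3 => (inner ℝ w (b j) : ℝ)) w := fun j =>
    contDiffAt_id.inner ℝ contDiffAt_const
  have hs := contDiffAt_slope (b := b) hw
  have hh' : ContDiff ℝ ∞ (deriv h) := ((contDiff_infty_iff_deriv).1 hh).2
  have h1 := hh.contDiffAt.comp w hs
  have h2 := hh'.contDiffAt.comp w hs
  exact (((contDiffAt_const.mul ((hX 0).mul (h1.sub (hs.mul h2)))).smul contDiffAt_const).add
    ((contDiffAt_const.mul ((hX 1).mul h2)).smul contDiffAt_const)).add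
      ((contDiffAt_const.mul ((hX 2).mul h2)).smul contDiffAt_const)

/-- Differentiation along the line through `w` with direction `v`; in the first component, `h - s
h'` has derivative `-s h''`. -/
theorem fderiv_shearField (hh : ContDiff ℝ ∞ h) {w : C3} (hw : (inner ℝ w (b 0) : ℝ) ≠ 0)
    (v : C3) : fderiv ℝ (shearField h b) w v
      = (2 * (inner ℝ v (b 0) * (h (slope b w) - slope b w * deriv h (slope b w))
          - inner ℝ w (b 0) * (slope b w * (deriv (deriv h) (slope b w) * slopeDeriv b w v)))) • b 0
        + (2 * (inner ℝ v (b 1) * deriv h (slope b w)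
          + inner ℝ w (b 1) * (deriv (deriv h) (slope b w) * slopeDeriv b w v))) • b 1
        + (2 * (inner ℝ v (b 2) * deriv h (slope b w)
          + inner ℝ w (b 2) * (deriv (deriv h) (slope b w) * slopeDeriv b w v))) • b 2 := by
  have hh' : ContDiff ℝ ∞ (deriv h) := ((contDiff_infty_iff_deriv).1 hh).2
  have hline : HasDerivAt (fun τ : ℝ => w + τ • v) v 0 := by
    simpa using ((hasDerivAt_id (0 : ℝ)).smul_const v).const_add w
  have hX : ∀ j, HasDerivAt (fun τ : ℝ => (inner ℝ (w + τ • v) (b j) : ℝ)) (inner ℝ v (b j)) 0 := by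
    intro j
    simpa using hline.inner ℝ (hasDerivAt_const (0 : ℝ) (b j))
  have h0 : w + (0 : ℝ) • v = w := by simp
  have hs : HasDerivAt (fun τ : ℝ => slope b (w + τ • v)) (slopeDeriv b w v) 0 := by
    have := (((hX 1).fun_pow 2).fun_add ((hX 2).fun_pow 2)).fun_div ((hX 0).fun_pow 2)
      (by rw [h0]; exact pow_ne_zero 2 hw)
    refine this.congr_deriv ?_
    rw [h0, slopeDeriv]
    field_simp
    ring
  have e1 : HasDerivAt (fun τ : ℝ => h (slope b (w + τ • v)))
      (deriv h (slope b w) * slopeDeriv b w v) 0 :=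
    HasDerivAt.comp (0 : ℝ) (h₂ := h)
      (by rw [h0]; exact (hh.differentiable (by simp) _).hasDerivAt) hs
  have e2 : HasDerivAt (fun τ : ℝ => deriv h (slope b (w + τ • v)))
      (deriv (deriv h) (slope b w) * slopeDeriv b w v) 0 :=
    HasDerivAt.comp (0 : ℝ) (h₂ := deriv h)
      (by rw [h0]; exact (hh'.differentiable (by simp) _).hasDerivAt) hs
  have hN := ((((hX 0).fun_mul (e1.fun_sub (hs.fun_mul e2))).const_mul 2).smul_const (b 0)).fun_add
    ((((hX 1).fun_mul e2).const_mul 2).smul_const (b 1)) |>.fun_add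
    ((((hX 2).fun_mul e2).const_mul 2).smul_const (b 2))
  have hD : HasDerivAt (fun τ : ℝ => shearField h b (w + τ • v))
      (fderiv ℝ (shearField h b) w v) 0 := by
    have hd := ((contDiffAt_shearField hh hw).differentiableAt (by simp)).hasFDerivAt
    rw [← h0] at hd
    have := hd.comp_hasDerivAt (0 : ℝ) hline
    rwa [h0] at this
  rw [hD.unique hN]
  simp only [h0]
  congr 3
  ring

/-- The slope is homogeneous of degree zero in the coordinates. -/
theorem slopeDeriv_of_proportional {w v : C3} {a : ℝ}
    (hv : ∀ j, inner ℝ v (b j) = a * inner ℝ w (b j)) : slopeDeriv b w v = 0 := by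
  rw [slopeDeriv, hv, hv, hv]
  ring_nf

/-- The derivative of a gradient is a symmetric Hessian, and the gradient of a function of degree
two is homogeneous of degree one, so the Hessian applied to `w` returns the gradient at `w`. -/
theorem inner_fderiv_shearField (hh : ContDiff ℝ ∞ h) {w : C3} (hw : (inner ℝ w (b 0) : ℝ) ≠ 0)
    (v : C3) : inner ℝ w (fderiv ℝ (shearField h b) w v) = (inner ℝ (shearField h b w) v : ℝ) := by
  have hs : slope b w * inner ℝ w (b 0) ^ 2 = inner ℝ w (b 1) ^ 2 + inner ℝ w (b 2) ^ 2 :=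
    div_mul_cancel₀ _ (pow_ne_zero 2 hw)
  rw [fderiv_shearField hh hw, shearField]
  simp only [inner_add_left, inner_add_right, inner_smul_left, inner_smul_right, conj_trivial,
    real_inner_comm v]
  rw [real_inner_comm (b 0) v, real_inner_comm (b 1) v, real_inner_comm (b 2) v]
  linear_combination (-2 * deriv (deriv h) (slope b w) * slopeDeriv b w v) * hs

/-- Euler's identity for a function homogeneous of degree two. It makes the contact Hamiltonian of
the deformation nonnegative when `h` is. -/
theorem inner_shearField_self {w : C3} (hw : (inner ℝ w (b 0) : ℝ) ≠ 0) :
    inner ℝ (shearField h b w) w = 2 * inner ℝ w (b 0) ^ 2 * h (slope b w) := by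
  have hs : slope b w * inner ℝ w (b 0) ^ 2 = inner ℝ w (b 1) ^ 2 + inner ℝ w (b 2) ^ 2 :=
    div_mul_cancel₀ _ (pow_ne_zero 2 hw)
  rw [shearField]
  simp only [inner_add_left, inner_smul_left, conj_trivial]
  rw [real_inner_comm w (b 0), real_inner_comm w (b 1), real_inner_comm w (b 2)]
  linear_combination (-2 * deriv h (slope b w)) * hs

theorem fderiv_shearField_of_proportional (hh : ContDiff ℝ ∞ h) {w v : C3}
    (hw : (inner ℝ w (b 0) : ℝ) ≠ 0) {a : ℝ} (hv : ∀ j, inner ℝ v (b j) = a * inner ℝ w (b j)) :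
    fderiv ℝ (shearField h b) w v = a • shearField h b w := by
  rw [fderiv_shearField hh hw, slopeDeriv_of_proportional hv, hv, hv, hv, shearField]
  module

end Shear

/-- The conditions at a point on a map `G` to the sphere and a field `N` along it, with
derivatives `G'` and `N'`, under which the rays through `G + t i N` form a Legendrian immersion. -/
structure IsHamiltonianAt (G N : C3) (G' N' : Plane →L[ℝ] C3) : Prop where
  symm : ∀ v, inner ℝ G (N' v) = (inner ℝ N (G' v) : ℝ)
  lag : ∀ v, inner ℝ N (mulI (N' v)) = (0 : ℝ)
  proportional : ∀ (t a : ℝ) (v : Plane),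
    G' v + t • mulI (N' v) = a • (G + t • mulI N) → N' v = a • N
  ne_zero : ∀ t : ℝ, G + t • mulI N ≠ 0

theorem IsHamiltonianAt.of_zero {G : C3} (hG : G ≠ 0) (G' : Plane →L[ℝ] C3) :
    IsHamiltonianAt G 0 G' 0 where
  symm v := by simp
  lag v := by simp
  proportional t a v _ := by simp
  ne_zero t := by simpa using hG

/-- The shear field and its derivatives lie in the span of the Lagrangian frame `b`, so their
multiples by `i` have zero coordinates with respect to `b`. The motion `G + t i N` therefore keeps
all the coordinates `⟪·, b_j⟫` fixed; this yields the Lagrangian condition, the nonvanishing and the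
proportionality for every `t`. -/
theorem isHamiltonianAt_shearField {h : ℝ → ℝ} {b : Fin 3 → C3} (hh : ContDiff ℝ ∞ h)
    (hb : ∀ i j, inner ℝ (b i) (mulI (b j)) = (0 : ℝ)) {G : C3}
    (hG : (inner ℝ G (b 0) : ℝ) ≠ 0) (G' : Plane →L[ℝ] C3) :
    IsHamiltonianAt G (shearField h b G) G' ((fderiv ℝ (shearField h b) G).comp G') := by
  have hN : ∀ j, inner ℝ (mulI (shearField h b G)) (b j) = (0 : ℝ) := by
    intro j
    rw [inner_mulI_left, shearField]
    simp only [inner_add_left, inner_smul_left, hb, mul_zero, add_zero, neg_zero]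
  have hD : ∀ v j, inner ℝ (mulI (fderiv ℝ (shearField h b) G v)) (b j) = (0 : ℝ) := by
    intro v j
    rw [inner_mulI_left, fderiv_shearField hh hG]
    simp only [inner_add_left, inner_smul_left, hb, mul_zero, add_zero, neg_zero]
  refine ⟨fun v => inner_fderiv_shearField hh hG _, fun v => ?_, fun t a v hv => ?_, fun t ht => ?_⟩
  · rw [real_inner_comm, shearField]
    simp only [inner_add_right, inner_smul_right, ContinuousLinearMap.comp_apply, hD, mul_zero,
      add_zero]
  · refine fderiv_shearField_of_proportional hh hG fun j => ?_
    have := congrArg (fun w : C3 => (inner ℝ w (b j) : ℝ)) hv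
    simp only [inner_add_left, inner_smul_left, hN, ContinuousLinearMap.comp_apply, hD, mul_zero,
      add_zero, conj_trivial] at this
    exact this
  · have := congrArg (fun w : C3 => (inner ℝ w (b 0) : ℝ)) ht
    simp only [inner_add_left, inner_smul_left, hN, mul_zero, add_zero, inner_zero_left] at this
    exact hG this

/-- Radial projection of `C3 \ 0` to the unit sphere. -/
noncomputable def normalize (w : C3) : C3 := ‖w‖⁻¹ • w

theorem contDiffAt_normalize {w : C3} (hw : w ≠ 0) : ContDiffAt ℝ ∞ normalize w :=
  ((contDiffAt_norm ℝ hw).inv (norm_ne_zero_iff.2 hw)).smul contDiffAt_id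

/-- Radial projection only rescales the derivative and subtracts a radial multiple, so contact and
immersion conditions can be checked before projecting. -/
theorem fderiv_normalize_comp {E : Type*} [NormedAddCommGroup E] [NormedSpace ℝ E] {Y : E → C3}
    {p : E} (hY : DifferentiableAt ℝ Y p) (h0 : Y p ≠ 0) (v : E) :
    ∃ a : ℝ, fderiv ℝ (fun q => normalize (Y q)) p v
      = ‖Y p‖⁻¹ • (fderiv ℝ Y p v - a • Y p) := by
  have h1 : DifferentiableAt ℝ (fun q => ‖Y q‖⁻¹) p :=
    (hY.norm ℝ h0).inv (norm_ne_zero_iff.2 h0)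
  refine ⟨-(‖Y p‖ * fderiv ℝ (fun q => ‖Y q‖⁻¹) p v), ?_⟩
  have h2 : fderiv ℝ (fun q => normalize (Y q)) p v
      = ‖Y p‖⁻¹ • fderiv ℝ Y p v + fderiv ℝ (fun q => ‖Y q‖⁻¹) p v • Y p := by
    have := (h1.hasFDerivAt.smul hY.hasFDerivAt).fderiv
    exact congrArg (fun L : E →L[ℝ] C3 => L v) this
  rw [h2, neg_smul, sub_neg_eq_add, smul_add, smul_smul, ← mul_assoc,
    inv_mul_cancel₀ (norm_ne_zero_iff.2 h0), one_mul]

theorem fderiv_shear {G N : Plane → C3} {p : Plane} (hG : DifferentiableAt ℝ G p)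
    (hN : DifferentiableAt ℝ N p) (t : ℝ) (v : Plane) :
    fderiv ℝ (fun q => G q + t • mulI (N q)) p v
      = fderiv ℝ G p v + t • mulI (fderiv ℝ N p v) := by
  have := (hG.hasFDerivAt.add ((mulI.hasFDerivAt.comp p hN.hasFDerivAt).const_smul t)).fderiv
  exact congrArg (fun L : Plane →L[ℝ] C3 => L v) this

namespace IsHamiltonianAt

variable {G N : Plane → C3} {p : Plane}
  (hH : IsHamiltonianAt (G p) (N p) (fderiv ℝ G p) (fderiv ℝ N p))
  (hG : DifferentiableAt ℝ G p) (hN : DifferentiableAt ℝ N p)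
include hH hG hN

/-- In `⟪i(G + tiN), G' + tiN'⟫` the constant term is the contact condition of `G`, the linear term
vanishes by `symm`, and the quadratic one by `lag`. -/
theorem contact_normalize (t : ℝ) (v : Plane)
    (hc : inner ℝ (mulI (G p)) (fderiv ℝ G p v) = (0 : ℝ)) :
    inner ℝ (mulI (normalize (G p + t • mulI (N p))))
      (fderiv ℝ (fun q => normalize (G q + t • mulI (N q))) p v) = (0 : ℝ) := by
  obtain ⟨a, ha⟩ := fderiv_normalize_comp (Y := fun q => G q + t • mulI (N q))
    (hG.add ((mulI.differentiableAt.comp p hN).const_smul t)) (hH.ne_zero t) v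
  have hself : ∀ w : C3, inner ℝ (mulI w) w = (0 : ℝ) := fun w => by
    rw [real_inner_comm, inner_mulI_self]
  have h1 : inner ℝ (mulI (G p + t • mulI (N p)))
      (fderiv ℝ G p v + t • mulI (fderiv ℝ N p v)) = (0 : ℝ) := by
    have e1 := hH.symm v
    have e2 := hH.lag v
    simp only [map_add, map_smul, mulI_mulI, inner_add_left, inner_add_right, inner_smul_left,
      inner_smul_right, inner_neg_left, inner_mulI_mulI, hc, e1, e2, conj_trivial]
    ring
  rw [ha, fderiv_shear hG hN, normalize, map_smul, inner_smul_left, inner_smul_right,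
    inner_sub_right, inner_smul_right, hself, h1]
  simp

/-- A kernel vector makes the derivative of `G + tiN` radial, so `proportional` forces `G'v = a G`;
since `G'v` is orthogonal to the unit vector `G`, the factor `a` is zero. -/
theorem eq_zero_of_fderiv_normalize (t : ℝ) {v : Plane}
    (h1 : inner ℝ (G p) (G p) = (1 : ℝ)) (h0 : inner ℝ (G p) (fderiv ℝ G p v) = (0 : ℝ))
    (hv : fderiv ℝ (fun q => normalize (G q + t • mulI (N q))) p v = 0) :
    fderiv ℝ G p v = 0 := by
  obtain ⟨a, ha⟩ := fderiv_normalize_comp (Y := fun q => G q + t • mulI (N q))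
    (hG.add ((mulI.differentiableAt.comp p hN).const_smul t)) (hH.ne_zero t) v
  rw [ha, fderiv_shear hG hN, smul_eq_zero, inv_eq_zero, norm_eq_zero, sub_eq_zero] at hv
  have hv' := hv.resolve_left (hH.ne_zero t)
  have hN' := hH.proportional t a v hv'
  rw [hN', map_smul, smul_add, smul_comm t a] at hv'
  have hG' : fderiv ℝ G p v = a • G p := add_right_cancel hv'
  rw [hG', inner_smul_right, h1, mul_one] at h0
  rw [hG', h0, zero_smul]

end IsHamiltonianAt

/-! ### Legendrian deformations obtained from shears -/

section ShearVariation

variable {M : Type*} [TopologicalSpace M] [ChartedSpace Plane M]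

theorem eventuallyEq_inChart {G : Type*} {g k : M → G} {x : M} (hgk : g =ᶠ[nhds x] k) :
    g ∘ (extChartAt (𝓡 2) x).symm =ᶠ[nhds (extChartAt (𝓡 2) x x)]
      k ∘ (extChartAt (𝓡 2) x).symm := by
  have h1 : Filter.Tendsto (extChartAt (𝓡 2) x).symm (nhds (extChartAt (𝓡 2) x x)) (nhds x) := by
    have := continuousAt_extChartAt_symm (I := 𝓡 2) x
    rwa [ContinuousAt, extChartAt_to_inv] at this
  exact h1.eventually hgk

/-- The velocity is `iN` up to a multiple of `f`, and that multiple is orthogonal to `if`. -/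
theorem inner_variationField_normalize {f N : M → C3} (hf : IsLegendrianImmersion f) (x : M) :
    inner ℝ (variationField (fun t x => normalize (f x + t • mulI (N x))) x) (mulI (f x))
      = (inner ℝ (N x) (f x) : ℝ) := by
  have h1 : ‖f x‖ = 1 := mem_sphere_zero_iff_norm.1 (hf.mem_sphere x)
  have h0 : f x + (0 : ℝ) • mulI (N x) = f x := by simp
  have hY : HasDerivAt (fun t : ℝ => f x + t • mulI (N x)) (mulI (N x)) 0 := by
    simpa using ((hasDerivAt_id (0 : ℝ)).smul_const (mulI (N x))).const_add (f x)
  obtain ⟨a, ha⟩ := fderiv_normalize_comp hY.differentiableAt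
    (by rw [h0, ← norm_ne_zero_iff, h1]; exact one_ne_zero) 1
  rw [variationField, ← fderiv_apply_one_eq_deriv, ha, h0, h1, fderiv_apply_one_eq_deriv, hY.deriv,
    inv_one, one_smul, inner_sub_left, inner_smul_left, inner_mulI_self, mul_zero, sub_zero,
    inner_mulI_mulI]

theorem contMDiff_normalize {f N : M → C3} (hf : ContMDiff (𝓡 2) 𝓘(ℝ, C3) ∞ f)
    (hN : ContMDiff (𝓡 2) 𝓘(ℝ, C3) ∞ N) (h0 : ∀ (t : ℝ) (x : M), f x + t • mulI (N x) ≠ 0) :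
    ContMDiff (𝓘(ℝ, ℝ).prod (𝓡 2)) 𝓘(ℝ, C3) ∞
      (fun z : ℝ × M => normalize (f z.2 + z.1 • mulI (N z.2))) := by
  have h1 : ContMDiff (𝓘(ℝ, ℝ).prod (𝓡 2)) 𝓘(ℝ, C3) ∞
      (fun z : ℝ × M => f z.2 + z.1 • mulI (N z.2)) :=
    (hf.comp contMDiff_snd).add (contMDiff_fst.smul
      ((mulI.contDiff.contMDiff.comp hN).comp contMDiff_snd))
  intro z
  have h2 : ContMDiffAt 𝓘(ℝ, C3) 𝓘(ℝ, C3) ∞ normalize (f z.2 + z.1 • mulI (N z.2)) :=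
    (contDiffAt_normalize (h0 z.1 z.2)).contMDiffAt
  exact ContMDiffAt.comp (g := normalize) (f := fun z : ℝ × M => f z.2 + z.1 • mulI (N z.2))
    z h2 (h1 z)

variable [IsManifold (𝓡 2) ∞ M]

theorem differentiableAt_inChart {g : M → C3} (hg : ContMDiff (𝓡 2) 𝓘(ℝ, C3) ∞ g) (x : M) :
    DifferentiableAt ℝ (inChart g x) (extChartAt (𝓡 2) x x) :=
  (contDiffOn_comp_extChartAt_symm hg x).differentiableAt_of_isOpen (isOpen_extChartAt_target x)
    (mem_extChartAt_target x)

theorem isLegendrianImmersion_normalize {f N : M → C3} (hf : IsLegendrianImmersion f)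
    (hN : ContMDiff (𝓡 2) 𝓘(ℝ, C3) ∞ N)
    (hH : ∀ x, IsHamiltonianAt (f x) (N x) (fderiv ℝ (inChart f x) (extChartAt (𝓡 2) x x))
      (fderiv ℝ (inChart N x) (extChartAt (𝓡 2) x x))) (t : ℝ) :
    IsLegendrianImmersion fun x => normalize (f x + t • mulI (N x)) := by
  have hslice : ContMDiff (𝓡 2) 𝓘(ℝ, C3) ∞ (fun x => normalize (f x + t • mulI (N x))) :=
    ContMDiff.comp (g := fun z : ℝ × M => normalize (f z.2 + z.1 • mulI (N z.2)))
      (f := fun x : M => (t, x)) (contMDiff_normalize hf.smooth hN fun t x => (hH x).ne_zero t)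
      (contMDiff_const.prodMk contMDiff_id)
  have hfd : ∀ x : M, mfderiv (𝓡 2) 𝓘(ℝ, C3)
      (fun x => normalize (f x + t • mulI (N x))) x = fderiv ℝ
        (fun q => normalize (inChart f x q + t • mulI (inChart N x q)))
          (extChartAt (𝓡 2) x x) := fun x =>
    mfderiv_eq_fderiv_inChart (hslice.mdifferentiableAt (by simp))
  have hself : ∀ (g : M → C3) (x : M), inChart g x (extChartAt (𝓡 2) x x) = g x := fun g x =>
    inChart_extChartAt g (mem_extChartAt_source x)
  have hH' : ∀ x, IsHamiltonianAt (inChart f x (extChartAt (𝓡 2) x x))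
      (inChart N x (extChartAt (𝓡 2) x x)) (fderiv ℝ (inChart f x) (extChartAt (𝓡 2) x x))
      (fderiv ℝ (inChart N x) (extChartAt (𝓡 2) x x)) := fun x => by
    rw [hself, hself]
    exact hH x
  have himm : ∀ x, ∀ v : Plane, fderiv ℝ
        (fun q => normalize (inChart f x q + t • mulI (inChart N x q)))
          (extChartAt (𝓡 2) x x) v = 0 → v = 0 := by
    intro x v hv
    have h1 := (hH' x).eq_zero_of_fderiv_normalize (differentiableAt_inChart hf.smooth x)
      (differentiableAt_inChart hN x) t (hf.inner_inChart x _)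
      ((hf.inChart x).inner_dd v (mem_extChartAt_target x)) hv
    exact hf.fderiv_inChart_injective x (mem_extChartAt_target x) (h1.trans (map_zero _).symm)
  have hiso : ∀ x, ∀ v : Plane, contactForm (normalize (f x + t • mulI (N x))) (fderiv ℝ
        (fun q => normalize (inChart f x q + t • mulI (inChart N x q)))
          (extChartAt (𝓡 2) x x) v) = 0 := by
    intro x v
    have h1 := (hH' x).contact_normalize (differentiableAt_inChart hf.smooth x)
      (differentiableAt_inChart hN x) t v (by
        have := hf.contact_inChart x (mem_extChartAt_target x) v
        rwa [inner_mulI_right, neg_eq_zero] at this)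
    rw [hself, hself] at h1
    exact h1
  refine ⟨hslice, fun x => ?_, fun x => ?_, fun x v => ?_⟩
  · rw [mem_sphere_zero_iff_norm, normalize, norm_smul, norm_inv, norm_norm,
      inv_mul_cancel₀ (norm_ne_zero_iff.2 ((hH x).ne_zero t))]
  · rw [hfd]
    exact (injective_iff_map_eq_zero (fderiv ℝ
      (fun q => normalize (inChart f x q + t • mulI (inChart N x q)))
          (extChartAt (𝓡 2) x x))).2 (himm x)
  · rw [hfd]
    exact hiso x v

theorem isLegendrianVariation_normalize {f N : M → C3} {K : Set M} (hf : IsLegendrianImmersion f)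
    (hN : ContMDiff (𝓡 2) 𝓘(ℝ, C3) ∞ N)
    (hH : ∀ x, IsHamiltonianAt (f x) (N x) (fderiv ℝ (inChart f x) (extChartAt (𝓡 2) x x))
      (fderiv ℝ (inChart N x) (extChartAt (𝓡 2) x x)))
    (hK : ∀ x ∉ K, N x = 0) (ε : ℝ) :
    IsLegendrianVariation f ε K fun t x => normalize (f x + t • mulI (N x)) := by
  have hfn : ∀ x, normalize (f x) = f x := fun x => by
    rw [normalize, mem_sphere_zero_iff_norm.1 (hf.mem_sphere x), inv_one, one_smul]
  refine ⟨(contMDiff_normalize hf.smooth hN fun t x => (hH x).ne_zero t).contMDiffOn, ?_,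
    fun t _ => isLegendrianImmersion_normalize hf hN hH t, fun t _ x hx => ?_⟩
  · ext1 x
    simp only [zero_smul, add_zero, hfn]
  · simp only [hK x hx, map_zero, smul_zero, add_zero, hfn]

end ShearVariation

/-! ### Tools for localization near a point -/

theorem setIntegral_closedBall_pos {p : Plane} {r : ℝ} (hr : 0 < r) {g : Plane → ℝ}
    (hg : ContinuousOn g (Metric.closedBall p r)) (h0 : ∀ q ∈ Metric.closedBall p r, 0 ≤ g q)
    (hp : 0 < g p) : 0 < ∫ q in Metric.closedBall p r, g q := by
  have hm : MeasurableSet (Metric.closedBall p r) := Metric.isClosed_closedBall.measurableSet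
  rw [setIntegral_pos_iff_support_of_nonneg_ae ((ae_restrict_mem hm).mono h0)
    (hg.integrableOn_compact (isCompact_closedBall p r))]
  have h1 : Metric.closedBall p r ∈ nhds p := Metric.closedBall_mem_nhds p hr
  have h2 : ∀ᶠ q in nhds p, 0 < g q := (hg.continuousAt h1).eventually (lt_mem_nhds hp)
  refine Measure.measure_pos_of_mem_nhds volume (x := p) ?_
  filter_upwards [h1, h2] with q hq hq2 using ⟨hq2.ne', hq⟩

theorem exists_smooth_cutoff {σ : ℝ} (hσ : 0 < σ) :
    ∃ h : ℝ → ℝ, ContDiff ℝ ∞ h ∧ (∀ s, 0 ≤ h s) ∧ 0 < h 0 ∧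
      ∀ s, σ < s → h s = 0 ∧ deriv h s = 0 := by
  refine ⟨fun s => Real.smoothTransition (σ - s),
    Real.smoothTransition.contDiff.comp (contDiff_const.sub contDiff_id),
    fun s => Real.smoothTransition.nonneg _, ?_, fun s hs => ?_⟩
  · beta_reduce
    rw [sub_zero]
    exact Real.smoothTransition.pos_of_pos hσ
  · have h1 : (fun s => Real.smoothTransition (σ - s)) =ᶠ[nhds s] fun _ => 0 :=
      Filter.eventuallyEq_of_mem (isOpen_Ioi.mem_nhds hs) fun u hu =>
        Real.smoothTransition.zero_of_nonpos (sub_nonpos.2 (le_of_lt hu))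
    exact ⟨h1.eq_of_nhds, by rw [h1.deriv_eq, deriv_const]⟩

/-- The vectors `F, ∂₁F, ∂₂F` at `p`. -/
noncomputable def baseFrame (F : Plane → C3) (p : Plane) : Fin 3 → C3 :=
  ![F p, frame F coordVec 0 p, frame F coordVec 1 p]

namespace IsLegendrianOn

variable {G : Plane → C3} {U : Set Plane} (hG : IsLegendrianOn G coordVec U) {p : Plane}
  (hp : p ∈ U)
include hG hp

theorem inner_mulI_baseFrame (i j : Fin 3) :
    inner ℝ (baseFrame G p i) (mulI (baseFrame G p j)) = (0 : ℝ) := by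
  have hc : ∀ i, inner ℝ (frame G coordVec i p) (mulI (G p)) = (0 : ℝ) := fun i => by
    rw [inner_mulI_right, real_inner_comm, hG.contact p hp, neg_zero]
  fin_cases i <;> fin_cases j <;>
    simp [baseFrame, inner_mulI_self, hG.contact p hp, hc, hG.frame_lag _ _ hp]

/-- The coordinates `X₁, X₂` of the immersion along its own tangent plane at `p` have injective
differential there, so they do not both vanish at nearby points other than `p`. A cutoff in the
slope is therefore a cutoff on the surface. -/
theorem eventually_slope_pos (hinj : Function.Injective (fderiv ℝ G p)) :
    ∀ᶠ q in nhds p, q ≠ p → 0 < slope (baseFrame G p) (G q) := by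
  have hd : HasFDerivAt G (fderiv ℝ G p) p := (hG.differentiableAt hp hG.smooth).hasFDerivAt
  have hX : ∀ i : Fin 2, HasFDerivAt (fun q => (inner ℝ (frame G coordVec i p) (G q) : ℝ))
      ((innerSL ℝ (frame G coordVec i p)).comp (fderiv ℝ G p)) p := fun i =>
    (innerSL ℝ (frame G coordVec i p)).hasFDerivAt.comp p hd
  have hP := (hX 0).prodMk (hX 1)
  have hinj' : Function.Injective (((innerSL ℝ (frame G coordVec 0 p)).comp (fderiv ℝ G p)).prod
      ((innerSL ℝ (frame G coordVec 1 p)).comp (fderiv ℝ G p))) := by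
    rw [injective_iff_map_eq_zero]
    intro v hv
    have h0 : inner ℝ (frame G coordVec 0 p) (fderiv ℝ G p v) = (0 : ℝ) := congrArg Prod.fst hv
    have h1 : inner ℝ (frame G coordVec 1 p) (fderiv ℝ G p v) = (0 : ℝ) := congrArg Prod.snd hv
    refine hinj ((inner_self_eq_zero (𝕜 := ℝ)).1 ?_ |>.trans (map_zero _).symm)
    have hv' : fderiv ℝ G p v = v 0 • frame G coordVec 0 p + v 1 • frame G coordVec 1 p := by
      conv_lhs => rw [plane_eq_sum v, map_sum, Fin.sum_univ_two, map_smul, map_smul]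
      rfl
    nth_rewrite 1 [hv']
    rw [inner_add_left, inner_smul_left, inner_smul_left, h0, h1, mul_zero, mul_zero, add_zero]
  obtain ⟨C, hC, hanti⟩ := (LinearMap.injective_iff_antilipschitz
    (((innerSL ℝ (frame G coordVec 0 p)).comp (fderiv ℝ G p)).prod
      ((innerSL ℝ (frame G coordVec 1 p)).comp (fderiv ℝ G p))).toLinearMap).1 hinj'
  have hne := hP.eventually_ne (c := ((0 : ℝ), (0 : ℝ))) ⟨C, hanti⟩
  have h00 : ∀ᶠ q in nhds p, (0 : ℝ) < inner ℝ (G q) (G p) := by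
    have hcont : ContinuousAt (fun q => (inner ℝ (G q) (G p) : ℝ)) p :=
      hd.continuousAt.inner continuousAt_const
    exact hcont.eventually (lt_mem_nhds (by beta_reduce; rw [hG.norm p hp]; exact one_pos))
  rw [eventually_nhdsWithin_iff] at hne
  filter_upwards [hne, h00] with q hq hq0 hqp
  have h1 := hq hqp
  refine div_pos ?_ (pow_pos hq0 2)
  by_contra hle
  have h2 := sq_nonneg (inner ℝ (G q) (baseFrame G p 1) : ℝ)
  have h3 := sq_nonneg (inner ℝ (G q) (baseFrame G p 2) : ℝ)
  have e1 : (inner ℝ (G q) (baseFrame G p 1) : ℝ) = 0 := by nlinarith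
  have e2 : (inner ℝ (G q) (baseFrame G p 2) : ℝ) = 0 := by nlinarith
  rw [real_inner_comm] at e1 e2
  exact h1 (Prod.ext e1 e2)

theorem slope_self : slope (baseFrame G p) (G p) = 0 := by
  have h : ∀ i, inner ℝ (G p) (frame G coordVec i p) = (0 : ℝ) := fun i => hG.inner_dd _ hp
  simp [slope, baseFrame, h]

end IsLegendrianOn

/-! ### Bump deformations and the Euler-Lagrange equation -/

section Stationary

variable {M : Type*} [TopologicalSpace M] [ChartedSpace Plane M] [IsManifold (𝓡 2) ∞ M]

/-- A field along a Legendrian immersion which is locally either zero or a shear field is the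
variational field of a Legendrian deformation. -/
theorem exists_legendrianVariation {f N : M → C3} (hf : IsLegendrianImmersion f) {h : ℝ → ℝ}
    (hh : ContDiff ℝ ∞ h) {b : Fin 3 → C3} (hb : ∀ i j, inner ℝ (b i) (mulI (b j)) = (0 : ℝ))
    {K : Set M} (hK : IsClosed K) (hN0 : ∀ x ∉ K, N x = 0)
    (hN : ∀ x ∈ K, (inner ℝ (f x) (b 0) : ℝ) ≠ 0 ∧ N =ᶠ[nhds x] shearField h b ∘ f) (ε : ℝ) :
    IsLegendrianVariation f ε K fun t x => normalize (f x + t • mulI (N x)) := by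
  have hNc : ∀ x ∉ K, N =ᶠ[nhds x] fun _ => 0 := fun x hx =>
    Filter.eventuallyEq_of_mem (hK.isOpen_compl.mem_nhds hx) hN0
  refine isLegendrianVariation_normalize hf (fun x => ?_) (fun x => ?_) hN0 ε
  · by_cases hx : x ∈ K
    · exact (ContMDiffAt.comp (g := shearField h b) (f := f) x
        (contDiffAt_shearField hh (hN x hx).1).contMDiffAt (hf.smooth x)).congr_of_eventuallyEq
          (hN x hx).2
    · exact contMDiffAt_const.congr_of_eventuallyEq (hNc x hx)
  · by_cases hx : x ∈ K
    · have h1 : inChart N x =ᶠ[nhds (extChartAt (𝓡 2) x x)] shearField h b ∘ inChart f x :=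
        eventuallyEq_inChart (hN x hx).2
      have h2 : inChart f x (extChartAt (𝓡 2) x x) = f x :=
        inChart_extChartAt f (mem_extChartAt_source x)
      rw [h1.fderiv_eq, (hN x hx).2.eq_of_nhds, fderiv_comp _ (by
        rw [h2]
        exact (contDiffAt_shearField hh (hN x hx).1).differentiableAt (by simp))
        (differentiableAt_inChart hf.smooth x), h2]
      exact isHamiltonianAt_shearField hh hb (hN x hx).1 _
    · have h1 : inChart N x =ᶠ[nhds (extChartAt (𝓡 2) x x)] fun _ => 0 :=
        eventuallyEq_inChart (hNc x hx)
      rw [h1.fderiv_eq, hN0 x hx, fderiv_fun_const]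
      refine IsHamiltonianAt.of_zero ?_ _
      rw [← norm_ne_zero_iff, mem_sphere_zero_iff_norm.1 (hf.mem_sphere x)]
      exact one_ne_zero

variable [T2Space M]

/-- Around every point of a Legendrian surface there are deformations with small support and
nonnegative contact Hamiltonian. -/
theorem IsLegendrianImmersion.exists_variation {f : M → C3} (hf : IsLegendrianImmersion f) {c : M}
    {p : Plane} (hp : p ∈ (extChartAt (𝓡 2) c).target) {P : Plane → Prop}
    (hP : ∀ᶠ q in nhds p, P q) :
    ∃ (r : ℝ) (F : ℝ → M → C3), 0 < r ∧
      Metric.closedBall p r ⊆ (extChartAt (𝓡 2) c).target ∧ (∀ q ∈ Metric.closedBall p r, P q) ∧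
      IsLegendrianVariation f 1 ((extChartAt (𝓡 2) c).symm '' Metric.closedBall p r) F ∧
      (∀ q ∈ Metric.closedBall p r, 0 ≤ (inner ℝ (LegendrianSurface.inChart (variationField F) c q)
        (mulI (LegendrianSurface.inChart f c q)) : ℝ)) ∧
      0 < (inner ℝ (LegendrianSurface.inChart (variationField F) c p)
        (mulI (LegendrianSurface.inChart f c p)) : ℝ) := by
  have hG := hf.inChart c
  set G := LegendrianSurface.inChart f c with hGdef
  set b := baseFrame G p with hb
  have hU := isOpen_extChartAt_target (I := 𝓡 2) c
  have hdG := hG.differentiableAt hp hG.smooth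
  have hX : ∀ᶠ q in nhds p, (0 : ℝ) < inner ℝ (G q) (b 0) := by
    have hcont : ContinuousAt (fun q => (inner ℝ (G q) (b 0) : ℝ)) p :=
      hdG.continuousAt.inner continuousAt_const
    refine hcont.eventually (lt_mem_nhds ?_)
    exact one_pos.trans_eq (hG.norm p hp).symm
  -- On this ball `X₀` is positive, `P` holds and the slope vanishes at most at the centre; the
  -- deformation will be supported in the ball of half the radius.
  obtain ⟨r, hr, hball⟩ := Metric.nhds_basis_closedBall.eventually_iff.1
    (((hU.eventually_mem hp).and
    hX).and (hP.and (hG.eventually_slope_pos hp (hf.fderiv_inChart_injective c hp))))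
  have hball' : ∀ q ∈ Metric.closedBall p (r / 2), q ∈ Metric.closedBall p r := fun q hq =>
    Metric.closedBall_subset_closedBall (by linarith) hq
  have hscont : ContinuousOn (fun q => slope b (G q)) (Metric.closedBall p r) := fun q hq =>
    ((contDiffAt_slope (hball hq).1.2.ne').continuousAt.comp
      (hG.differentiableAt (hball hq).1.1 hG.smooth).continuousAt).continuousWithinAt
  -- A positive lower bound `a` for the slope on the closed ball minus the open ball of radius `r /
  -- 2`, by compactness. With a cutoff vanishing beyond `a / 2`, the shear field is zero on this
  -- shell.
  obtain ⟨a, ha, hs⟩ := ((isCompact_closedBall p r).diff (Metric.isOpen_ball (x := p)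
    (ε := r / 2))).exists_forall_le' (hscont.mono sdiff_subset) (a := 0) fun q hq =>
      (hball hq.1).2.2 fun h => hq.2 (h ▸ Metric.mem_ball_self (by linarith))
  obtain ⟨h, hh, hh0, hhp, hhs⟩ := exists_smooth_cutoff (half_pos ha)
  classical
  set O : Set M := (extChartAt (𝓡 2) c).source ∩ extChartAt (𝓡 2) c ⁻¹' Metric.ball p r with hO
  have hOopen : IsOpen O := (continuousOn_extChartAt c).isOpen_inter_preimage
    (isOpen_extChartAt_source c) Metric.isOpen_ball
  set K : Set M := (extChartAt (𝓡 2) c).symm '' Metric.closedBall p (r / 2) with hKdef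
  have hK : IsCompact K := (isCompact_closedBall p (r / 2)).image_of_continuousOn
    ((continuousOn_extChartAt_symm c).mono fun q hq => (hball (hball' q hq)).1.1)
  -- The slope may be small again far away on the surface, so the shear field is used only on `O`,
  -- which contains `K`. It vanishes on `O \ K`, hence the extension by zero is smooth.
  set N : M → C3 := O.indicator (shearField h b ∘ f) with hNdef
  have hKO : ∀ q ∈ Metric.closedBall p (r / 2), (extChartAt (𝓡 2) c).symm q ∈ O := by
    intro q hq
    have hqt := (hball (hball' q hq)).1.1
    refine ⟨(extChartAt (𝓡 2) c).map_target hqt, ?_⟩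
    rw [mem_preimage, (extChartAt (𝓡 2) c).right_inv hqt]
    exact Metric.closedBall_subset_ball (by linarith) hq
  have hN0 : ∀ x ∉ K, N x = 0 := by
    intro x hx
    by_cases hxO : x ∈ O
    · have hxK : extChartAt (𝓡 2) c x ∉ Metric.closedBall p (r / 2) := fun hq =>
        hx ⟨_, hq, (extChartAt (𝓡 2) c).left_inv hxO.1⟩
      have hge := hs (extChartAt (𝓡 2) c x) ⟨Metric.ball_subset_closedBall hxO.2,
        fun hq => hxK (Metric.ball_subset_closedBall hq)⟩
      have hGx : G (extChartAt (𝓡 2) c x) = f x := inChart_extChartAt f hxO.1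
      rw [hGx] at hge
      obtain ⟨e1, e2⟩ := hhs (slope b (f x)) (by linarith)
      rw [hNdef, indicator_of_mem hxO, Function.comp_apply, shearField, e1, e2]
      simp
    · exact indicator_of_notMem hxO _
  have hvar : IsLegendrianVariation f 1 K fun t x => normalize (f x + t • mulI (N x)) := by
    refine exists_legendrianVariation hf hh (hG.inner_mulI_baseFrame hp) hK.isClosed hN0 ?_ 1
    rintro _ ⟨q, hq, rfl⟩
    refine ⟨(hball (hball' q hq)).1.2.ne', ?_⟩
    exact Filter.eventuallyEq_of_mem (hOopen.mem_nhds (hKO q hq)) fun y hy => indicator_of_mem hy _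
  have hval : ∀ q ∈ Metric.closedBall p (r / 2), inner ℝ (LegendrianSurface.inChart
      (variationField fun t x => normalize (f x + t • mulI (N x))) c q) (mulI (G q))
      = 2 * inner ℝ (G q) (b 0) ^ 2 * h (slope b (G q)) := by
    intro q hq
    rw [← inner_shearField_self (hball (hball' q hq)).1.2.ne']
    refine (inner_variationField_normalize hf _).trans ?_
    rw [hNdef, indicator_of_mem (hKO q hq)]
    rfl
  refine ⟨r / 2, _, half_pos hr, fun q hq => (hball (hball' q hq)).1.1,
    fun q hq => (hball (hball' q hq)).2.1, hvar, fun q hq => ?_, ?_⟩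
  · rw [hval q hq]
    exact mul_nonneg (by positivity) (hh0 _)
  · have hpb : p ∈ Metric.closedBall p (r / 2) := Metric.mem_closedBall_self (by linarith)
    rw [hval p hpb, hG.slope_self hp]
    exact mul_pos (mul_pos two_pos (pow_pos (hball (hball' p hpb)).1.2 2)) hhp

variable [SecondCountableTopology M] [MeasurableSpace M] [BorelSpace M]

/-- The Euler-Lagrange equation of contact stationary Legendrian surfaces. -/
theorem IsCsL.isDivergenceFree {f : M → C3} (hf : IsCsL f) : IsDivergenceFree f := by
  intro c p hp
  by_contra hne
  have hG := hf.1.inChart c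
  have hU := isOpen_extChartAt_target (I := 𝓡 2) c
  set δ : Plane → ℝ := fun p => ∑ k, dd (coordVec k) (fun q => areaDensity (inChart f c) q
    * gradCoord (inChart f c) coordVec k q) p with hδ
  have hδc : ContinuousOn δ (extChartAt (𝓡 2) c).target := continuousOn_finsetSum _ fun k _ =>
    ((hG.density_smooth.mul (hG.gradCoord_smooth k)).dd hU (coordVec k)).continuousOn
  -- Multiplying by the value at `p` treats both signs of the divergence at once.
  have hδp : ∀ᶠ q in nhds p, 0 < δ p * δ q :=
    (continuousAt_const.mul (hδc.continuousAt (hU.mem_nhds hp))).eventually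
      (lt_mem_nhds (mul_self_pos.2 hne))
  obtain ⟨r, F, hr, hsub, hpos, hF, hu0, hup⟩ := hf.1.exists_variation hp hδp
  have hK : IsCompact ((extChartAt (𝓡 2) c).symm '' Metric.closedBall p r) :=
    (isCompact_closedBall p r).image_of_continuousOn ((continuousOn_extChartAt_symm c).mono hsub)
  have hKc : (extChartAt (𝓡 2) c).symm '' Metric.closedBall p r ⊆ (extChartAt (𝓡 2) c).source := by
    rintro _ ⟨q, hq, rfl⟩
    exact (extChartAt (𝓡 2) c).map_target (hsub hq)
  have hint := hf.setIntegral_contact_mul hF one_pos hK hKc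
  have himage : extChartAt (𝓡 2) c '' ((extChartAt (𝓡 2) c).symm '' Metric.closedBall p r)
      = Metric.closedBall p r := by
    rw [image_image]
    exact (image_congr fun q hq => (extChartAt (𝓡 2) c).right_inv (hsub hq)).trans (image_id' _)
  rw [himage] at hint
  have hV : ContDiffOn ℝ ∞ (inChart (variationField F) c) (extChartAt (𝓡 2) c).target :=
    contDiffOn_comp_extChartAt_symm (hF.contMDiff_variationField one_pos) c
  have hgt := setIntegral_closedBall_pos (p := p) hr (g := fun q => δ p * (1 / 2 * inner ℝ
      (inChart (variationField F) c q) (mulI (inChart f c q)) * δ q)) ?_ ?_ ?_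
  · rw [integral_const_mul, hint, mul_zero] at hgt
    exact lt_irrefl _ hgt
  · exact (continuousOn_const.mul (((continuousOn_const.mul (hV.inner ℝ
      (mulI.contDiff.comp_contDiffOn hG.smooth)).continuousOn)).mul hδc)).mono hsub
  · intro q hq
    have h1 := mul_nonneg (hu0 q hq) (hpos q hq).le
    nlinarith
  · have h1 := mul_pos hup (hpos p (Metric.mem_closedBall_self hr.le))
    nlinarith

end Stationary

end LegendrianSurface

/-! ### Conclusion -/

theorem proposition4p1 {M : Type*} [TopologicalSpace M]
    [ChartedSpace LegendrianSurface.Plane M] [IsManifold (𝓡 2) ∞ M]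
    [T2Space M] [SecondCountableTopology M] [MeasurableSpace M] [BorelSpace M]
    (f : M → LegendrianSurface.C3) (hf : LegendrianSurface.IsCsL f)
    (htrace : ∀ x : M, LegendrianSurface.traceTermAt f x = 0) :
    LegendrianSurface.IsCsLWillmore f :=
  ⟨hf.1, fun _ _ _ hε hK hF => hF.hasDerivAt_willmore hε hK hf.isDivergenceFree htrace⟩
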